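/- Let $d$ be a positive integer with $d\equiv 0\pmod 4$ and set $n_-=\lfloor d/16\rfloor+1$. Write $\widehat F(t)=\int_{\mathbb R^d}F(x)e^{-2\pi i\langle x,t\rangle}\,dx$. Then there exists a radial Schwartz function $F_-:\mathbb R^d\to\mathbb R$, say $F_-(x)=g(\|x\|)$, such that $$F_-(x)=(-1)^{\frac d4+1}\,\widehat{F_-}(x)\quad\text{for all }x\in\mathbb R^d,$$ $$g(\sqrt{2n_-})=0,\qquad g'(\sqrt{2n_-})\neq 0,$$ $$g(\sqrt{2m})=g'(\sqrt{2m})=0\quad\text{for all integers }m>n_-.$$ Moreover, $F_-$ can be chosen of the following form. There are a weakly holomorphic modular form $f$ (possibly zero) of weight $2-\frac d2$ for $\mathrm{SL}(2,\mathbb Z)$ and a weakly holomorphic modular form $\omega$ of weight $2-\frac d2$ for $\Gamma(2)$ such that, with $$\psi(z)=f(z)\log\lambda(z)+\omega(z)\qquad(\operatorname{Im} z>0),$$ one has $F_-(x)=U(\|x\|^2)$, where $U$ is holomorphic on a half-plane $\operatorname{Re}s>-\varepsilon$ for some $\varepsilon>0$ and $$U(s)=-4\sin^2\!\left(\frac{\pi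 s}2\right)\int_0^\infty\psi(it)\,e^{-\pi st}\,dt\qquad(\operatorname{Re}s>2n_-),$$ the integral being absolutely convergent. Here $\lambda=\theta_{10}^4/\theta_{00}^4$ with $\theta_{00}(z)=\sum_{k\in\mathbb Z}e^{\pi ik^2z}$ and $\theta_{10}(z)=\sum_{k\in\mathbb Z}e^{\pi i(k+\frac12)^2z}$, and $\log\lambda(z)=\int_0^z\frac{d\lambda/dw}{\lambda(w)}\,dw$ (along the straight segment) is the holomorphic logarithm of $\lambda$ on the upper half-plane that tends to $0$ at the cusp $0$; weakly holomorphic means holomorphic on the upper half-plane and meromorphic at all cusps. -/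

import Mathlib

open scoped UpperHalfPlane MatrixGroups ModularForm Manifold FourierTransform SchwartzMap

noncomputable section

namespace FourierEigen

/-- A weakly holomorphic modular form of weight `k` for a subgroup `Γ` of `SL(2, ℤ)`: holomorphic on
the upper half-plane, invariant under the weight `k` slash action of `Γ`, and with at most a pole at
every cusp (each translate under `SL(2, ℤ)` has at most exponential growth in `Im z` at `i∞`). -/
structure IsWeaklyHolomorphic (Γ : Subgroup SL(2, ℤ)) (k : ℤ) (f : ℍ → ℂ) : Prop where
  holo : MDifferentiable 𝓘(ℂ) 𝓘(ℂ) f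
  slash_eq : ∀ γ ∈ Γ, f ∣[k] γ = f
  cusps : ∀ γ : SL(2, ℤ), ∃ N : ℝ,
    (f ∣[k] γ) =O[UpperHalfPlane.atImInfty] fun z : ℍ ↦ Real.exp (2 * Real.pi * N * z.im)

/-- The theta constant `θ₁₀(z) = ∑ exp(π i (n + 1/2)² z)`; Mathlib's `jacobiTheta` is `θ₀₀`. -/
def theta10 (z : ℂ) : ℂ :=
  ∑' n : ℤ, Complex.exp (Real.pi * Complex.I * ((n : ℂ) + 1 / 2) ^ 2 * z)

/-- The modular `λ`-function `λ = θ₁₀⁴ / θ₀₀⁴`. -/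
def modularLambda (z : ℂ) : ℂ := theta10 z ^ 4 / jacobiTheta z ^ 4

/-- The holomorphic logarithm of `λ` on the upper half-plane that tends to `0 = log 1` at the
cusp `0`: the integral of `(dλ/dw) / λ` along the straight segment from `0` to `z`. -/
def logLambda (z : ℍ) : ℂ :=
  ∫ t in (0 : ℝ)..1, logDeriv modularLambda ((t : ℂ) * (z : ℂ)) * (z : ℂ)

/-- The integrand of `-i ∫_0^{i∞} ψ(z) exp(i π s z) dz` after the substitution `z = i t`. -/
def laplaceIntegrand (ψ : ℍ → ℂ) (s : ℂ) (t : ℝ) : ℂ :=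
  ψ (UpperHalfPlane.ofComplex (Complex.I * (t : ℂ))) * Complex.exp (-(Real.pi * s * (t : ℂ)))

/-- `U` is the holomorphic continuation, to a half-plane `Re s > -ε` with `ε > 0`, of
`s ↦ -4 sin(π s / 2)² ∫_0^∞ ψ(i t) exp(-π s t) dt`, the integral converging absolutely
for `Re s > σ`. -/
def IsLaplaceContinuation (ψ : ℍ → ℂ) (σ : ℝ) (U : ℂ → ℂ) : Prop :=
  (∃ ε : ℝ, 0 < ε ∧ DifferentiableOn ℂ U {s : ℂ | -ε < s.re}) ∧
  ∀ s : ℂ, σ < s.re →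
    MeasureTheory.IntegrableOn (laplaceIntegrand ψ s) (Set.Ioi 0) ∧
    U s = -4 * Complex.sin (Real.pi / 2 * s) ^ 2 * ∫ t in Set.Ioi (0 : ℝ), laplaceIntegrand ψ s t

end FourierEigen

end

noncomputable section

namespace FourierEigen

open Complex Filter Topology Asymptotics

/-! ### Fourth powers of theta constants -/

/-! Write `d = 4e`. The function is a contour integral of Gaussians `exp(πi‖x‖²z)` weighted by `ψ =
f log λ + ω`, and the theorem splits into finding `ψ` and reading off the properties of the
integral.

Analysis. Put `ψS(z) = z^(2e-2) ψ(-1/z)`. Since `-4 sin²(πs/2) = e^(πis) + e^(-πis) - 2`, the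
Laplace expression is a combination of integrals of `ψ` along `0 → i∞` with the exponential shifted
by `±1` and `0`. Each path is bent at `i`. Above `i` the second difference of `ψ` collapses to `-2
ψS`, because `ψ(z+1) = ψ - ψS + πi f` and `ψS(z+1) = -ψS`. Below `i` there remain arcs from `-1`,
`1` and `0` to `i`, on which `z ↦ -1/z` again brings in `ψS`. If `ψS` decays like `exp(-π Im z)`,
all pieces converge for `Re s > -1/2`, which gives the continuation `contU`
(`LaplaceKernel.contU_eq`). The Fourier transform sends the Gaussian with parameter `z` to
`(i/z)^(2e)` times the one with parameter `-1/z`. This interchanges the arc at `0` with the ray and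
the arcs at `±1` with each other, so `contU` is an eigenfunction (`fourier_contU`). As `ψ(it)` grows
exactly like `exp(2πnt)`, its Laplace transform has a simple pole at `s = 2n` and is regular to the
right. The double zeros of `sin²` turn this into a simple zero at `2n` and zeros of order at least
two at `2m` for `m > n`.

Algebra. Dividing by powers of `θ₀₀⁴` and of `θ₁₀⁴θ₀₀⁴θ₀₁⁴` makes everything a polynomial in `λ`:
`f` comes from a level one polynomial `p`, and `ω` and its image under `z ↦ -1/z` from `polyOmega A
B` and `polyPhi A B` with `A`, `B` of level one. Decay of `ψS` says that `p log(1-λ) + polyPhi A B`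
vanishes to order `2n+1` at `λ = 0`; the growth rate of `ψ` says `A(0) ≠ B(0)`. The symmetry `λ ↦
λ/(λ-1)` makes the even coefficients harmless, so only `n` linear conditions remain, and the
dimensions of the level one spaces exceed `n` (`exists_polynomial_data`).

The nonvanishing is the delicate point. If `A(0) = B(0)`, then both vanish at `0`, and a Wronskian
of the triple `(p, A, B)` under the Serre derivative is a level one form that vanishes to too high
an order at the cusp, so it is zero. This would express a combination of `log λ` and `log(1-λ)` as a
rational function of `λ`, which residues forbid (`eq_zero_of_vanishing`, `no_residue`). -/

/-- `θ₁₀⁴`. -/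
def thetaU (z : ℂ) : ℂ := theta10 z ^ 4

/-- `θ₀₀⁴`. -/
def thetaV (z : ℂ) : ℂ := jacobiTheta z ^ 4

/-- `θ₀₁⁴`. -/
def thetaW (z : ℂ) : ℂ := jacobiTheta (z + 1) ^ 4

lemma modularLambda_eq (z : ℂ) : modularLambda z = thetaU z / thetaV z := rfl

lemma theta10_eq (z : ℂ) :
    theta10 z = cexp (Real.pi * I * z / 4) * jacobiTheta₂ (z / 2) z := by
  rw [theta10, jacobiTheta₂, ← tsum_mul_left]
  refine tsum_congr fun n ↦ ?_
  rw [jacobiTheta₂_term, ← Complex.exp_add]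
  congr 1
  ring

lemma jacobiTheta_add_one (z : ℂ) : jacobiTheta (z + 1) = jacobiTheta₂ (1 / 2) z := by
  rw [jacobiTheta, jacobiTheta₂]
  refine tsum_congr fun n ↦ ?_
  rw [jacobiTheta₂_term]
  obtain ⟨m, hm⟩ : Even (n * (n - 1)) := Int.even_mul_pred_self n
  rw [Complex.exp_eq_exp_iff_exists_int]
  refine ⟨m, ?_⟩
  have : (n : ℂ) * (n - 1) = m + m := by exact_mod_cast hm
  linear_combination (Real.pi * I) * this

lemma im_neg_one_div {z : ℂ} (hz : 0 < z.im) : 0 < (-1 / z).im := by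
  rw [neg_div, neg_im, one_div, inv_im]
  have : 0 < normSq z := by
    rw [normSq_pos]; rintro rfl; simp at hz
  have := div_pos hz this
  rw [neg_div, neg_neg]; exact this

lemma ne_zero_of_im_pos {z : ℂ} (hz : 0 < z.im) : z ≠ 0 := by
  rintro rfl; simp at hz

/-- Fourth powers remove the branch of the square root in the functional equation of theta; hence
the choice of `θ⁴` throughout. -/
lemma cpow_half_pow_four (z : ℂ) : ((-I * z) ^ (1 / 2 : ℂ)) ^ 4 = -z ^ 2 := by
  rw [show (4 : ℕ) = 2 * 2 from rfl, pow_mul, ← Complex.cpow_nat_mul]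
  norm_num
  rw [mul_pow, I_sq]; ring

lemma thetaU_add_one (z : ℂ) : thetaU (z + 1) = -thetaU z := by
  have h : theta10 (z + 1) = cexp (Real.pi * I / 4) * theta10 z := by
    rw [theta10, theta10, ← tsum_mul_left]
    refine tsum_congr fun n ↦ ?_
    rw [← Complex.exp_add, Complex.exp_eq_exp_iff_exists_int]
    obtain ⟨m, hm⟩ : Even (n * (n + 1)) := Int.even_mul_succ_self n
    refine ⟨m, ?_⟩
    have : (n : ℂ) * (n + 1) = m + m := by exact_mod_cast hm
    linear_combination (Real.pi * I) * this
  rw [thetaU, thetaU, h, mul_pow, ← Complex.exp_nat_mul]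
  rw [show ((4 : ℕ) : ℂ) * (Real.pi * I / 4) = Real.pi * I by push_cast; ring, exp_pi_mul_I]
  ring

lemma thetaV_add_one (z : ℂ) : thetaV (z + 1) = thetaW z := rfl

lemma thetaW_add_one (z : ℂ) : thetaW (z + 1) = thetaV z := by
  rw [thetaW, thetaV, add_assoc, add_comm z, show (1 : ℂ) + 1 = 2 by norm_num, jacobiTheta_two_add]

lemma thetaV_S {z : ℂ} (hz : 0 < z.im) : thetaV (-1 / z) = -z ^ 2 * thetaV z := by
  have h := jacobiTheta₂_functional_equation 0 z
  have h0 : (-I * z) ^ (1 / 2 : ℂ) ≠ 0 := by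
    intro h
    have := cpow_half_pow_four z
    rw [h] at this
    have h2 := ne_zero_of_im_pos hz
    simp at this; exact h2 this
  rw [thetaV, thetaV, jacobiTheta_eq_jacobiTheta₂, jacobiTheta_eq_jacobiTheta₂, h, mul_pow, mul_pow,
    div_pow, cpow_half_pow_four]
  have h2 := ne_zero_of_im_pos hz
  simp
  field_simp

lemma thetaW_S {z : ℂ} (hz : 0 < z.im) : thetaW (-1 / z) = -z ^ 2 * thetaU z := by
  have h := jacobiTheta₂_functional_equation (z / 2) z
  have h2 := ne_zero_of_im_pos hz
  rw [thetaW, thetaU, jacobiTheta_add_one, theta10_eq, h, show z / 2 / z = 1 / 2 by field_simp]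
  simp only [mul_pow, div_pow, cpow_half_pow_four]
  rw [← Complex.exp_nat_mul, ← Complex.exp_nat_mul]
  have : cexp (((4 : ℕ) : ℂ) * (Real.pi * I * z / 4)) *
      cexp (((4 : ℕ) : ℂ) * (-Real.pi * I * (z ^ 2 / 2 ^ 2) / z)) = 1 := by
    rw [← Complex.exp_add, Complex.exp_eq_one_iff]
    refine ⟨0, ?_⟩
    field_simp
    push_cast
    ring
  generalize cexp (((4 : ℕ) : ℂ) * (Real.pi * I * z / 4)) = a at *
  generalize cexp (((4 : ℕ) : ℂ) * (-Real.pi * I * (z ^ 2 / 2 ^ 2) / z)) = b at *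
  generalize jacobiTheta₂ (1 / 2) (-1 / z) = j
  field_simp
  linear_combination (-j ^ 4) * this

lemma thetaU_S {z : ℂ} (hz : 0 < z.im) : thetaU (-1 / z) = -z ^ 2 * thetaW z := by
  have h := thetaW_S (im_neg_one_div hz)
  have h2 := ne_zero_of_im_pos hz
  rw [show -1 / (-1 / z) = z by field_simp] at h
  rw [h]; field_simp

lemma differentiableAt_thetaV {z : ℂ} (hz : 0 < z.im) : DifferentiableAt ℂ thetaV z :=
  (differentiableAt_jacobiTheta hz).pow 4

lemma differentiableAt_thetaW {z : ℂ} (hz : 0 < z.im) : DifferentiableAt ℂ thetaW z := by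
  have : 0 < (z + 1).im := by simpa using hz
  exact ((differentiableAt_jacobiTheta this).comp z
    (f := fun z : ℂ ↦ z + 1) (by fun_prop)).pow 4

lemma differentiableAt_thetaU {z : ℂ} (hz : 0 < z.im) : DifferentiableAt ℂ thetaU z := by
  have h : theta10 = fun z ↦ cexp (Real.pi * I * z / 4) * jacobiTheta₂ (z / 2) z :=
    funext theta10_eq
  have : DifferentiableAt ℂ theta10 z := by
    rw [h]
    refine DifferentiableAt.mul (by fun_prop) ?_
    exact (hasFDerivAt_jacobiTheta₂ (z / 2) hz).differentiableAt.comp z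
      (f := fun z : ℂ ↦ (z / 2, z)) (by fun_prop)
  exact this.pow 4

/-! ### Behaviour at the cusp -/

lemma tendsto_thetaV : Tendsto thetaV (comap im atTop) (𝓝 1) := by
  have h := isBigO_at_im_infty_jacobiTheta_sub_one
  have h2 : Tendsto (fun τ : ℂ ↦ Real.exp (-Real.pi * τ.im)) (comap im atTop) (𝓝 0) := by
    refine Real.tendsto_exp_atBot.comp ?_
    exact (tendsto_comap).const_mul_atTop_of_neg (by simpa using Real.pi_pos)
  have := (h.trans_tendsto h2).add_const 1
  simp only [sub_add_cancel, zero_add] at this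
  simpa [thetaV, Function.comp_def] using! this.pow 4

lemma tendsto_add_one_comap_im : Tendsto (fun z : ℂ ↦ z + 1) (comap im atTop) (comap im atTop) := by
  rw [tendsto_comap_iff]
  have : im ∘ (fun z : ℂ ↦ z + 1) = im := by ext; simp
  rw [this]; exact tendsto_comap

lemma tendsto_thetaW : Tendsto thetaW (comap im atTop) (𝓝 1) :=
  tendsto_thetaV.comp tendsto_add_one_comap_im

/-- In `θ₁₀ = exp(πiz/4) ∑ exp(πi n(n+1) z)` only `n = 0` and `n = -1` survive at the cusp, so the
limit is `2⁴`. -/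
lemma tendsto_thetaU : Tendsto (fun z ↦ thetaU z * cexp (-(Real.pi * I * z))) (comap im atTop)
    (𝓝 16) := by
  have key : Tendsto (fun z : ℂ ↦ jacobiTheta₂ (z / 2) z) (comap im atTop) (𝓝 2) := by
    have hsum : ∑' n : ℤ, (if n = 0 ∨ n = -1 then (1 : ℂ) else 0) = 2 := by
      rw [tsum_eq_sum (s := {0, -1})]
      · rw [Finset.sum_pair (by norm_num)]; norm_num
      · intro b hb; simp at hb; simp [hb]
    suffices h : Tendsto (fun z : ℂ ↦ ∑' n : ℤ, jacobiTheta₂_term n (z / 2) z) (comap im atTop)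
        (𝓝 (∑' n : ℤ, (if n = 0 ∨ n = -1 then (1 : ℂ) else 0))) by rwa [hsum] at h
    refine tendsto_tsum_of_dominated_convergence
      (bound := fun n ↦ ‖jacobiTheta₂_term n (I / 2) I‖) ?_ ?_ ?_
    · exact ((summable_jacobiTheta₂_term_iff (I / 2) I).mpr (by simp)).norm
    · intro n
      have hterm : ∀ z : ℂ, jacobiTheta₂_term n (z / 2) z = cexp ((n * (n + 1) : ℤ) * (Real.pi * I * z)) := by
        intro z; rw [jacobiTheta₂_term]; congr 1; push_cast; ring
      simp only [hterm]
      split_ifs with h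
      · have : n * (n + 1) = 0 := by rcases h with h | h <;> simp [h]
        simpa [this] using! tendsto_const_nhds
      · have hpos : 0 < n * (n + 1) := by
          rcases lt_or_gt_of_ne (fun h' ↦ h (Or.inl h')) with h1 | h1
          · have : n + 1 < 0 := by omega
            exact mul_pos_of_neg_of_neg h1 this
          · positivity
        rw [tendsto_zero_iff_norm_tendsto_zero]
        simp only [Complex.norm_exp]
        refine Real.tendsto_exp_atBot.comp ?_
        have : (fun x : ℂ ↦ (((n * (n + 1) : ℤ) : ℂ) * (Real.pi * I * x)).re) =
            fun x ↦ (-(((n * (n + 1) : ℤ) : ℝ) * Real.pi)) * x.im := by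
          ext x
          rw [← Complex.ofReal_intCast, re_ofReal_mul, mul_assoc, re_ofReal_mul]; simp; ring
        rw [this]
        refine (tendsto_comap).const_mul_atTop_of_neg ?_
        have : (0 : ℝ) < ((n * (n + 1) : ℤ) : ℝ) := by exact_mod_cast hpos
        have := mul_pos this Real.pi_pos
        linarith
    · rw [eventually_comap]
      filter_upwards [eventually_ge_atTop 1] with y hy z hz n
      rw [norm_jacobiTheta₂_term, norm_jacobiTheta₂_term, Real.exp_le_exp]
      have h2 : ∀ w : ℂ, (w / 2).im = w.im / 2 := by
        intro w; simp
      simp only [h2, I_im, hz]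
      have hpos : (0 : ℝ) ≤ n * (n + 1) := by
        have : 0 ≤ n * (n + 1) := by
          rcases le_or_gt 0 n with h | h
          · positivity
          · exact mul_nonneg_of_nonpos_of_nonpos h.le (by omega)
        exact_mod_cast this
      have := mul_nonneg (mul_nonneg hpos Real.pi_pos.le) (sub_nonneg.2 hy)
      nlinarith
  have := key.pow 4
  norm_num at this
  refine this.congr fun z ↦ ?_
  rw [thetaU, theta10_eq, mul_pow, ← Complex.exp_nat_mul, mul_comm (cexp _), mul_assoc,
    ← Complex.exp_add]
  rw [show ((4 : ℕ) : ℂ) * (Real.pi * I * z / 4) + -(Real.pi * I * z) = 0 by push_cast; ring]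
  simp

lemma tendsto_exp_pi_mul_I : Tendsto (fun z : ℂ ↦ cexp (Real.pi * I * z)) (comap im atTop) (𝓝 0) := by
  rw [tendsto_zero_iff_norm_tendsto_zero]
  simp only [Complex.norm_exp]
  refine Real.tendsto_exp_atBot.comp ?_
  have : (fun x : ℂ ↦ (Real.pi * I * x : ℂ).re) = fun x ↦ (-Real.pi) * x.im := by
    ext x
    rw [mul_assoc, re_ofReal_mul]; simp
  rw [this]
  exact (tendsto_comap).const_mul_atTop_of_neg (by simpa using Real.pi_pos)

lemma tendsto_thetaU_zero : Tendsto thetaU (comap im atTop) (𝓝 0) := by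
  have := tendsto_thetaU.mul tendsto_exp_pi_mul_I
  rw [mul_zero] at this
  refine this.congr fun z ↦ ?_
  rw [mul_assoc, ← Complex.exp_add, neg_add_cancel, Complex.exp_zero, mul_one]

/-! ### Level one cusp forms from functions on the upper half-plane -/

/-- Invariance under the two generators and decay at `i∞` suffice, as level one has a single cusp.
This gives access to the known spaces of cusp forms of weight 4 and 12. -/
lemma exists_cuspForm {F : ℂ → ℂ} {k : ℤ} (hd : ∀ z : ℂ, 0 < z.im → DifferentiableAt ℂ F z)
    (hT : ∀ z : ℂ, 0 < z.im → F (z + 1) = F z)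
    (hS : ∀ z : ℂ, 0 < z.im → F (-1 / z) = z ^ k * F z)
    (h0 : Tendsto F (comap im atTop) (𝓝 0)) :
    ∃ G : CuspForm 𝒮ℒ k, ∀ z : ℍ, G z = F z := by
  have hS' : (fun z : ℍ ↦ F z) ∣[k] ModularGroup.S = (fun z : ℍ ↦ F z) := by
    ext z
    rw [ModularForm.SL_slash_apply, UpperHalfPlane.modular_S_smul, ModularGroup.denom_S]
    have := hS z z.2
    have h0 := ne_zero_of_im_pos z.2
    simp only
    rw [show (-(z : ℂ))⁻¹ = -1 / z by field_simp, this, zpow_neg]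
    field_simp
  have hT' : (fun z : ℍ ↦ F z) ∣[k] ModularGroup.T = (fun z : ℍ ↦ F z) := by
    ext z
    rw [ModularForm.SL_slash_apply, UpperHalfPlane.modular_T_smul, ModularGroup.denom_apply]
    have := hT z z.2
    simp [ModularGroup.coe_T]
    rw [add_comm, this]
  have hall := SlashInvariantForm.slash_action_generators_SL2Z hS' hT'
  refine ⟨⟨⟨fun z ↦ F z, ?_⟩, ?_, ?_⟩, fun z ↦ rfl⟩
  · rintro A ⟨A, rfl⟩
    exact hall A
  · rw [UpperHalfPlane.mdifferentiable_iff]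
    refine .congr (fun z hz ↦ (hd z hz).differentiableWithinAt) fun z hz ↦ ?_
    simp [UpperHalfPlane.ofComplex_apply_of_im_pos hz]
  · intro c hc
    rw [Subgroup.IsArithmetic.isCusp_iff_isCusp_SL2Z] at hc
    rw [OnePoint.isZeroAt_iff_forall_SL2Z hc]
    intro γ _
    change UpperHalfPlane.IsZeroAtImInfty ((fun z : ℍ ↦ F z) ∣[k] γ)
    rw [hall]
    exact h0.comp UpperHalfPlane.tendsto_coe_atImInfty

/-- **Jacobi's identity** `θ₀₀⁴ = θ₁₀⁴ + θ₀₁⁴`. -/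
lemma thetaV_eq_add {z : ℂ} (hz : 0 < z.im) : thetaV z = thetaU z + thetaW z := by
  -- Under `z + 1` the difference changes sign, and under `-1/z` it is multiplied by `z²`. Its
  -- square is therefore a cusp form of weight 4, and there are none below weight 12.
  obtain ⟨G, hG⟩ := exists_cuspForm (F := fun z ↦ (thetaV z - thetaU z - thetaW z) ^ 2) (k := 4)
    (fun z hz ↦ (((differentiableAt_thetaV hz).sub (differentiableAt_thetaU hz)).sub
      (differentiableAt_thetaW hz)).pow 2)
    (fun z hz ↦ by simp only [thetaV_add_one, thetaU_add_one, thetaW_add_one]; ring)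
    (fun z hz ↦ by
      simp only [thetaV_S hz, thetaU_S hz, thetaW_S hz]
      rw [show (4 : ℤ) = ((4 : ℕ) : ℤ) from rfl, zpow_natCast]; ring)
    (by simpa using ((tendsto_thetaV.sub tendsto_thetaU_zero).sub tendsto_thetaW).pow 2)
  have := rank_zero_iff_forall_zero.mp
    (CuspForm.rank_eq_zero_of_weight_lt_twelve (k := 4) (by norm_num)) G
  have h2 := hG ⟨z, hz⟩
  rw [this] at h2
  have h3 : (thetaV z - thetaU z - thetaW z) ^ 2 = 0 := h2.symm
  have h4 := pow_eq_zero_iff (two_ne_zero) |>.1 h3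
  linear_combination h4

/-- The square of the product is a cusp form of weight 12, hence a multiple of the discriminant,
which has no zeros. The multiple is nonzero because the product has leading coefficient 16 at the
cusp. -/
lemma theta_mul_ne_zero {z : ℂ} (hz : 0 < z.im) : thetaU z * thetaV z * thetaW z ≠ 0 := by
  obtain ⟨G, hG⟩ := exists_cuspForm (F := fun z ↦ (thetaU z * thetaV z * thetaW z) ^ 2) (k := 12)
    (fun z hz ↦ (((differentiableAt_thetaU hz).mul (differentiableAt_thetaV hz)).mul
      (differentiableAt_thetaW hz)).pow 2)
    (fun z hz ↦ by simp only [thetaV_add_one, thetaU_add_one, thetaW_add_one]; ring)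
    (fun z hz ↦ by
      simp only [thetaV_S hz, thetaU_S hz, thetaW_S hz]
      rw [show (12 : ℤ) = ((12 : ℕ) : ℤ) from rfl, zpow_natCast]; ring)
    (by simpa using ((tendsto_thetaU_zero.mul tendsto_thetaV).mul tendsto_thetaW).pow 2)
  obtain ⟨c, hc⟩ := CuspForm.exists_smul_discriminant_of_weight_eq_twelve G
  have hval : ∀ z : ℍ, (thetaU z * thetaV z * thetaW z) ^ 2 = c * ModularForm.discriminant z := by
    intro z; rw [← hG z, ← hc]; rfl
  intro h
  have h1 := hval ⟨z, hz⟩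
  have h2 : c = 0 := by
    rcases mul_eq_zero.1 (h1.symm.trans (by simp [h])) with h | h
    · exact h
    · exact absurd h (ModularForm.discriminant_ne_zero _)
  have h3 : ∀ z : ℂ, 0 < z.im → thetaU z * thetaV z * thetaW z = 0 := by
    intro z hz
    have := hval ⟨z, hz⟩
    rw [h2, zero_mul] at this
    exact pow_eq_zero_iff (two_ne_zero) |>.1 this
  have h4 := (tendsto_thetaU.mul tendsto_thetaV).mul tendsto_thetaW
  have h5 : (fun z ↦ thetaU z * cexp (-(Real.pi * I * z)) * thetaV z * thetaW z)
      =ᶠ[comap im atTop] fun _ ↦ 0 := by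
    rw [EventuallyEq, eventually_comap]
    filter_upwards [eventually_gt_atTop 0] with y hy z hzy
    have := h3 z (hzy ▸ hy)
    linear_combination cexp (-(Real.pi * I * z)) * this
  have hne : (comap im atTop : Filter ℂ).NeBot := by
    refine comap_neBot fun t ht ↦ ?_
    obtain ⟨y, hy⟩ := (atTop_neBot (α := ℝ)).nonempty_of_mem ht
    exact ⟨y * I, by simpa using hy⟩
  have := tendsto_nhds_unique (h4.congr' h5) tendsto_const_nhds
  norm_num at this

lemma thetaU_ne_zero {z : ℂ} (hz : 0 < z.im) : thetaU z ≠ 0 :=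
  fun h ↦ theta_mul_ne_zero hz (by simp [h])

lemma thetaV_ne_zero {z : ℂ} (hz : 0 < z.im) : thetaV z ≠ 0 :=
  fun h ↦ theta_mul_ne_zero hz (by simp [h])

lemma thetaW_ne_zero {z : ℂ} (hz : 0 < z.im) : thetaW z ≠ 0 :=
  fun h ↦ theta_mul_ne_zero hz (by simp [h])

end FourierEigen

end

noncomputable section

namespace FourierEigen

open Complex Filter Topology Asymptotics

/-! ### The `λ`-function and its logarithm -/

lemma modularLambda_ne_zero {z : ℂ} (hz : 0 < z.im) : modularLambda z ≠ 0 :=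
  div_ne_zero (thetaU_ne_zero hz) (thetaV_ne_zero hz)

lemma one_sub_modularLambda {z : ℂ} (hz : 0 < z.im) :
    1 - modularLambda z = thetaW z / thetaV z := by
  have := thetaV_ne_zero hz
  rw [modularLambda_eq, eq_div_iff this, sub_mul, div_mul_cancel₀ _ this, thetaV_eq_add hz]
  ring

lemma one_sub_modularLambda_ne_zero {z : ℂ} (hz : 0 < z.im) : 1 - modularLambda z ≠ 0 := by
  rw [one_sub_modularLambda hz]
  exact div_ne_zero (thetaW_ne_zero hz) (thetaV_ne_zero hz)

lemma modularLambda_S {z : ℂ} (hz : 0 < z.im) : modularLambda (-1 / z) = 1 - modularLambda z := by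
  have h0 := ne_zero_of_im_pos hz
  rw [one_sub_modularLambda hz, modularLambda_eq, thetaU_S hz, thetaV_S hz]
  have := thetaV_ne_zero hz
  field_simp

lemma modularLambda_add_one {z : ℂ} (hz : 0 < z.im) :
    modularLambda (z + 1) = -(modularLambda z / (1 - modularLambda z)) := by
  rw [one_sub_modularLambda hz, modularLambda_eq, modularLambda_eq, thetaU_add_one, thetaV_add_one]
  have := thetaV_ne_zero hz
  have := thetaW_ne_zero hz
  field_simp

lemma differentiableAt_modularLambda {z : ℂ} (hz : 0 < z.im) :
    DifferentiableAt ℂ modularLambda z :=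
  (differentiableAt_thetaU hz).div (differentiableAt_thetaV hz) (thetaV_ne_zero hz)

lemma tendsto_modularLambda_mul_exp :
    Tendsto (fun z ↦ modularLambda z * cexp (-(Real.pi * I * z))) (comap im atTop) (𝓝 16) := by
  have := tendsto_thetaU.div tendsto_thetaV one_ne_zero
  rw [div_one] at this
  refine this.congr fun z ↦ ?_
  simp only [Pi.div_apply, modularLambda_eq]
  ring

lemma tendsto_modularLambda : Tendsto modularLambda (comap im atTop) (𝓝 0) := by
  have := tendsto_thetaU_zero.div tendsto_thetaV one_ne_zero
  rwa [div_one] at this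

lemma isOpen_im_pos : IsOpen {z : ℂ | 0 < z.im} := isOpen_lt continuous_const continuous_im

/-- Transport by the Cayley transform to the unit disc, where holomorphic functions have primitives.
-/
lemma exists_primitive {g : ℂ → ℂ} (hg : DifferentiableOn ℂ g {z | 0 < z.im}) :
    ∃ G : ℂ → ℂ, ∀ z : ℂ, 0 < z.im → HasDerivAt G (g z) z := by
  have hne : ∀ w ∈ Metric.ball (0 : ℂ) 1, 1 - w ≠ 0 := by
    intro w hw h
    rw [← sub_eq_zero.1 h] at hw
    simp at hw
  have him : ∀ w ∈ Metric.ball (0 : ℂ) 1, 0 < (I * (1 + w) / (1 - w)).im := by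
    intro w hw
    have h1 := hne w hw
    have : (I * (1 + w) / (1 - w)).im = (1 - normSq w) / normSq (1 - w) := by
      rw [div_eq_mul_inv, inv_def]
      simp [normSq_apply]
      ring
    rw [this]
    refine div_pos ?_ (normSq_pos.2 h1)
    rw [normSq_eq_norm_sq]
    have : ‖w‖ < 1 := by simpa using hw
    nlinarith [norm_nonneg w]
  have hex : DifferentiableOn ℂ (fun w ↦ g (I * (1 + w) / (1 - w)) * (2 * I / (1 - w) ^ 2))
      (Metric.ball 0 1) := by
    refine DifferentiableOn.mul ?_ ?_
    · refine hg.comp (t := {z | 0 < z.im}) ?_ him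
      intro w hw
      exact (DifferentiableAt.div (by fun_prop) (by fun_prop) (hne w hw)).differentiableWithinAt
    · intro w hw
      have : DifferentiableAt ℂ (fun w : ℂ ↦ 2 * I / (1 - w) ^ 2) w :=
        DifferentiableAt.div (by fun_prop) (by fun_prop) (pow_ne_zero 2 (hne w hw))
      exact this.differentiableWithinAt
  obtain ⟨H, hH⟩ := hex.isExactOn_ball
  refine ⟨fun z ↦ H ((z - I) / (z + I)), fun z hz ↦ ?_⟩
  have h1 : z + I ≠ 0 := by
    intro h
    have := congrArg im h
    simp at this; linarith
  have hmem : (z - I) / (z + I) ∈ Metric.ball (0 : ℂ) 1 := by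
    rw [mem_ball_zero_iff, norm_div, div_lt_one (norm_pos_iff.2 h1), ← sq_lt_sq₀ (norm_nonneg _)
      (norm_nonneg _), ← normSq_eq_norm_sq, ← normSq_eq_norm_sq]
    simp [normSq_apply]
    nlinarith
  have hd : HasDerivAt (fun z : ℂ ↦ (z - I) / (z + I)) (2 * I / (z + I) ^ 2) z := by
    have := ((hasDerivAt_id z).sub_const I).div ((hasDerivAt_id z).add_const I) h1
    convert! this using 1
    simp; ring
  have := (hH _ hmem).comp z hd
  convert! this using 1
  have h2 : 1 - (z - I) / (z + I) = 2 * I / (z + I) := by field_simp; ring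
  have h3 : I * (1 + (z - I) / (z + I)) / (2 * I / (z + I)) = z := by field_simp; ring
  beta_reduce
  rw [h2, h3]
  field_simp

lemma preconnected_im_ge (Y : ℝ) : IsPreconnected {z : ℂ | Y ≤ z.im} :=
  (convex_halfSpace_im_ge Y).isPreconnected

lemma preconnected_im_pos : IsPreconnected {z : ℂ | 0 < z.im} :=
  (convex_halfSpace_im_gt 0).isPreconnected

/-- A continuous function on a preconnected set with `exp h = 1` is constant. -/
lemma eq_of_exp_eq_one {X : Type*} [TopologicalSpace X] {S : Set X} (hS : IsPreconnected S)
    {h : X → ℂ} (hc : ContinuousOn h S) (h1 : ∀ x ∈ S, cexp (h x) = 1) {x y : X} (hx : x ∈ S)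
    (hy : y ∈ S) : h x = h y := by
  have key : ∀ x ∈ S, ∃ n : ℤ, h x = n * (2 * Real.pi * I) := fun x hx ↦ exp_eq_one_iff.1 (h1 x hx)
  have him : ∀ x ∈ S, ∀ n : ℤ, h x = n * (2 * Real.pi * I) → (h x).im / (2 * Real.pi) = n := by
    intro x _ n hn
    have : (h x).im = n * (2 * Real.pi) := by rw [hn]; simp
    rw [this]; field_simp
  have hc' : ContinuousOn (fun x ↦ (h x).im / (2 * Real.pi)) S :=
    (continuous_im.comp_continuousOn hc).div_const _
  have aux : ∀ x ∈ S, ∀ y ∈ S, ∀ n m : ℤ, h x = n * (2 * Real.pi * I) →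
      h y = m * (2 * Real.pi * I) → m ≤ n := by
    intro x hx y hy n m hn hm
    by_contra! hlt
    have hiv := hS.intermediate_value hx hy hc'
    have hmem : ((n : ℝ) + 1 / 2) ∈ Set.Icc ((h x).im / (2 * Real.pi)) ((h y).im / (2 * Real.pi)) := by
      rw [him x hx n hn, him y hy m hm]
      have : (n : ℝ) + 1 ≤ m := by exact_mod_cast hlt
      constructor <;> linarith
    obtain ⟨w, hw, hw2⟩ := hiv hmem
    obtain ⟨k, hk⟩ := key w hw
    have h3 : (h w).im / (2 * Real.pi) = (n : ℝ) + 1 / 2 := hw2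
    rw [him w hw k hk] at h3
    have h4 : (2 * k : ℝ) = 2 * n + 1 := by linarith
    have h5 : 2 * k = 2 * n + 1 := by exact_mod_cast h4
    omega
  obtain ⟨n, hn⟩ := key x hx
  obtain ⟨m, hm⟩ := key y hy
  rw [hn, hm, le_antisymm (aux y hy x hx m n hm hn) (aux x hx y hy n m hn hm)]

/-- If `exp h → 1` at `i∞` and `h` is real on the imaginary axis, then `h` is eventually the
principal logarithm of `exp h`. -/
lemma eventually_eq_log_exp {h : ℂ → ℂ} (hc : ContinuousOn h {z | 0 < z.im})
    (h1 : Tendsto (fun z ↦ cexp (h z)) (comap im atTop) (𝓝 1))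
    (hr : ∀ t : ℝ, 0 < t → (h (I * t)).im = 0) :
    ∀ᶠ z in comap im atTop, h z = log (cexp (h z)) := by
  have h2 := h1.eventually (Metric.ball_mem_nhds (1 : ℂ) one_pos)
  rw [eventually_comap, eventually_atTop] at h2
  obtain ⟨Y, hY⟩ := h2
  rw [eventually_comap, eventually_atTop]
  refine ⟨max Y 1, ?_⟩
  rintro _ hb z rfl
  have hslit : ∀ w : ℂ, w ∈ {w : ℂ | max Y 1 ≤ w.im} → cexp (h w) ∈ slitPlane := by
    intro w hw
    have := hY w.im ((le_max_left _ _).trans hw) w rfl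
    exact ball_one_subset_slitPlane (by simpa using this)
  have hpos : ∀ w : ℂ, w ∈ {w : ℂ | max Y 1 ≤ w.im} → 0 < w.im := fun w hw ↦
    lt_of_lt_of_le one_pos ((le_max_right _ _).trans hw)
  have hcont : ContinuousOn (fun w ↦ h w - log (cexp (h w))) {w : ℂ | max Y 1 ≤ w.im} := by
    have h3 := hc.mono (fun w hw ↦ hpos w hw)
    exact h3.sub ((continuous_exp.comp_continuousOn h3).clog hslit)
  have hbase : (I * ((max Y 1 : ℝ) : ℂ)) ∈ {w : ℂ | max Y 1 ≤ w.im} := by simp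
  have := eq_of_exp_eq_one (preconnected_im_ge (max Y 1)) hcont (fun w hw ↦ by
    rw [Complex.exp_sub, Complex.exp_log (exp_ne_zero _), div_self (exp_ne_zero _)]) hb hbase
  have h0 := hr (max Y 1) (lt_of_lt_of_le one_pos (le_max_right _ _))
  have h4 : log (cexp (h (I * ((max Y 1 : ℝ) : ℂ)))) = h (I * ((max Y 1 : ℝ) : ℂ)) :=
    log_exp (by rw [h0]; linarith [Real.pi_pos]) (by rw [h0]; exact Real.pi_pos.le)
  rw [h4, sub_self] at this
  exact sub_eq_zero.1 this

lemma tendsto_zero_of_exp_tendsto_one {h : ℂ → ℂ} (hc : ContinuousOn h {z | 0 < z.im})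
    (h1 : Tendsto (fun z ↦ cexp (h z)) (comap im atTop) (𝓝 1))
    (hr : ∀ t : ℝ, 0 < t → (h (I * t)).im = 0) : Tendsto h (comap im atTop) (𝓝 0) := by
  have h2 : Tendsto (fun z ↦ log (cexp (h z))) (comap im atTop) (𝓝 0) := by
    have := (continuousAt_clog (one_mem_slitPlane)).tendsto.comp h1
    simpa using! this
  exact h2.congr' ((eventually_eq_log_exp hc h1 hr).mono fun z hz ↦ hz.symm)

/-! ### Values on the imaginary axis -/

lemma exists_jacobiTheta_eq_ofReal (t : ℝ) : ∃ r : ℝ, jacobiTheta (I * t) = r := by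
  refine ⟨_, (conj_eq_iff_real.1 ?_).choose_spec⟩
  rw [jacobiTheta_eq_jacobiTheta₂, jacobiTheta₂_conj]
  simp

lemma exists_theta10_eq_ofReal (t : ℝ) : ∃ r : ℝ, theta10 (I * t) = r := by
  refine ⟨_, (conj_eq_iff_real.1 ?_).choose_spec⟩
  rw [theta10_eq, map_mul, jacobiTheta₂_conj, ← exp_conj]
  congr 1
  · congr 1
    simp [map_ofNat]
  · rw [← jacobiTheta₂_neg_left]
    congr 1 <;> simp [map_ofNat]
    ring

lemma im_I_mul (t : ℝ) : (I * (t : ℂ)).im = t := by simp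

lemma exists_thetaV_eq_ofReal {t : ℝ} (ht : 0 < t) : ∃ r : ℝ, 0 < r ∧ thetaV (I * t) = r := by
  obtain ⟨r, hr⟩ := exists_jacobiTheta_eq_ofReal t
  have h := thetaV_ne_zero (z := I * t) (by simpa using ht)
  rw [thetaV, hr] at h
  have hr0 : r ≠ 0 := by rintro rfl; simp at h
  exact ⟨r ^ 4, by positivity, by rw [thetaV, hr]; push_cast; rfl⟩

lemma exists_thetaU_eq_ofReal {t : ℝ} (ht : 0 < t) : ∃ r : ℝ, 0 < r ∧ thetaU (I * t) = r := by
  obtain ⟨r, hr⟩ := exists_theta10_eq_ofReal t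
  have h := thetaU_ne_zero (z := I * t) (by simpa using ht)
  rw [thetaU, hr] at h
  have hr0 : r ≠ 0 := by rintro rfl; simp at h
  exact ⟨r ^ 4, by positivity, by rw [thetaU, hr]; push_cast; rfl⟩

lemma neg_one_div_I_mul (t : ℝ) : -1 / (I * (t : ℂ)) = I * ((t⁻¹ : ℝ) : ℂ) := by
  rcases eq_or_ne t 0 with rfl | ht
  · simp
  · have : (t : ℂ) ≠ 0 := by exact_mod_cast ht
    push_cast
    field_simp
    rw [I_sq]

lemma exists_thetaW_eq_ofReal {t : ℝ} (ht : 0 < t) : ∃ r : ℝ, 0 < r ∧ thetaW (I * t) = r := by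
  obtain ⟨r, hr0, hr⟩ := exists_thetaU_eq_ofReal (inv_pos.2 ht)
  have h := thetaU_S (z := I * t) (by simpa using ht)
  rw [neg_one_div_I_mul, hr] at h
  refine ⟨r / t ^ 2, by positivity, ?_⟩
  have : (t : ℂ) ≠ 0 := by exact_mod_cast ht.ne'
  push_cast
  rw [h, mul_pow, I_sq]
  field_simp

lemma exists_modularLambda_eq_ofReal {t : ℝ} (ht : 0 < t) :
    ∃ r : ℝ, 0 < r ∧ r < 1 ∧ modularLambda (I * t) = r := by
  obtain ⟨u, hu0, hu⟩ := exists_thetaU_eq_ofReal ht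
  obtain ⟨v, hv0, hv⟩ := exists_thetaV_eq_ofReal ht
  obtain ⟨w, hw0, hw⟩ := exists_thetaW_eq_ofReal ht
  have h := thetaV_eq_add (z := I * t) (by simpa using ht)
  rw [hu, hv, hw] at h
  have h' : v = u + w := by exact_mod_cast h
  refine ⟨u / v, by positivity, by rw [div_lt_one hv0]; linarith, ?_⟩
  rw [modularLambda_eq, hu, hv]; push_cast; rfl

/-! ### The logarithm -/

lemma exists_log_modularLambda : ∃ L : ℂ → ℂ,
    (∀ z : ℂ, 0 < z.im → HasDerivAt L (logDeriv modularLambda z) z) ∧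
    (∀ z : ℂ, 0 < z.im → cexp (L z) = modularLambda z) ∧ (L I).im = 0 := by
  have hd : DifferentiableOn ℂ (logDeriv modularLambda) {z | 0 < z.im} := by
    have h1 : DifferentiableOn ℂ modularLambda {z | 0 < z.im} := fun z hz ↦
      (differentiableAt_modularLambda hz).differentiableWithinAt
    exact (h1.deriv isOpen_im_pos).div h1 fun z hz ↦ modularLambda_ne_zero hz
  obtain ⟨G, hG⟩ := exists_primitive hd
  obtain ⟨r, hr0, -, hr⟩ := exists_modularLambda_eq_ofReal one_pos
  rw [ofReal_one, mul_one] at hr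
  set L : ℂ → ℂ := fun z ↦ G z - G I + Real.log r with hL
  have hLd : ∀ z : ℂ, 0 < z.im → HasDerivAt L (logDeriv modularLambda z) z := fun z hz ↦
    ((hG z hz).sub_const _).add_const _
  refine ⟨L, hLd, fun z hz ↦ ?_, ?_⟩
  · have hq : ∀ w : ℂ, 0 < w.im → HasDerivAt (fun w ↦ modularLambda w * cexp (-L w)) 0 w := by
      intro w hw
      have h1 := (differentiableAt_modularLambda hw).hasDerivAt.mul (hLd w hw).neg.cexp
      convert! h1 using 1
      have := modularLambda_ne_zero hw
      rw [logDeriv_apply]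
      field_simp
      ring
    have hconst := isOpen_im_pos.is_const_of_deriv_eq_zero preconnected_im_pos
      (fun w hw ↦ (hq w hw).differentiableAt.differentiableWithinAt)
      (fun w hw ↦ (hq w hw).deriv) (x := z) (y := I) hz (by simp)
    have hI : modularLambda I * cexp (-L I) = 1 := by
      have : L I = Real.log r := by simp [hL]
      rw [this, hr, ← ofReal_neg, ← ofReal_exp, Real.exp_neg, Real.exp_log hr0, ← ofReal_mul,
        mul_inv_cancel₀ hr0.ne', ofReal_one]
    have h3 : modularLambda z * cexp (-L z) = 1 := hconst.trans hI
    rw [Complex.exp_neg] at h3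
    have := exp_ne_zero (L z)
    field_simp at h3
    exact h3.symm
  · simp only [hL, sub_self, zero_add]; exact ofReal_im _

/-- The holomorphic logarithm of `λ` on the upper half-plane that is real on the imaginary axis. -/
def logLam : ℂ → ℂ := exists_log_modularLambda.choose

lemma hasDerivAt_logLam {z : ℂ} (hz : 0 < z.im) :
    HasDerivAt logLam (logDeriv modularLambda z) z :=
  exists_log_modularLambda.choose_spec.1 z hz

lemma exp_logLam {z : ℂ} (hz : 0 < z.im) : cexp (logLam z) = modularLambda z :=
  exists_log_modularLambda.choose_spec.2.1 z hz

lemma differentiableAt_logLam {z : ℂ} (hz : 0 < z.im) : DifferentiableAt ℂ logLam z :=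
  (hasDerivAt_logLam hz).differentiableAt

lemma continuousOn_logLam : ContinuousOn logLam {z | 0 < z.im} := fun _ hz ↦
  (differentiableAt_logLam hz).continuousAt.continuousWithinAt

lemma logLam_im {t : ℝ} (ht : 0 < t) : (logLam (I * t)).im = 0 := by
  -- `λ` is positive on the imaginary axis, so `logLam - Re logLam` has exponential one there. It is
  -- constant, and it vanishes at `i` by the normalisation.
  have hc : ContinuousOn (fun t : ℝ ↦ logLam (I * t) - ((logLam (I * t)).re : ℂ)) (Set.Ioi 0) := by
    have h1 : ContinuousOn (fun t : ℝ ↦ logLam (I * t)) (Set.Ioi 0) :=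
      continuousOn_logLam.comp (by fun_prop) (fun t ht ↦ by simpa using ht)
    exact h1.sub (by fun_prop)
  have h := eq_of_exp_eq_one isPreconnected_Ioi hc (fun t ht ↦ by
    obtain ⟨r, hr0, -, hr⟩ := exists_modularLambda_eq_ofReal ht
    have h1 := exp_logLam (z := I * t) (by simpa using ht)
    rw [Complex.exp_sub, ← ofReal_exp, ← Complex.norm_exp, h1, hr, norm_real, Real.norm_eq_abs,
      abs_of_pos hr0, div_self]
    exact_mod_cast hr0.ne') (x := t) (y := 1) ht (by simp)
  have h2 := congrArg im h
  simp only [sub_im, ofReal_im, sub_zero, ofReal_one, mul_one] at h2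
  rw [h2]
  exact exists_log_modularLambda.choose_spec.2.2

lemma continuousOn_neg_one_div : ContinuousOn (fun z : ℂ ↦ -1 / z) {z | 0 < z.im} :=
  continuousOn_const.div continuousOn_id fun _ hz ↦ ne_zero_of_im_pos hz

lemma continuousOn_logLam_S : ContinuousOn (fun z ↦ logLam (-1 / z)) {z | 0 < z.im} :=
  continuousOn_logLam.comp continuousOn_neg_one_div fun _ hz ↦ im_neg_one_div hz

lemma eventually_im_pos : ∀ᶠ z : ℂ in comap im atTop, 0 < z.im :=
  tendsto_comap.eventually (eventually_gt_atTop 0)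

lemma exp_logLam_S {z : ℂ} (hz : 0 < z.im) : cexp (logLam (-1 / z)) = 1 - modularLambda z := by
  rw [exp_logLam (im_neg_one_div hz), modularLambda_S hz]

lemma tendsto_exp_logLam_S : Tendsto (fun z ↦ cexp (logLam (-1 / z))) (comap im atTop) (𝓝 1) := by
  have := (tendsto_const_nhds (x := (1 : ℂ))).sub tendsto_modularLambda
  rw [sub_zero] at this
  exact this.congr' (eventually_im_pos.mono fun z hz ↦ (exp_logLam_S hz).symm)

lemma logLam_S_im {t : ℝ} (ht : 0 < t) : (logLam (-1 / (I * t))).im = 0 := by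
  rw [neg_one_div_I_mul]
  exact logLam_im (inv_pos.2 ht)

lemma eventually_logLam_S :
    ∀ᶠ z in comap im atTop, logLam (-1 / z) = log (1 - modularLambda z) := by
  filter_upwards [eventually_eq_log_exp continuousOn_logLam_S tendsto_exp_logLam_S
    (fun t ht ↦ logLam_S_im ht), eventually_im_pos] with z h1 h2
  rw [h1, exp_logLam_S h2]

lemma tendsto_logLam_S : Tendsto (fun z ↦ logLam (-1 / z)) (comap im atTop) (𝓝 0) :=
  tendsto_zero_of_exp_tendsto_one continuousOn_logLam_S tendsto_exp_logLam_S
    (fun _ ht ↦ logLam_S_im ht)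

lemma tendsto_logLam_sub :
    Tendsto (fun z ↦ logLam z - Real.pi * I * z - Real.log 16) (comap im atTop) (𝓝 0) := by
  refine tendsto_zero_of_exp_tendsto_one ?_ ?_ ?_
  · exact (continuousOn_logLam.sub (by fun_prop)).sub continuousOn_const
  · have := tendsto_modularLambda_mul_exp.div_const 16
    rw [div_self (by norm_num)] at this
    refine this.congr' (eventually_im_pos.mono fun z hz ↦ ?_)
    beta_reduce
    rw [Complex.exp_sub, Complex.exp_sub, exp_logLam hz, ← ofReal_exp, Real.exp_log (by norm_num),
      Complex.exp_neg]
    push_cast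
    ring
  · intro t ht
    have : ((Real.pi : ℂ) * I * (I * t)) = ((-(Real.pi * t) : ℝ) : ℂ) := by
      push_cast; linear_combination (Real.pi * t : ℂ) * I_sq
    rw [this, sub_im, sub_im, logLam_im ht, ofReal_im, ofReal_im]; ring

/-- The identity holds after exponentiation, by `λ(z+1) = -λ/(1-λ)`. The difference of the two sides
is then constant, and the expansion `log λ = πiz + log 16 + o(1)` shows that the constant is zero.
-/
lemma logLam_add_one {z : ℂ} (hz : 0 < z.im) :
    logLam (z + 1) = logLam z - logLam (-1 / z) + Real.pi * I := by
  set h : ℂ → ℂ := fun z ↦ logLam (z + 1) - logLam z + logLam (-1 / z) - Real.pi * I with hh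
  have hc : ContinuousOn h {z | 0 < z.im} := by
    have h1 : ContinuousOn (fun z ↦ logLam (z + 1)) {z | 0 < z.im} :=
      continuousOn_logLam.comp (by fun_prop) fun z hz ↦ by simpa using hz
    exact ((h1.sub continuousOn_logLam).add continuousOn_logLam_S).sub continuousOn_const
  have h1 : ∀ z ∈ {z : ℂ | 0 < z.im}, cexp (h z) = 1 := by
    intro z hz
    have hz' : 0 < (z + 1).im := by simpa using hz
    have a := modularLambda_ne_zero hz
    have b := one_sub_modularLambda_ne_zero hz
    simp only [hh]
    rw [Complex.exp_sub, Complex.exp_add, Complex.exp_sub, exp_logLam hz', exp_logLam hz,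
      exp_logLam_S hz, exp_pi_mul_I, modularLambda_add_one hz]
    field_simp
  have h2 : Tendsto h (comap im atTop) (𝓝 0) := by
    have := ((tendsto_logLam_sub.comp tendsto_add_one_comap_im).sub tendsto_logLam_sub).add
      tendsto_logLam_S
    simp only [sub_zero, add_zero] at this
    refine this.congr fun z ↦ ?_
    simp only [Function.comp, hh]; ring
  have h3 : Tendsto h (comap im atTop) (𝓝 (h z)) :=
    tendsto_const_nhds.congr' (eventually_im_pos.mono fun w hw ↦
      eq_of_exp_eq_one preconnected_im_pos hc h1 hz hw)
  have hne : (comap im atTop : Filter ℂ).NeBot := by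
    refine comap_neBot fun t ht ↦ ?_
    obtain ⟨y, hy⟩ := (atTop_neBot (α := ℝ)).nonempty_of_mem ht
    exact ⟨y * I, by simpa using hy⟩
  have := tendsto_nhds_unique h3 h2
  simp only [hh] at this
  linear_combination this

/-- Near `i∞`, `log λ(-1/z)` decays like `exp (-π Im z)`. -/
lemma exists_norm_logLam_S_le : ∃ C Y : ℝ, 0 < Y ∧
    ∀ z : ℂ, Y ≤ z.im → ‖logLam (-1 / z)‖ ≤ C * Real.exp (-(Real.pi * z.im)) := by
  have h1 := tendsto_modularLambda.eventually (Metric.ball_mem_nhds (0 : ℂ) (show (0:ℝ) < 1 / 2 by norm_num))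
  have h2 := tendsto_modularLambda_mul_exp.eventually (Metric.ball_mem_nhds (16 : ℂ) one_pos)
  have h3 := ((eventually_logLam_S.and h1).and h2)
  rw [eventually_comap, eventually_atTop] at h3
  obtain ⟨Y, hY⟩ := h3
  -- `3/2` comes from `|log(1+w)| ≤ (3/2)|w|` for `|w| ≤ 1/2`; `17` bounds `|λ exp(-πiz)|`, whose
  -- limit is 16.
  refine ⟨3 / 2 * 17, max Y 1, by positivity, fun z hz ↦ ?_⟩
  obtain ⟨⟨a, b⟩, c⟩ := hY z.im ((le_max_left _ _).trans hz) z rfl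
  have hb : ‖modularLambda z‖ < 1 / 2 := by simpa using b
  have hc : ‖modularLambda z * cexp (-(Real.pi * I * z))‖ ≤ 17 := by
    have : ‖modularLambda z * cexp (-(Real.pi * I * z)) - 16‖ < 1 := by
      simpa [dist_eq_norm] using c
    have h4 := norm_le_norm_sub_add (modularLambda z * cexp (-(Real.pi * I * z))) 16
    have h5 : ‖(16 : ℂ)‖ = 16 := by norm_num
    linarith
  rw [norm_mul, Complex.norm_exp] at hc
  have hre : (-(Real.pi * I * z : ℂ)).re = Real.pi * z.im := by
    rw [neg_re, mul_assoc, re_ofReal_mul]; simp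
  rw [hre] at hc
  have h4 := norm_log_one_add_half_le_self (z := -modularLambda z) (by rw [norm_neg]; exact hb.le)
  rw [a, sub_eq_add_neg]
  refine h4.trans ?_
  rw [norm_neg, mul_assoc, Real.exp_neg, ← div_eq_mul_inv]
  gcongr
  rwa [le_div_iff₀ (Real.exp_pos _)]

/-- The fundamental theorem of calculus along the segment: `log λ` tends to `0` at the cusp `0`,
because `log λ(-1/y)` decays as `Im y → ∞`. Most of the work is integrability near the endpoint `0`.
-/
lemma logLambda_eq (z : ℍ) : logLambda z = logLam z := by
  obtain ⟨C, Y, hY, hC⟩ := exists_norm_logLam_S_le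
  have hz0 : (z : ℂ) ≠ 0 := ne_zero_of_im_pos z.2
  have him : ∀ t : ℝ, 0 < t → 0 < ((t : ℂ) * z).im := fun t ht ↦ by
    simpa using mul_pos ht z.2
  have hC0 : 0 ≤ C := by
    have := (norm_nonneg _).trans (hC (Y * I) (by simp))
    exact nonneg_of_mul_nonneg_left this (Real.exp_pos _)
  have hder : ∀ t : ℝ, 0 < t → HasDerivAt (fun t : ℝ ↦ logLam (t * z))
      (logDeriv modularLambda ((t : ℂ) * (z : ℂ)) * (z : ℂ)) t := by
    intro t ht
    have h1 : HasDerivAt (fun t : ℝ ↦ (t : ℂ) * (z : ℂ)) z t := by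
      simpa using (ofRealCLM.hasDerivAt (x := t)).mul_const (z : ℂ)
    exact (hasDerivAt_logLam (him t ht)).comp t h1
  have hdS : ∀ y : ℂ, 0 < y.im → DifferentiableAt ℂ (fun y ↦ logLam (-1 / y)) y := by
    intro y hy
    exact (differentiableAt_logLam (im_neg_one_div hy)).comp y (f := fun y : ℂ ↦ -1 / y)
      (DifferentiableAt.div (by fun_prop) (by fun_prop) (ne_zero_of_im_pos hy))
  -- Cauchy's estimate on the unit disc about `y` carries the decay over to the derivative, at the
  -- price of a factor `exp π`.
  have hcauchy : ∀ y : ℂ, Y + 1 ≤ y.im →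
      ‖deriv (fun y ↦ logLam (-1 / y)) y‖ ≤ C * Real.exp (Real.pi - Real.pi * y.im) := by
    intro y hy
    have hsub : ∀ w ∈ Metric.closedBall y 1, y.im - 1 ≤ w.im := by
      intro w hw
      have h1 : |(w - y).im| ≤ 1 := (abs_im_le_norm _).trans (by simpa [dist_eq_norm] using hw)
      have := neg_le_of_abs_le h1
      simp at this; linarith
    have := norm_deriv_le_of_forall_mem_sphere_norm_le (c := y) (R := 1)
      (C := C * Real.exp (Real.pi - Real.pi * y.im)) (f := fun y ↦ logLam (-1 / y)) one_pos ?_ ?_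
    · simpa using this
    · refine DifferentiableOn.diffContOnCl fun w hw ↦ (hdS w ?_).differentiableWithinAt
      rw [closure_ball y one_ne_zero] at hw
      linarith [hsub w hw]
    · intro w hw
      have h1 := hsub w (Metric.sphere_subset_closedBall hw)
      refine (hC w (by linarith)).trans ?_
      gcongr
      nlinarith [Real.pi_pos]
  have hlim : Tendsto (fun t : ℝ ↦ ((-1 / ((t : ℂ) * z)) : ℂ)) (𝓝[>] 0) (comap im atTop) := by
    rw [tendsto_comap_iff]
    have : ∀ t : ℝ, (im ∘ fun t : ℝ ↦ ((-1 / ((t : ℂ) * z)) : ℂ)) t =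
        (-1 / (z : ℂ)).im * t⁻¹ := by
      intro t
      simp only [Function.comp]
      rw [show -1 / ((t : ℂ) * z) = ((t⁻¹ : ℝ) : ℂ) * (-1 / z) by push_cast; field_simp,
        im_ofReal_mul, mul_comm]
    refine Tendsto.congr (fun t ↦ (this t).symm) ?_
    exact tendsto_inv_nhdsGT_zero.const_mul_atTop (im_neg_one_div z.2)
  have hzero : Tendsto (fun t : ℝ ↦ logLam (t * z)) (𝓝[>] 0) (𝓝 0) := by
    refine (tendsto_logLam_S.comp hlim).congr' ?_
    filter_upwards [self_mem_nhdsWithin] with t ht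
    have : (t : ℂ) ≠ 0 := by exact_mod_cast (ne_of_gt ht)
    simp only [Function.comp]
    congr 1; field_simp
  have hone : Tendsto (fun t : ℝ ↦ logLam (t * z)) (𝓝[<] 1) (𝓝 (logLam z)) := by
    have := (hder 1 one_pos).continuousAt.tendsto.mono_left (nhdsWithin_le_nhds (s := Set.Iio 1))
    simpa using this
  set c := (-1 / (z : ℂ)).im with hc
  have hcpos : 0 < c := im_neg_one_div z.2
  have hbound : ∀ t : ℝ, 0 < t → Y + 1 ≤ c / t → ‖logDeriv modularLambda ((t : ℂ) * (z : ℂ)) * z‖ ≤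
      C * Real.exp Real.pi * 2 / (c * c * ‖(z : ℂ)‖) := by
    intro t ht htY
    have ht0 : (t : ℂ) ≠ 0 := by exact_mod_cast ht.ne'
    have hyim : (-1 / ((t : ℂ) * z)).im = c / t := by
      rw [show -1 / ((t : ℂ) * z) = ((t⁻¹ : ℝ) : ℂ) * (-1 / z) by push_cast; field_simp,
        im_ofReal_mul, ← hc]; field_simp
    have h1 := hcauchy (-1 / ((t : ℂ) * z)) (by rw [hyim]; exact htY)
    rw [hyim] at h1
    have hypos : 0 < (-1 / ((t : ℂ) * z)).im := by rw [hyim]; positivity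
    have hd1 := (hdS _ hypos).hasDerivAt
    have hd2 : HasDerivAt (fun w : ℂ ↦ -1 / w) (1 / ((t : ℂ) * z) ^ 2) ((t : ℂ) * z) := by
      have := (hasDerivAt_inv (mul_ne_zero ht0 hz0)).neg
      convert! this using 1
      · ext w; simp [neg_div]
      · field_simp
    have hd3 := hd1.comp ((t : ℂ) * z) hd2
    have hd4 : HasDerivAt logLam (deriv (fun y ↦ logLam (-1 / y)) (-1 / ((t : ℂ) * z)) *
        (1 / ((t : ℂ) * z) ^ 2)) ((t : ℂ) * z) := by
      refine hd3.congr_of_eventuallyEq ?_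
      filter_upwards [isOpen_im_pos.mem_nhds (him t ht)] with w hw
      have := ne_zero_of_im_pos hw
      simp only [Function.comp]
      congr 1; field_simp
    rw [(hasDerivAt_logLam (him t ht)).unique hd4, norm_mul, norm_mul]
    -- The factor `t²` gained from the exponential cancels the `1/t²` produced by differentiating
    -- `-1/w`, so the integrand stays bounded near `0`.
    have h2 : Real.exp (Real.pi - Real.pi * (c / t)) ≤ Real.exp Real.pi * (2 * (t / c) ^ 2) := by
      rw [Real.exp_sub, div_eq_mul_inv]
      gcongr
      have hx : 0 < c / t := by positivity
      have h3 := Real.quadratic_le_exp_of_nonneg hx.le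
      have h4 : Real.exp (c / t) ≤ Real.exp (Real.pi * (c / t)) := by
        gcongr; nlinarith [Real.pi_gt_three]
      rw [inv_le_comm₀ (Real.exp_pos _) (by positivity)]
      refine le_trans ?_ h4
      refine le_trans ?_ h3
      have : (2 * (t / c) ^ 2)⁻¹ = (c / t) ^ 2 / 2 := by field_simp
      rw [this]; linarith
    have hzn : 0 < ‖(z : ℂ)‖ := norm_pos_iff.2 hz0
    have hn : ‖1 / ((t : ℂ) * z) ^ 2‖ = 1 / (t * ‖(z : ℂ)‖) ^ 2 := by
      rw [norm_div, norm_pow, norm_mul, norm_real, Real.norm_eq_abs, abs_of_pos ht, norm_one]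
    rw [hn]
    calc _ ≤ C * (Real.exp Real.pi * (2 * (t / c) ^ 2)) * (1 / (t * ‖(z : ℂ)‖) ^ 2) * ‖(z : ℂ)‖ := by
          gcongr
          exact h1.trans (by gcongr)
      _ = _ := by field_simp
  have hcontg : ContinuousOn (fun t : ℝ ↦ logDeriv modularLambda ((t : ℂ) * (z : ℂ)) * (z : ℂ))
      (Set.Ioc 0 1) := by
    have h1 : DifferentiableOn ℂ modularLambda {z | 0 < z.im} := fun z hz ↦
      (differentiableAt_modularLambda hz).differentiableWithinAt
    have h2 : ContinuousOn (logDeriv modularLambda) {z | 0 < z.im} :=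
      ((h1.deriv isOpen_im_pos).div h1 fun z hz ↦ modularLambda_ne_zero hz).continuousOn
    exact (h2.comp (by fun_prop) (fun t ht ↦ him t ht.1)).mul continuousOn_const
  have hint : IntervalIntegrable
      (fun t : ℝ ↦ logDeriv modularLambda ((t : ℂ) * (z : ℂ)) * (z : ℂ)) MeasureTheory.volume 0 1 := by
    rw [intervalIntegrable_iff_integrableOn_Ioc_of_le zero_le_one]
    obtain ⟨δ, hδ0, hδ⟩ : ∃ δ : ℝ, 0 < δ ∧ δ ≤ 1 ∧ ∀ t, 0 < t → t ≤ δ → Y + 1 ≤ c / t := by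
      refine ⟨min 1 (c / (Y + 1)), by positivity, min_le_left _ _, fun t ht h ↦ ?_⟩
      rw [le_div_iff₀ ht]
      have := h.trans (min_le_right _ _)
      rwa [le_div_iff₀ (by linarith), mul_comm] at this
    rw [← Set.Ioc_union_Ioc_eq_Ioc hδ0.le hδ.1]
    refine MeasureTheory.IntegrableOn.union ?_ ?_
    · refine MeasureTheory.IntegrableOn.of_bound (by simp)
        ((hcontg.mono (Set.Ioc_subset_Ioc_right hδ.1)).aestronglyMeasurable measurableSet_Ioc)
        (C * Real.exp Real.pi * 2 / (c * c * ‖(z : ℂ)‖)) ?_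
      filter_upwards [MeasureTheory.ae_restrict_mem measurableSet_Ioc] with t ht
      exact hbound t ht.1 (hδ.2 t ht.1 ht.2)
    · refine (ContinuousOn.integrableOn_Icc (hcontg.mono ?_)).mono_set Set.Ioc_subset_Icc_self
      exact fun t ht ↦ ⟨hδ0.trans_le ht.1, ht.2⟩
  have := intervalIntegral.integral_eq_sub_of_hasDerivAt_of_tendsto zero_lt_one
    (fun t ht ↦ hder t ht.1) hint hzero hone
  rw [logLambda, this, sub_zero]

end FourierEigen

end

noncomputable section

namespace FourierEigen

open Polynomial

/-! ### Level one forms as polynomials in `λ` -/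

/-- Polynomials `p` such that `θ₀₀ ^ (4 N) * p(λ)` is a modular form of weight `2 N` and level one. -/
def levelOne (N : ℕ) : Submodule ℝ ℝ[X] where
  carrier := {p | (∀ x : ℝ, p.eval (1 - x) = (-1) ^ N * p.eval x) ∧
    ∀ x : ℝ, x ≠ 0 → x ^ N * p.eval x⁻¹ = p.eval x}
  add_mem' := by
    rintro p q ⟨h1, h2⟩ ⟨h3, h4⟩
    refine ⟨fun x ↦ ?_, fun x hx ↦ ?_⟩
    · rw [eval_add, eval_add, h1, h3]; ring
    · rw [eval_add, eval_add, mul_add, h2 x hx, h4 x hx]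
  zero_mem' := by simp
  smul_mem' := by
    rintro c p ⟨h1, h2⟩
    refine ⟨fun x ↦ ?_, fun x hx ↦ ?_⟩
    · rw [eval_smul, eval_smul, h1, smul_eq_mul, smul_eq_mul]; ring
    · rw [eval_smul, eval_smul, ← h2 x hx, smul_eq_mul, smul_eq_mul]; ring

lemma levelOne_mul {M N : ℕ} {p q : ℝ[X]} (hp : p ∈ levelOne M) (hq : q ∈ levelOne N) :
    p * q ∈ levelOne (M + N) := by
  refine ⟨fun x ↦ ?_, fun x hx ↦ ?_⟩
  · rw [eval_mul, eval_mul, hp.1, hq.1]; ring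
  · rw [eval_mul, eval_mul, ← hp.2 x hx, ← hq.2 x hx]; ring

lemma levelOne_pow {M : ℕ} {p : ℝ[X]} (hp : p ∈ levelOne M) (k : ℕ) : p ^ k ∈ levelOne (k * M) := by
  refine ⟨fun x ↦ ?_, fun x hx ↦ ?_⟩
  · rw [eval_pow, eval_pow, hp.1, mul_pow, ← pow_mul, mul_comm M k]
  · rw [eval_pow, eval_pow, ← hp.2 x hx, mul_pow, ← pow_mul, mul_comm M k]

lemma eval_eq_reflect_mul (p : ℝ[X]) {M : ℕ} (hM : p.natDegree ≤ M) {x : ℝ} (hx : x ≠ 0) :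
    x ^ M * p.eval x⁻¹ = (p.reflect M).eval x := by
  have : Invertible x⁻¹ := invertibleOfNonzero (inv_ne_zero hx)
  have h := eval₂_reflect_mul_pow (RingHom.id ℝ) x⁻¹ M p hM
  simp only [eval₂_id, invOf_eq_inv, inv_inv, inv_pow] at h
  rw [← h]
  field_simp

lemma eq_of_eval_eq_off {p q : ℝ[X]} {S : Set ℝ} (hS : S.Finite)
    (h : ∀ x ∉ S, p.eval x = q.eval x) : p = q :=
  eq_of_infinite_eval_eq _ _ (hS.infinite_compl.mono h)

lemma natDegree_le_of_mem_levelOne {N : ℕ} {p : ℝ[X]} (hp : p ∈ levelOne N) : p.natDegree ≤ N := by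
  rcases eq_or_ne p 0 with rfl | hp0
  · simp
  set M := max N p.natDegree with hM
  -- The reflection has degree at most `M`, so comparing degrees gives `(M - N) + deg p ≤ M`.
  have h1 : X ^ (M - N) * p = p.reflect M := by
    refine eq_of_eval_eq_off (Set.finite_singleton (0 : ℝ)) fun x hx ↦ ?_
    have hx0 : x ≠ 0 := hx
    rw [← eval_eq_reflect_mul p (le_max_right _ _) hx0, eval_mul, ← hp.2 x hx0, eval_pow, eval_X,
      ← mul_assoc, ← pow_add, Nat.sub_add_cancel (le_max_left _ _)]
  have h2 : (X ^ (M - N) * p).natDegree = M - N + p.natDegree := by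
    rw [natDegree_mul (pow_ne_zero _ X_ne_zero) hp0, natDegree_X_pow]
  have h3 : (p.reflect M).natDegree ≤ max M p.natDegree := natDegree_reflect_le
  rw [← h1, h2] at h3
  omega

lemma reflect_of_mem_levelOne {N : ℕ} {p : ℝ[X]} (hp : p ∈ levelOne N) : p.reflect N = p := by
  refine eq_of_eval_eq_off (Set.finite_singleton (0 : ℝ)) fun x hx ↦ ?_
  rw [← eval_eq_reflect_mul p (natDegree_le_of_mem_levelOne hp) hx, hp.2 x hx]

lemma comp_of_mem_levelOne {N : ℕ} {p : ℝ[X]} (hp : p ∈ levelOne N) :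
    p.comp (1 - X) = C ((-1) ^ N) * p := by
  refine Polynomial.funext fun x ↦ ?_
  simp [eval_comp, hp.1 x]

lemma isCoprime_X_pow_one_sub_X_pow (m k : ℕ) :
    IsCoprime ((X : ℝ[X]) ^ m) ((1 - X) ^ k) :=
  IsCoprime.pow ⟨1, 1, by ring⟩

/-- The valence bound in polynomial form. The symmetries carry the vanishing at `λ = 0` to `λ = 1`
and to `λ = ∞`, and the orders at these three points add up to at most `N`. -/
lemma eq_zero_of_X_pow_dvd {N m : ℕ} {p : ℝ[X]} (hp : p ∈ levelOne N) (hm : X ^ m ∣ p)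
    (hN : N < 3 * m) : p = 0 := by
  by_contra hp0
  have h1 : (1 - X) ^ m ∣ p := by
    obtain ⟨q, hq⟩ := hm
    have h2 := comp_of_mem_levelOne hp
    rw [hq, mul_comp, pow_comp, X_comp, ← hq] at h2
    have h3 : (1 - X) ^ m ∣ C ((-1) ^ N) * p := ⟨_, h2.symm⟩
    have h4 : p = C ((-1) ^ N) * (C ((-1) ^ N) * p) := by
      rw [← mul_assoc, ← C_mul, ← mul_pow]; simp
    rw [h4]
    exact Dvd.dvd.mul_left h3 _
  have h2 : X ^ m * (1 - X) ^ m ∣ p := (isCoprime_X_pow_one_sub_X_pow m m).mul_dvd hm h1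
  have h3 := natDegree_le_of_dvd h2 hp0
  have h5 : (1 - X : ℝ[X]).natDegree = 1 := by
    rw [show (1 - X : ℝ[X]) = -(X - C 1) by simp, natDegree_neg, natDegree_X_sub_C]
  have h6 : (1 - X : ℝ[X]) ≠ 0 := by
    intro h; rw [h] at h5; simp at h5
  rw [natDegree_mul (pow_ne_zero _ X_ne_zero) (pow_ne_zero _ h6), natDegree_X_pow, natDegree_pow,
    h5] at h3
  have hD := natDegree_le_of_mem_levelOne hp
  -- By the palindromic symmetry this is the leading coefficient, so the order at `0` is at most `N
  -- - deg p`.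
  have h7 : p.coeff (N - p.natDegree) ≠ 0 := by
    rw [← revAt_le hD, ← coeff_reflect, reflect_of_mem_levelOne hp]
    exact leadingCoeff_ne_zero.2 hp0
  have h8 : m ≤ N - p.natDegree := by
    by_contra! hlt
    exact h7 (X_pow_dvd_iff.1 hm _ hlt)
  omega

/-- Six times the Serre derivative of `θ₀₀ ^ (4 k) * p(λ)`, expressed in the variable `λ`. -/
def serre (k : ℝ) (p : ℝ[X]) : ℝ[X] :=
  3 * X * (1 - X) * derivative p + C k * (2 * X - 1) * p

/-- Differentiating both functional equations of `p` leaves multiples of `p` itself, which the term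
`N (2X - 1) p` absorbs. -/
lemma serre_mem_levelOne {N : ℕ} {p : ℝ[X]} (hp : p ∈ levelOne N) :
    serre N p ∈ levelOne (N + 1) := by
  refine ⟨fun x ↦ ?_, fun x hx ↦ ?_⟩
  · have h1 := congrArg (fun q ↦ eval x (derivative q)) (comp_of_mem_levelOne hp)
    have h2 : -(eval (1 - x) (derivative p)) = (-1) ^ N * eval x (derivative p) := by
      simp only [derivative_comp, derivative_C_mul, eval_mul, eval_C, eval_comp] at h1
      simpa using h1
    simp only [serre, eval_add, eval_mul, eval_sub, eval_one, eval_X, eval_C, eval_ofNat, hp.1 x]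
    linear_combination (-3 * (1 - x) * x) * h2
  · have h1 : HasDerivAt (fun x : ℝ ↦ x ^ N * p.eval x⁻¹)
        (N * x ^ (N - 1) * p.eval x⁻¹ + x ^ N * ((derivative p).eval x⁻¹ * (-(x ^ 2)⁻¹))) x :=
      (hasDerivAt_pow N x).mul ((p.hasDerivAt x⁻¹).comp x (hasDerivAt_inv hx))
    have h2 : HasDerivAt (fun x : ℝ ↦ x ^ N * p.eval x⁻¹) ((derivative p).eval x) x := by
      refine (p.hasDerivAt x).congr_of_eventuallyEq ?_
      filter_upwards [isOpen_ne.mem_nhds hx] with y hy using hp.2 y hy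
    have h3 := h1.unique h2
    have h4 : x * (N * x ^ (N - 1)) = N * x ^ N := by
      rcases N with _ | N
      · simp
      · simp [pow_succ]; ring
    have h5 := hp.2 x hx
    simp only [serre, eval_add, eval_mul, eval_sub, eval_one, eval_X, eval_C, eval_ofNat]
    rw [← h3, ← h5]
    generalize (derivative p).eval x⁻¹ = b at *
    generalize p.eval x⁻¹ = a at *
    rw [pow_succ]
    have h6 : x * x⁻¹ = 1 := mul_inv_cancel₀ hx
    have h7 : 3 * x * (1 - x) * (↑N * x ^ (N - 1) * a + x ^ N * (b * -(x ^ 2)⁻¹)) =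
        3 * (1 - x) * (N * x ^ N) * a - 3 * (1 - x) * x ^ N * b * x⁻¹ := by
      rw [← h4]; field_simp; ring
    rw [h7]
    field_simp
    ring

/-- The polynomial of `E₄`. -/
def polyE4 : ℝ[X] := 1 - X + X ^ 2

/-- The polynomial of a multiple of `E₆`. -/
def polyE6 : ℝ[X] := (1 + X) * (2 - X) * (1 - 2 * X)

/-- The polynomial of a multiple of the discriminant. -/
def polyDelta : ℝ[X] := X ^ 2 * (1 - X) ^ 2

lemma polyE4_mem : polyE4 ∈ levelOne 2 := by
  refine ⟨fun x ↦ ?_, fun x hx ↦ ?_⟩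
  · simp [polyE4]; ring
  · simp [polyE4]; field_simp; ring

lemma polyE6_mem : polyE6 ∈ levelOne 3 := by
  refine ⟨fun x ↦ ?_, fun x hx ↦ ?_⟩
  · simp [polyE6]; ring
  · simp [polyE6]; field_simp; ring

lemma polyDelta_mem : polyDelta ∈ levelOne 6 := by
  refine ⟨fun x ↦ ?_, fun x hx ↦ ?_⟩
  · simp [polyDelta]; ring
  · simp [polyDelta]; field_simp; ring

/-- The polynomial of `-θ₀₁⁴ A + θ₀₁⁴ (θ₀₀⁴ + θ₁₀⁴) B`. -/
def polyOmega (A B : ℝ[X]) : ℝ[X] := -((1 - X) * A) + (1 - X ^ 2) * B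

/-- The polynomial of `θ₁₀⁴ A + θ₁₀⁴ (θ₀₀⁴ + θ₀₁⁴) B`. -/
def polyPhi (A B : ℝ[X]) : ℝ[X] := X * A + X * (2 - X) * B

/-- The pairs `(A, B)` parametrise a module of rank two over the level one forms that is stable
under the Serre derivative. The same map on `(A, B)` serves for `polyPhi`, the image of `polyOmega`
under `λ ↦ 1 - λ` up to sign. -/
lemma serre_polyOmega (k : ℝ) (A B : ℝ[X]) :
    serre k (polyOmega A B) =
      polyOmega (serre (k - 1) A + 2 * polyE4 * B) (serre (k - 2) B + A) := by
  simp [serre, polyOmega, polyE4, derivative_mul, derivative_pow, map_ofNat C]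
  ring

lemma serre_polyPhi (k : ℝ) (A B : ℝ[X]) :
    serre k (polyPhi A B) =
      polyPhi (serre (k - 1) A + 2 * polyE4 * B) (serre (k - 2) B + A) := by
  simp [serre, polyPhi, polyE4, derivative_mul, map_ofNat C]
  ring

lemma X_pow_dvd_serre {k : ℝ} {m : ℕ} {p : ℝ[X]} (h : X ^ m ∣ p) : X ^ m ∣ serre k p := by
  obtain ⟨q, rfl⟩ := h
  refine ⟨serre k q + 3 * (m : ℝ[X]) * (1 - X) * q, ?_⟩
  rcases m with _ | m
  · simp
  · simp only [serre, derivative_mul, derivative_X_pow, Nat.add_sub_cancel, map_natCast]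
    push_cast
    ring

/-- Minus the Taylor polynomial of `-log (1 - X)`. -/
def logPoly (m : ℕ) : ℝ[X] := -∑ k ∈ Finset.range m, C (1 / ((k : ℝ) + 1)) * X ^ (k + 1)

lemma one_sub_X_mul_derivative_logPoly (m : ℕ) :
    (1 - X) * derivative (logPoly m) = X ^ m - 1 := by
  have h : derivative (logPoly m) = -∑ k ∈ Finset.range m, X ^ k := by
    rw [logPoly, derivative_neg, derivative_sum]
    congr 1
    refine Finset.sum_congr rfl fun k _ ↦ ?_
    rw [derivative_C_mul, derivative_X_pow, ← mul_assoc]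
    have : C (1 / ((k : ℝ) + 1)) * C (((k + 1 : ℕ) : ℝ)) = (1 : ℝ[X]) := by
      rw [← C_mul]; push_cast; rw [one_div_mul_cancel (by positivity), C_1]
    rw [this]; simp
  rw [h, ← mul_geom_sum]
  ring

/-- For the true `log(1-X)` the last term would be `-3Xp`. The truncation adds only a multiple of
`X^(m+1)`. -/
lemma serre_mul_logPoly (k : ℝ) (m : ℕ) (p : ℝ[X]) :
    serre k (p * logPoly m) = serre k p * logPoly m + 3 * X * p * (X ^ m - 1) := by
  rw [← one_sub_X_mul_derivative_logPoly]
  simp only [serre, derivative_mul]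
  ring

/-! ### Wronskians -/

/-- After removal of the gcd the two factors are coprime with vanishing Wronskian, which in
characteristic zero makes both constant. -/
lemma exists_smul_eq_of_wronskian {u v : ℝ[X]} (h : u * derivative v = v * derivative u) :
    ∃ α β : ℝ, (α ≠ 0 ∨ β ≠ 0) ∧ C α * v = C β * u := by
  rcases eq_or_ne u 0 with rfl | hu
  · exact ⟨0, 1, by simp⟩
  set g := EuclideanDomain.gcd u v with hg
  have hg0 : g ≠ 0 := fun h0 ↦ hu (EuclideanDomain.gcd_eq_zero_iff.1 h0).1
  obtain ⟨a, ha⟩ := EuclideanDomain.gcd_dvd_left u v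
  obtain ⟨b, hb⟩ := EuclideanDomain.gcd_dvd_right u v
  rw [← hg] at ha hb
  have hco : IsCoprime a b := by
    have h1 := EuclideanDomain.gcd_eq_gcd_ab u v
    rw [← hg] at h1
    refine ⟨EuclideanDomain.gcdA u v, EuclideanDomain.gcdB u v, ?_⟩
    apply mul_left_cancel₀ hg0
    generalize EuclideanDomain.gcdA u v = s at *
    generalize EuclideanDomain.gcdB u v = t at *
    clear_value g
    subst ha hb
    linear_combination -h1
  have hw : wronskian a b = 0 := by
    rw [ha, hb, derivative_mul, derivative_mul] at h
    have : g ^ 2 * wronskian a b = 0 := by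
      rw [wronskian]; linear_combination h
    exact (mul_eq_zero.1 this).resolve_left (pow_ne_zero 2 hg0)
  obtain ⟨h1, h2⟩ := hco.wronskian_eq_zero_iff.1 hw
  obtain ⟨α, hα⟩ := natDegree_eq_zero.1 (derivative_eq_zero.1 h1)
  obtain ⟨β, hβ⟩ := natDegree_eq_zero.1 (derivative_eq_zero.1 h2)
  refine ⟨α, β, Or.inl ?_, ?_⟩
  · rintro rfl
    rw [C_0] at hα
    rw [← hα, mul_zero] at ha
    exact hu ha
  · rw [ha, hb, ← hα, ← hβ]; ring

/-- The derivative of a rational function has no residue at `0`. -/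
lemma no_residue_aux {s c p₀ : ℝ[X]} (hs : s.eval 0 ≠ 0) (hc : c.eval 0 ≠ 0) (hp : p₀.eval 0 ≠ 0)
    (m : ℕ) : ∀ w : ℝ[X], X * s * (X ^ m * p₀ * derivative w - w * derivative (X ^ m * p₀)) ≠
      (X ^ m * p₀) ^ 2 * c := by
  induction m with
  | zero =>
    intro w h
    have := congrArg (eval 0) h
    simp at this
    rcases this with h | h
    · exact hp h
    · exact hc h
  | succ m ih =>
    intro w h
    -- If `w(0) = 0`, a factor `X` cancels from the fraction and the induction applies. Otherwise
    -- the pole has exact order `m + 1`, and the lowest coefficient `-(m+1) s w p₀` at `0` would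
    -- have to vanish.
    by_cases hw : w.eval 0 = 0
    · obtain ⟨w₁, rfl⟩ : X ∣ w := by rwa [X_dvd_iff, coeff_zero_eq_eval_zero]
      refine ih w₁ ?_
      apply mul_left_cancel₀ (pow_ne_zero 2 (X_ne_zero (R := ℝ)))
      rw [pow_succ', mul_assoc X (X ^ m) p₀] at h
      rw [derivative_mul, derivative_mul (f := X) (g := X ^ m * p₀), derivative_X] at h
      linear_combination h
    · have h2 : s * (X * p₀ * derivative w - w * (((m + 1 : ℕ) : ℝ[X]) * p₀ + X * derivative p₀)) =
          X ^ (m + 1) * p₀ ^ 2 * c := by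
        apply mul_left_cancel₀ (pow_ne_zero (m + 1) (X_ne_zero (R := ℝ)))
        rw [derivative_mul, derivative_X_pow] at h
        simp only [Nat.add_sub_cancel, map_natCast] at h
        rw [pow_succ] at h ⊢
        linear_combination h
      have := congrArg (eval 0) h2
      simp [hs, hw, hp] at this
      norm_cast at this

/-- In terms of fractions: `(w/p)' = c/(X s)` is impossible, since the right side has a simple pole
at `0`. -/
lemma no_residue {s c p w : ℝ[X]} (hs : s.eval 0 ≠ 0) (hc : c.eval 0 ≠ 0) (hp : p ≠ 0) :
    X * s * (p * derivative w - w * derivative p) ≠ p ^ 2 * c := by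
  obtain ⟨p₀, h1, h2⟩ := exists_eq_pow_rootMultiplicity_mul_and_not_dvd p hp 0
  rw [C_0, sub_zero] at h1 h2
  have h3 : p₀.eval 0 ≠ 0 := by
    rwa [X_dvd_iff, coeff_zero_eq_eval_zero] at h2
  rw [h1]
  exact no_residue_aux hs hc h3 _ w

end FourierEigen

end

/-! ### Injectivity: a triple with too high vanishing order is zero -/

noncomputable section

namespace FourierEigen

open Polynomial

lemma levelOne_mul_of_eq {M N L : ℕ} {p q : ℝ[X]} (hp : p ∈ levelOne M) (hq : q ∈ levelOne N)
    (h : M + N = L) : p * q ∈ levelOne L := h ▸ levelOne_mul hp hq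

lemma levelOne_natCast_mul {N : ℕ} {p : ℝ[X]} (c : ℕ) (hp : p ∈ levelOne N) :
    (c : ℝ[X]) * p ∈ levelOne N := by
  rw [← nsmul_eq_mul]; exact (levelOne N).nsmul_mem hp c

lemma X_pow_dvd_of_mul_dvd {m : ℕ} {H : ℝ[X]} (h : X ^ (m + 1) ∣ 3 * X * (1 - X) * H) :
    X ^ m ∣ H := by
  have h1 : X ^ m ∣ 3 * (1 - X) * H := by
    rw [pow_succ'] at h
    obtain ⟨q, hq⟩ := h
    refine ⟨q, mul_left_cancel₀ (X_ne_zero (R := ℝ)) ?_⟩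
    linear_combination hq
  have h2 := (isCoprime_X_pow_one_sub_X_pow m 1)
  rw [pow_one] at h2
  have h3 : X ^ m ∣ (1 - X) * H := by
    have : (1 - X) * H = C (1 / 3) * (3 * (1 - X) * H) := by
      have : C (1 / 3 : ℝ) * 3 = (1 : ℝ[X]) := by
        rw [show (3 : ℝ[X]) = C 3 from (map_ofNat C 3).symm, ← C_mul]; norm_num
      linear_combination (-(1 - X) * H) * this
    rw [this]
    exact Dvd.dvd.mul_left h1 _
  exact h2.dvd_of_dvd_mul_left h3

lemma polyOmega_dvd {m : ℕ} {A B : ℝ[X]} (hA : X ^ m ∣ A) (hB : X ^ m ∣ B) :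
    X ^ m ∣ polyOmega A B :=
  dvd_add ((Dvd.dvd.mul_left hA _).neg_right) (Dvd.dvd.mul_left hB _)

/-- Two polynomial solutions whose associated functions are proportional vanish. -/
lemma eq_zero_of_polyPhi_proportional {K : ℕ} {A B : ℝ[X]} (hA : A ∈ levelOne (K + 1))
    (hB : B ∈ levelOne K) {α β : ℝ} (h0 : α ≠ 0 ∨ β ≠ 0)
    (h : C α * polyPhi A B = C β * polyOmega A B) : A = 0 ∧ B = 0 := by
  -- The relation is played against the symmetries of `A` and `B`: `e3` is `e1` at `1 - x`, and `e2`
  -- below is `e1` at `1/x`. Together they overdetermine `A(x)` and `B(x)`.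
  have e1 : ∀ x : ℝ, α * (x * (A.eval x + (2 - x) * B.eval x)) =
      -β * ((1 - x) * (A.eval x - (1 + x) * B.eval x)) := by
    intro x
    have := congrArg (eval x) h
    simp [polyPhi, polyOmega] at this
    linear_combination this
  have e3 : ∀ x : ℝ, α * ((1 - x) * (A.eval x - (1 + x) * B.eval x)) =
      -β * (x * (A.eval x + (2 - x) * B.eval x)) := by
    intro x
    have := e1 (1 - x)
    rw [hA.1, hB.1, pow_succ] at this
    have hs : ((-1 : ℝ) ^ K) ^ 2 = 1 := by rw [← pow_mul, mul_comm, pow_mul]; simp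
    generalize (-1 : ℝ) ^ K = σ at *
    linear_combination (-σ) * this + (-α * ((1 - x) * (A.eval x - (1 + x) * B.eval x)) -
      β * (x * (A.eval x + (2 - x) * B.eval x))) * hs
  have hB0 : B = 0 := by
    refine eq_of_eval_eq_off (S := {0, 1}) (by simp) fun x hx ↦ ?_
    simp only [Set.mem_insert_iff, Set.mem_singleton_iff, not_or] at hx
    have hx1 : 1 - x ≠ 0 := fun h ↦ hx.2 (by linarith)
    rw [eval_zero]
    by_cases hα : α = 0
    · have hβ : β ≠ 0 := h0.resolve_left (by simp [hα])
      have a := e1 x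
      have b := e3 x
      simp only [hα, zero_mul] at a b
      have a' : A.eval x - (1 + x) * B.eval x = 0 := by
        have := mul_eq_zero.1 a.symm
        simpa [hβ, hx1] using this
      have b' : A.eval x + (2 - x) * B.eval x = 0 := by
        have := mul_eq_zero.1 b.symm
        simpa [hβ, hx.1] using this
      linarith
    · have e2 : ∀ x : ℝ, x ≠ 0 → α * (A.eval x + (2 * x - 1) * B.eval x) =
          β * ((1 - x) * (A.eval x - (1 + x) * B.eval x)) := by
        intro x hx
        have := e1 x⁻¹
        rw [← hA.2 x hx, ← hB.2 x hx, pow_succ]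
        generalize A.eval x⁻¹ = a at *
        generalize B.eval x⁻¹ = b at *
        field_simp at this
        linear_combination (x ^ K) * this
      -- The sum of `e1` and `e2` no longer contains `β`. At `x` and at `1 - x` it gives two
      -- equations for `A(x)`, `B(x)` whose determinant is a nonzero multiple of `x(1-x)`.
      have e4 : ∀ x : ℝ, x ≠ 0 → (1 + x) * A.eval x = (1 + x ^ 2 - 4 * x) * B.eval x := by
        intro x hx
        apply mul_left_cancel₀ hα
        linear_combination e1 x + e2 x hx
      have f1 := e4 x hx.1
      have f2 := e4 (1 - x) hx1
      rw [hA.1, hB.1, pow_succ] at f2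
      have hs : (-1 : ℝ) ^ K ≠ 0 := pow_ne_zero _ (by norm_num)
      have f3 : (2 - x) * A.eval x = -(x ^ 2 + 2 * x - 2) * B.eval x := by
        apply mul_left_cancel₀ hs
        linear_combination -f2
      have f4 : x * (1 - x) * B.eval x = 0 := by
        linear_combination ((2 - x) / 9) * f1 - ((1 + x) / 9) * f3
      simpa [hx.1, hx1] using f4
  refine ⟨eq_of_eval_eq_off (S := {1 / 2}) (by simp) fun x hx ↦ ?_, hB0⟩
  have a := e1 x
  have b := e3 x
  rw [hB0] at a b
  simp only [eval_zero, mul_zero, add_zero, sub_zero] at a b ⊢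
  by_contra hAx
  have a' : α * x = -β * (1 - x) := by
    apply mul_right_cancel₀ hAx; linear_combination a
  have b' : α * (1 - x) = -β * x := by
    apply mul_right_cancel₀ hAx; linear_combination b
  have c : α = -β := by linear_combination a' + b'
  have hα : α ≠ 0 := by
    rcases h0 with h | h
    · exact h
    · intro h1; exact h (by linarith)
  have d : α * (2 * x - 1) = 0 := by linear_combination a' - (1 - x) * c
  have := (mul_eq_zero.1 d).resolve_left hα
  exact hx (by rw [Set.mem_singleton_iff]; linarith)

/-- The order of vanishing bounds: a triple with too high vanishing order at the cusp is zero. -/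
theorem eq_zero_of_vanishing {K n s : ℕ} {p A B : ℝ[X]} (hp : p ∈ levelOne (K + 2))
    (hA : A ∈ levelOne (K + 1)) (hB : B ∈ levelOne K) (hs : 1 ≤ s) (hps : X ^ (2 * s) ∣ p)
    (hA2 : X ^ 2 ∣ A) (hB2 : X ^ 2 ∣ B)
    (hY : X ^ (2 * n + 1) ∣ p * logPoly (2 * n) + polyPhi A B)
    (h3 : K < 2 * s + 2 * n) (h2 : K < 3 * n + 2) : p = 0 ∧ A = 0 ∧ B = 0 := by
  obtain ⟨T, hT⟩ : ∃ f : ℝ[X], f = logPoly (2 * n) := ⟨_, rfl⟩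
  -- `(p1, A1, B1)` and `(p2, A2, B2)` are the triples of the first and second Serre derivatives of
  -- `ψ = f log λ + ω`. The terms `-3p` and `-3p1` come from differentiating the logarithm.
  obtain ⟨p1, hp1⟩ : ∃ f : ℝ[X], f = serre ((K + 2 : ℕ) : ℝ) p := ⟨_, rfl⟩
  obtain ⟨p2, hp2⟩ : ∃ f : ℝ[X], f = serre ((K + 3 : ℕ) : ℝ) p1 := ⟨_, rfl⟩
  obtain ⟨A1, hA1⟩ : ∃ f : ℝ[X], f = serre ((K + 1 : ℕ) : ℝ) A + 2 * polyE4 * B - 3 * p := ⟨_, rfl⟩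
  obtain ⟨B1, hB1⟩ : ∃ f : ℝ[X], f = serre (K : ℝ) B + A := ⟨_, rfl⟩
  obtain ⟨A2, hA2'⟩ : ∃ f : ℝ[X], f = serre ((K + 2 : ℕ) : ℝ) A1 + 2 * polyE4 * B1 - 3 * p1 := ⟨_, rfl⟩
  obtain ⟨B2, hB2'⟩ : ∃ f : ℝ[X], f = serre ((K + 1 : ℕ) : ℝ) B1 + A1 := ⟨_, rfl⟩
  rw [← hT] at hY
  have mp1 : p1 ∈ levelOne (K + 3) := hp1 ▸ serre_mem_levelOne hp
  have mp2 : p2 ∈ levelOne (K + 4) := hp2 ▸ serre_mem_levelOne mp1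
  have hE : ∀ {M : ℕ} {q : ℝ[X]}, q ∈ levelOne M → 2 * polyE4 * q ∈ levelOne (M + 2) := by
    intro M q hq
    rw [mul_assoc]
    exact levelOne_natCast_mul 2 (levelOne_mul_of_eq polyE4_mem hq (by omega))
  have mA1 : A1 ∈ levelOne (K + 2) := hA1 ▸
    sub_mem (add_mem (serre_mem_levelOne hA) (hE hB)) (levelOne_natCast_mul 3 hp)
  have mB1 : B1 ∈ levelOne (K + 1) := hB1 ▸ add_mem (serre_mem_levelOne hB) hA
  have mA2 : A2 ∈ levelOne (K + 3) := hA2' ▸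
    sub_mem (add_mem (serre_mem_levelOne mA1) (hE mB1)) (levelOne_natCast_mul 3 mp1)
  have mB2 : B2 ∈ levelOne (K + 2) := hB2' ▸ add_mem (serre_mem_levelOne mB1) mA1
  have c1 : (((K + 2 : ℕ) : ℝ)) - 1 = ((K + 1 : ℕ) : ℝ) := by push_cast; ring
  have c2 : (((K + 2 : ℕ) : ℝ)) - 2 = (K : ℝ) := by push_cast; ring
  have c3 : (((K + 3 : ℕ) : ℝ)) - 1 = ((K + 2 : ℕ) : ℝ) := by push_cast; ring
  have c4 : (((K + 3 : ℕ) : ℝ)) - 2 = ((K + 1 : ℕ) : ℝ) := by push_cast; ring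
  have q1 : serre ((K + 2 : ℕ) : ℝ) (polyOmega A B) = polyOmega A1 B1 - 3 * (1 - X) * p := by
    rw [serre_polyOmega, c1, c2, hA1, hB1, polyOmega, polyOmega]; ring
  have q2 : serre ((K + 3 : ℕ) : ℝ) (polyOmega A1 B1) = polyOmega A2 B2 - 3 * (1 - X) * p1 := by
    rw [serre_polyOmega, c3, c4, hA2', hB2', polyOmega, polyOmega]; ring
  have r1 : serre ((K + 2 : ℕ) : ℝ) (polyPhi A B) = polyPhi A1 B1 + 3 * X * p := by
    rw [serre_polyPhi, c1, c2, hA1, hB1, polyPhi, polyPhi]; ring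
  have r2 : serre ((K + 3 : ℕ) : ℝ) (polyPhi A1 B1) = polyPhi A2 B2 + 3 * X * p1 := by
    rw [serre_polyPhi, c3, c4, hA2', hB2', polyPhi, polyPhi]; ring
  have sadd : ∀ (k : ℝ) (f g : ℝ[X]), serre k (f + g) = serre k f + serre k g := by
    intro k f g; simp only [serre, derivative_add]; ring
  have Y1 : X ^ (2 * n + 1) ∣ p1 * T + polyPhi A1 B1 := by
    have h := X_pow_dvd_serre (k := ((K + 2 : ℕ) : ℝ)) hY
    rw [sadd, hT, serre_mul_logPoly, r1, ← hp1, ← hT] at h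
    -- The truncation error of the logarithm has exactly the tolerated order `2n + 1`, so the
    -- vanishing order survives differentiation.
    have h' : X ^ (2 * n + 1) ∣ 3 * X * p * X ^ (2 * n) := ⟨3 * p, by ring⟩
    have e : p1 * T + polyPhi A1 B1 = p1 * T + 3 * X * p * (X ^ (2 * n) - 1) +
      (polyPhi A1 B1 + 3 * X * p) - 3 * X * p * X ^ (2 * n) := by ring
    rw [e]
    exact dvd_sub h h'
  have Y2 : X ^ (2 * n + 1) ∣ p2 * T + polyPhi A2 B2 := by
    have h := X_pow_dvd_serre (k := ((K + 3 : ℕ) : ℝ)) Y1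
    rw [sadd, hT, serre_mul_logPoly, r2, ← hp2, ← hT] at h
    have h' : X ^ (2 * n + 1) ∣ 3 * X * p1 * X ^ (2 * n) := ⟨3 * p1, by ring⟩
    have e : p2 * T + polyPhi A2 B2 = p2 * T + 3 * X * p1 * (X ^ (2 * n) - 1) +
      (polyPhi A2 B2 + 3 * X * p1) - 3 * X * p1 * X ^ (2 * n) := by ring
    rw [e]
    exact dvd_sub h h'
  have dp1 : X ^ (2 * s) ∣ p1 := hp1 ▸ X_pow_dvd_serre hps
  have dp2 : X ^ (2 * s) ∣ p2 := hp2 ▸ X_pow_dvd_serre dp1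
  have h2s : (X : ℝ[X]) ^ 2 ∣ X ^ (2 * s) := pow_dvd_pow X (by omega)
  have dA1 : X ^ 2 ∣ A1 := hA1 ▸ dvd_sub (dvd_add (X_pow_dvd_serre hA2) (Dvd.dvd.mul_left hB2 _))
    (Dvd.dvd.mul_left (h2s.trans hps) _)
  have dB1 : X ^ 2 ∣ B1 := hB1 ▸ dvd_add (X_pow_dvd_serre hB2) hA2
  have dA2 : X ^ 2 ∣ A2 := hA2' ▸ dvd_sub (dvd_add (X_pow_dvd_serre dA1) (Dvd.dvd.mul_left dB1 _))
    (Dvd.dvd.mul_left (h2s.trans dp1) _)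
  have dB2 : X ^ 2 ∣ B2 := hB2' ▸ dvd_add (X_pow_dvd_serre dB1) dA1
  have dq := polyOmega_dvd hA2 hB2
  have dq1 := polyOmega_dvd dA1 dB1
  have dq2 := polyOmega_dvd dA2 dB2
  by_cases hp0 : p = 0
  · have hp10 : p1 = 0 := by simp [hp1, hp0, serre]
    refine ⟨hp0, ?_⟩
    -- Up to the factor `3X(1-X)` this is the determinant of `polyOmega`, of order at least 2, and
    -- `polyPhi`, of order at least `2n + 1`. Its order is thus at least `2n + 2`, too much for a
    -- level one polynomial of index `2K + 2`.
    have hH : A * B1 - A1 * B = 0 := by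
      refine eq_zero_of_X_pow_dvd (N := 2 * K + 2) (m := 2 * n + 2) ?_ ?_ (by omega)
      · exact sub_mem (levelOne_mul_of_eq hA mB1 (by omega)) (levelOne_mul_of_eq mA1 hB (by omega))
      · apply X_pow_dvd_of_mul_dvd
        have e : 3 * X * (1 - X) * (A * B1 - A1 * B) =
            polyOmega A1 B1 * (p * T + polyPhi A B) - polyOmega A B * (p1 * T + polyPhi A1 B1) := by
          rw [hp0, hp10]
          simp only [polyOmega, polyPhi]
          ring
        rw [e, show 2 * n + 2 + 1 = 2 + (2 * n + 1) by ring, pow_add]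
        exact dvd_sub (mul_dvd_mul dq1 hY) (mul_dvd_mul dq Y1)
    have hw : polyOmega A B * derivative (polyPhi A B) =
        polyPhi A B * derivative (polyOmega A B) := by
      have e : 3 * X * (1 - X) * (polyOmega A B * derivative (polyPhi A B) -
          polyPhi A B * derivative (polyOmega A B)) = 0 := by
        have e1 : polyOmega A B * serre ((K + 2 : ℕ) : ℝ) (polyPhi A B) -
            polyPhi A B * serre ((K + 2 : ℕ) : ℝ) (polyOmega A B) = 0 := by
          rw [q1, r1, hp0]
          simp only [polyOmega, polyPhi]
          linear_combination (-3 * X * (1 - X)) * hH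
        simp only [serre] at e1
        linear_combination e1
      have hne : (3 * X * (1 - X) : ℝ[X]) ≠ 0 := by
        intro h0
        have := congrArg (eval 2) h0
        norm_num at this
      exact sub_eq_zero.1 ((mul_eq_zero.1 e).resolve_left hne)
    obtain ⟨α, β, h0, hab⟩ := exists_smul_eq_of_wronskian hw
    exact eq_zero_of_polyPhi_proportional hA hB h0 hab
  · exfalso
    -- The three by three determinant of the triples. The columns `p`, `polyOmega` and `p T +
    -- polyPhi` have orders at least `2s`, `2` and `2n + 1`; one factor `X` is lost to `3X(1-X)`.
    -- The valence bound for index `3K + 6` then needs `K < 2s + 2n`.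
    have hH : p * (A1 * B2 - A2 * B1) - p1 * (A * B2 - A2 * B) + p2 * (A * B1 - A1 * B) = 0 := by
      refine eq_zero_of_X_pow_dvd (N := 3 * K + 6) (m := 2 * s + 2 + 2 * n) ?_ ?_ (by omega)
      · refine add_mem (sub_mem ?_ ?_) ?_
        · exact levelOne_mul_of_eq hp (sub_mem (levelOne_mul_of_eq mA1 mB2 rfl)
            (levelOne_mul_of_eq mA2 mB1 (by omega))) (by omega)
        · exact levelOne_mul_of_eq mp1 (sub_mem (levelOne_mul_of_eq hA mB2 rfl)
            (levelOne_mul_of_eq mA2 hB (by omega))) (by omega)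
        · exact levelOne_mul_of_eq mp2 (sub_mem (levelOne_mul_of_eq hA mB1 rfl)
            (levelOne_mul_of_eq mA1 hB (by omega))) (by omega)
      · apply X_pow_dvd_of_mul_dvd
        have e : 3 * X * (1 - X) * (p * (A1 * B2 - A2 * B1) - p1 * (A * B2 - A2 * B) +
              p2 * (A * B1 - A1 * B)) =
            -(p * (polyOmega A1 B1 * (p2 * T + polyPhi A2 B2) -
                polyOmega A2 B2 * (p1 * T + polyPhi A1 B1)) -
              p1 * (polyOmega A B * (p2 * T + polyPhi A2 B2) -
                polyOmega A2 B2 * (p * T + polyPhi A B)) +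
              p2 * (polyOmega A B * (p1 * T + polyPhi A1 B1) -
                polyOmega A1 B1 * (p * T + polyPhi A B))) := by
          simp only [polyOmega, polyPhi]
          ring
        rw [e, show 2 * s + 2 + 2 * n + 1 = 2 * s + (2 + (2 * n + 1)) by ring, pow_add, pow_add X 2]
        refine Dvd.dvd.neg_right (dvd_add (dvd_sub ?_ ?_) ?_)
        · exact mul_dvd_mul hps (dvd_sub (mul_dvd_mul dq1 Y2) (mul_dvd_mul dq2 Y1))
        · exact mul_dvd_mul dp1 (dvd_sub (mul_dvd_mul dq Y2) (mul_dvd_mul dq2 hY))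
        · exact mul_dvd_mul dp2 (dvd_sub (mul_dvd_mul dq Y1) (mul_dvd_mul dq1 hY))
    obtain ⟨u, hu⟩ : ∃ f : ℝ[X], f = p * polyOmega A1 B1 - polyOmega A B * p1 := ⟨_, rfl⟩
    obtain ⟨v, hv⟩ : ∃ f : ℝ[X], f = p * polyPhi A1 B1 - polyPhi A B * p1 := ⟨_, rfl⟩
    obtain ⟨k, hk⟩ : ∃ k : ℝ, k = ((2 * K + 5 : ℕ) : ℝ) := ⟨_, rfl⟩
    have smul' : ∀ (a b : ℝ) (f g : ℝ[X]), serre (a + b) (f * g) = serre a f * g + f * serre b g := by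
      intro a b f g; simp only [serre, derivative_mul, map_add]; ring
    have ssub : ∀ (k : ℝ) (f g : ℝ[X]), serre k (f - g) = serre k f - serre k g := by
      intro k f g; simp only [serre, derivative_sub]; ring
    have k1 : k = ((K + 2 : ℕ) : ℝ) + ((K + 3 : ℕ) : ℝ) := by rw [hk]; push_cast; ring
    have su : serre k u = p * polyOmega A2 B2 - polyOmega A B * p2 := by
      rw [hu, ssub, k1, smul', smul', q1, q2, ← hp1, ← hp2]; ring
    have sv : serre k v = p * polyPhi A2 B2 - polyPhi A B * p2 := by
      rw [hv, ssub, k1, smul', smul', r1, r2, ← hp1, ← hp2]; ring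
    -- The Serre derivative is `3X(1-X) d/dX` plus a multiple of the function itself, so the Serre
    -- Wronskian of `u` and `v` is `3X(1-X)` times the ordinary one; by `hH` it vanishes.
    have hw : u * derivative v = v * derivative u := by
      have e1 : u * serre k v - v * serre k u = 0 := by
        rw [su, sv, hu, hv]
        simp only [polyOmega, polyPhi]
        linear_combination (-3 * X * (1 - X) * p) * hH
      have e : 3 * X * (1 - X) * (u * derivative v - v * derivative u) = 0 := by
        simp only [serre] at e1
        linear_combination e1
      have hne : (3 * X * (1 - X) : ℝ[X]) ≠ 0 := by
        intro h0
        have := congrArg (eval 2) h0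
        norm_num at this
      exact sub_eq_zero.1 ((mul_eq_zero.1 e).resolve_left hne)
    obtain ⟨α, β, h0, hab⟩ := exists_smul_eq_of_wronskian hw
    obtain ⟨w, hwdef⟩ : ∃ f : ℝ[X], f = C α * polyPhi A B - C β * polyOmega A B := ⟨_, rfl⟩
    -- Equivalently `(w/p)' = α/(1-X) + β/X`: a rational function would equal `β log X - α log(1-X)`
    -- up to a constant.
    have key : X * (1 - X) * (p * derivative w - w * derivative p) =
        p ^ 2 * (C α * X + C β * (1 - X)) := by
      have e1 : u = 3 * X * (1 - X) * (p * derivative (polyOmega A B) -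
          polyOmega A B * derivative p) + 3 * (1 - X) * p ^ 2 := by
        have : polyOmega A1 B1 = serre ((K + 2 : ℕ) : ℝ) (polyOmega A B) + 3 * (1 - X) * p := by
          rw [q1]; ring
        rw [hu, this, hp1]; simp only [serre]; ring
      have e2 : v = 3 * X * (1 - X) * (p * derivative (polyPhi A B) -
          polyPhi A B * derivative p) - 3 * X * p ^ 2 := by
        have : polyPhi A1 B1 = serre ((K + 2 : ℕ) : ℝ) (polyPhi A B) - 3 * X * p := by
          rw [r1]; ring
        rw [hv, this, hp1]; simp only [serre]; ring
      rw [e1, e2] at hab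
      have h3 : (3 : ℝ[X]) ≠ 0 := by norm_num
      apply mul_left_cancel₀ h3
      rw [hwdef]
      simp only [derivative_sub, derivative_C_mul]
      linear_combination hab
    -- For `β ≠ 0` the residue at `0` is the obstruction. Otherwise it is the residue at `1`, moved
    -- to `0` by `X ↦ 1 - X`.
    by_cases hβ : β = 0
    · have hα : α ≠ 0 := h0.resolve_right (by simp [hβ])
      have key2 := congrArg (fun q ↦ q.comp (1 - X)) key
      have hpc : p.comp (1 - X) ≠ 0 := by
        rw [comp_of_mem_levelOne hp]
        exact mul_ne_zero (by simp) hp0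
      have hd : ∀ f : ℝ[X], (derivative f).comp (1 - X) = -derivative (f.comp (1 - X)) := by
        intro f; rw [derivative_comp]; simp
      refine no_residue (s := 1 - X) (c := -(C α * (1 - X))) (w := w.comp (1 - X)) (by simp)
        (by simpa using hα) hpc ?_
      simp only [mul_comp, sub_comp, pow_comp, add_comp, X_comp, one_comp, C_comp, zero_comp, hd, hβ, C_0] at key2
      linear_combination -key2
    · exact no_residue (s := 1 - X) (c := C α * X + C β * (1 - X)) (by simp) (by simpa using hβ)
        hp0 key

end FourierEigen

end

noncomputable section

namespace FourierEigen

open Polynomial Filter Topology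

/-! ### Dimension count and existence of the polynomial data -/

instance finiteDimensional_levelOne (N : ℕ) : FiniteDimensional ℝ (levelOne N) := by
  have h : levelOne N ≤ degreeLT ℝ (N + 1) := by
    intro p hp
    rw [mem_degreeLT]
    refine lt_of_le_of_lt degree_le_natDegree ?_
    exact_mod_cast Nat.lt_succ_of_le (natDegree_le_of_mem_levelOne hp)
  have : FiniteDimensional ℝ (degreeLT ℝ (N + 1)) :=
    (degreeLTEquiv ℝ (N + 1)).symm.finiteDimensional
  exact Submodule.finiteDimensional_of_le h

lemma exists_mem_levelOne_eval_ne_zero {N : ℕ} (hN : N ≠ 1) :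
    ∃ e ∈ levelOne N, e.eval 0 ≠ 0 := by
  rcases Nat.even_or_odd N with ⟨k, hk⟩ | ⟨k, hk⟩
  · refine ⟨polyE4 ^ k, ?_, by simp [polyE4]⟩
    have := levelOne_pow polyE4_mem k
    rwa [show k * 2 = N by omega] at this
  · refine ⟨polyE4 ^ (k - 1) * polyE6, ?_, by simp [polyE4, polyE6]⟩
    exact levelOne_mul_of_eq (levelOne_pow polyE4_mem (k - 1)) polyE6_mem (by omega)

/-- Multiplication by the discriminant is injective, and its image misses a form that does not
vanish at the cusp. -/
lemma finrank_levelOne_add_six {N : ℕ} (hN : N + 6 ≠ 1) :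
    Module.finrank ℝ (levelOne N) + 1 ≤ Module.finrank ℝ (levelOne (N + 6)) := by
  set f : ℝ[X] →ₗ[ℝ] ℝ[X] := LinearMap.mulLeft ℝ polyDelta with hf
  have h0 : polyDelta ≠ 0 := by
    intro h
    have := congrArg (eval 2) h
    norm_num [polyDelta] at this
  have hinj : Function.Injective f := fun a b hab ↦ mul_left_cancel₀ h0 hab
  have h1 : Module.finrank ℝ ((levelOne N).map f) = Module.finrank ℝ (levelOne N) :=
    (Submodule.equivMapOfInjective f hinj (levelOne N)).finrank_eq.symm
  have hlt : (levelOne N).map f < levelOne (N + 6) := by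
    refine lt_of_le_of_ne ?_ ?_
    · rintro _ ⟨p, hp, rfl⟩
      exact levelOne_mul_of_eq polyDelta_mem hp (by omega)
    · intro h
      obtain ⟨e, he, he0⟩ := exists_mem_levelOne_eval_ne_zero hN
      rw [← h] at he
      obtain ⟨p, -, rfl⟩ := he
      apply he0
      simp [hf, polyDelta]
  have := Submodule.finrank_lt_finrank_of_lt hlt
  omega

lemma le_finrank_levelOne (N : ℕ) :
    (if N % 6 = 1 then N / 6 else N / 6 + 1) ≤ Module.finrank ℝ (levelOne N) := by
  induction N using Nat.strong_induction_on with
  | _ N ih =>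
    rcases lt_or_ge N 6 with h | h
    · split_ifs with h1
      · omega
      · have hN : N ≠ 1 := by omega
        obtain ⟨e, he, he0⟩ := exists_mem_levelOne_eval_ne_zero hN
        have : Nontrivial (levelOne N) :=
          ⟨⟨⟨e, he⟩, 0, fun h ↦ he0 (by
            have h' : e = 0 := congrArg Subtype.val h
            simp [h'])⟩⟩
        have := Module.finrank_pos (R := ℝ) (M := levelOne N)
        omega
    · obtain ⟨M, rfl⟩ := Nat.exists_eq_add_of_le' h
      have h1 := ih M (by omega)
      have h2 := finrank_levelOne_add_six (N := M) (by omega)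
      have h3 : (M + 6) % 6 = M % 6 := by omega
      have h4 : (M + 6) / 6 = M / 6 + 1 := by omega
      rw [h3, h4]
      split_ifs at h1 ⊢ <;> omega

/-! ### Symmetry under `x ↦ x / (x - 1)` -/

/-- `x ↦ x/(x-1)` is the effect of `z ↦ z + 1` on `λ`; it is composed from the two defining
symmetries. -/
lemma eval_T_of_mem_levelOne {N : ℕ} {p : ℝ[X]} (hp : p ∈ levelOne N) {x : ℝ} (hx : x ≠ 1) :
    (1 - x) ^ N * p.eval (x / (x - 1)) = p.eval x := by
  have h1 : 1 - x ≠ 0 := fun h ↦ hx (by linarith)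
  have h1' : x - 1 ≠ 0 := fun h ↦ hx (by linarith)
  have h2 := hp.2 (1 - x) h1
  have h3 := hp.1 ((1 - x)⁻¹)
  have h4 := hp.1 x
  have h5 : 1 - (1 - x)⁻¹ = x / (x - 1) := by field_simp; ring
  have hs : ((-1 : ℝ) ^ N) ^ 2 = 1 := by rw [← pow_mul, mul_comm, pow_mul]; simp
  rw [h5] at h3
  rw [h4] at h2
  rw [h3]
  linear_combination (-1 : ℝ) ^ N * h2 + p.eval x * hs

/-- The involution `x ↦ x/(x-1)` has derivative `-1` at its fixed point `0`. Once `p(0) = 0`, it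
forces `p'(0) = -p'(0)`. -/
lemma X_sq_dvd_of_mem_levelOne {N : ℕ} {p : ℝ[X]} (hp : p ∈ levelOne N) (h0 : p.eval 0 = 0) :
    X ^ 2 ∣ p := by
  have hd : HasDerivAt (fun x : ℝ ↦ (1 - x) ^ N * p.eval (x / (x - 1)))
      (-((derivative p).eval 0)) 0 := by
    have h1 : HasDerivAt (fun x : ℝ ↦ (1 - x) ^ N) (N * (1 - 0) ^ (N - 1) * (-1)) (0 : ℝ) :=
      ((hasDerivAt_id (0 : ℝ)).const_sub 1).pow N
    have h2 : HasDerivAt (fun x : ℝ ↦ x / (x - 1)) (-1) 0 := by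
      have := (hasDerivAt_id (0 : ℝ)).div ((hasDerivAt_id (0 : ℝ)).sub_const 1) (by norm_num)
      convert! this using 1
      norm_num
    have h3 : HasDerivAt (fun x : ℝ ↦ p.eval (x / (x - 1))) ((derivative p).eval 0 * (-1)) 0 := by
      have := (p.hasDerivAt ((0 : ℝ) / (0 - 1))).comp (0 : ℝ) h2
      rw [zero_div] at this
      exact this
    have := h1.mul h3
    convert! this using 1
    simp [h0]
  have hd2 : HasDerivAt (fun x : ℝ ↦ (1 - x) ^ N * p.eval (x / (x - 1)))
      ((derivative p).eval 0) 0 := by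
    refine (p.hasDerivAt 0).congr_of_eventuallyEq ?_
    filter_upwards [isOpen_ne.mem_nhds (show (0 : ℝ) ≠ 1 by norm_num)] with x hx
    exact eval_T_of_mem_levelOne hp hx
  have h1 : (derivative p).eval 0 = 0 := by
    have := hd.unique hd2
    linarith
  rw [X_pow_dvd_iff]
  intro d hd
  interval_cases d
  · rw [coeff_zero_eq_eval_zero, h0]
  · have h2 : (derivative p).coeff 0 = p.coeff 1 * (0 + 1) := by
      rw [coeff_derivative]; simp
    rw [coeff_zero_eq_eval_zero, h1] at h2
    linarith

lemma eval_logPoly (m : ℕ) (x : ℝ) :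
    (logPoly m).eval x = -∑ k ∈ Finset.range m, x ^ (k + 1) / ((k : ℝ) + 1) := by
  simp only [logPoly, eval_neg, eval_finsetSum, eval_mul, eval_C, eval_pow, eval_X]
  congr 1
  exact Finset.sum_congr rfl fun k _ ↦ by ring

/-- Up to a power of `1 - x`, the function `p log(1-x) + polyPhi` is odd under `x ↦ x/(x-1)`,
whereas `x^(2i)` is even. A leading term of even degree must therefore vanish. The limit of `y x /
x^(2i)` isolates that term, the truncation of the logarithm being of higher order. -/
lemma coeff_even_eq_zero {K i m : ℕ} {p A B : ℝ[X]} (hp : p ∈ levelOne (K + 2))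
    (hA : A ∈ levelOne (K + 1)) (hB : B ∈ levelOne K) (him : 2 * i ≤ m)
    (hY : X ^ (2 * i) ∣ p * logPoly m + polyPhi A B) :
    (p * logPoly m + polyPhi A B).coeff (2 * i) = 0 := by
  obtain ⟨Z, hZ⟩ := hY
  have hcoeff : (p * logPoly m + polyPhi A B).coeff (2 * i) = Z.eval 0 := by
    rw [hZ, ← coeff_zero_eq_eval_zero, coeff_X_pow_mul', if_pos le_rfl, Nat.sub_self]
  rw [hcoeff]
  set y : ℝ → ℝ := fun x ↦ p.eval x * Real.log (1 - x) + (polyPhi A B).eval x with hy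
  have hlim : Tendsto (fun x ↦ y x / x ^ (2 * i)) (𝓝[≠] 0) (𝓝 (Z.eval 0)) := by
    have h1 : Tendsto (fun x ↦ Z.eval x) (𝓝[≠] 0) (𝓝 (Z.eval 0)) :=
      Z.continuous.continuousAt.tendsto.mono_left nhdsWithin_le_nhds
    have h2 : Tendsto (fun x ↦ y x / x ^ (2 * i) - Z.eval x) (𝓝[≠] 0) (𝓝 0) := by
      have hb : Tendsto (fun x : ℝ ↦ |p.eval x| * (2 * |x|)) (𝓝[≠] 0) (𝓝 0) := by
        have : Continuous fun x : ℝ ↦ |p.eval x| * (2 * |x|) :=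
          (p.continuous.abs).mul (by fun_prop)
        have h := this.tendsto 0
        simp only [abs_zero, mul_zero] at h
        exact h.mono_left nhdsWithin_le_nhds
      refine squeeze_zero_norm' ?_ hb
      have hball : Set.Ioo (-(1 / 2) : ℝ) (1 / 2) ∈ 𝓝[≠] (0 : ℝ) :=
        nhdsWithin_le_nhds (Ioo_mem_nhds (by norm_num) (by norm_num))
      filter_upwards [self_mem_nhdsWithin, hball] with x hx0 hx
      have hx0' : x ≠ 0 := hx0
      have habs : |x| < 1 / 2 := abs_lt.2 ⟨hx.1, hx.2⟩
      have hlog := Real.abs_log_sub_add_sum_range_le (x := x) (by linarith) m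
      have he := congrArg (eval x) hZ
      rw [eval_add, eval_mul, eval_mul, eval_pow, eval_X, eval_logPoly] at he
      have hdiff : y x / x ^ (2 * i) - Z.eval x =
          p.eval x * ((∑ k ∈ Finset.range m, x ^ (k + 1) / ((k : ℝ) + 1)) + Real.log (1 - x)) /
            x ^ (2 * i) := by
        rw [eq_div_iff (pow_ne_zero _ hx0'), sub_mul, div_mul_cancel₀ _ (pow_ne_zero _ hx0')]
        simp only [hy]
        linear_combination he
      rw [hdiff, Real.norm_eq_abs, abs_div, abs_mul, mul_div_assoc]
      gcongr
      rw [abs_pow, div_le_iff₀ (by positivity)]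
      refine hlog.trans ?_
      rw [div_le_iff₀ (by linarith)]
      have h3 : |x| ^ (m + 1) ≤ |x| * |x| ^ (2 * i) := by
        rw [← pow_succ']
        exact pow_le_pow_of_le_one (abs_nonneg _) (by linarith) (by omega)
      have h4 : 0 ≤ |x| * |x| ^ (2 * i) := by positivity
      nlinarith
    have := h2.add h1
    simpa using this
  have ht : Tendsto (fun x : ℝ ↦ x / (x - 1)) (𝓝[≠] 0) (𝓝[≠] 0) := by
    refine tendsto_nhdsWithin_iff.2 ⟨?_, ?_⟩
    · have : ContinuousAt (fun x : ℝ ↦ x / (x - 1)) 0 :=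
        ContinuousAt.div (by fun_prop) (by fun_prop) (by norm_num)
      have h := this.tendsto
      simp only [zero_div] at h
      exact h.mono_left nhdsWithin_le_nhds
    · have hne : {x : ℝ | x ≠ 1} ∈ 𝓝[≠] (0 : ℝ) :=
        nhdsWithin_le_nhds (isOpen_ne.mem_nhds (by norm_num))
      filter_upwards [self_mem_nhdsWithin, hne] with x hx hx1
      exact div_ne_zero hx (sub_ne_zero.2 hx1)
  have hlim2 := hlim.comp ht
  have hlim3 : Tendsto (fun x ↦ -((1 - x) ^ (2 * i) / (1 - x) ^ (K + 2)) * (y x / x ^ (2 * i)))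
      (𝓝[≠] 0) (𝓝 (-1 * Z.eval 0)) := by
    refine Tendsto.mul ?_ hlim
    have : ContinuousAt (fun x : ℝ ↦ -((1 - x) ^ (2 * i) / (1 - x) ^ (K + 2))) 0 :=
      (ContinuousAt.div (by fun_prop) (by fun_prop) (by norm_num)).neg
    have h := this.tendsto
    simp only [sub_zero, one_pow, div_one] at h
    exact h.mono_left nhdsWithin_le_nhds
  have heq : (fun x ↦ -((1 - x) ^ (2 * i) / (1 - x) ^ (K + 2)) * (y x / x ^ (2 * i)))
      =ᶠ[𝓝[≠] 0] (fun x ↦ y x / x ^ (2 * i)) ∘ fun x ↦ x / (x - 1) := by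
    have hne : Set.Iio (1 : ℝ) ∈ 𝓝[≠] (0 : ℝ) :=
      nhdsWithin_le_nhds (Iio_mem_nhds (by norm_num))
    filter_upwards [self_mem_nhdsWithin, hne] with x hx hx1
    have hx0 : x ≠ 0 := hx
    have hx1' : x < 1 := hx1
    have hx2 : 1 - x ≠ 0 := by linarith
    have hx3 : x - 1 ≠ 0 := by linarith
    have e1 := eval_T_of_mem_levelOne hp hx1'.ne
    have e2 := eval_T_of_mem_levelOne hA hx1'.ne
    have e3 := eval_T_of_mem_levelOne hB hx1'.ne
    have hlog : Real.log (1 - x / (x - 1)) = -Real.log (1 - x) := by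
      rw [← Real.log_inv]; congr 1; field_simp; ring
    have hyT : (1 - x) ^ (K + 2) * y (x / (x - 1)) = -y x := by
      simp only [hy, polyPhi, eval_add, eval_mul, eval_X, eval_sub, eval_ofNat, hlog]
      rw [← e1, ← e2, ← e3]
      field_simp
      ring
    simp only [Function.comp]
    have hT : (x / (x - 1)) ^ (2 * i) = x ^ (2 * i) / (1 - x) ^ (2 * i) := by
      rw [div_pow]; congr 1
      rw [pow_mul, pow_mul]; congr 1; ring
    have hyT' : y (x / (x - 1)) = -y x / (1 - x) ^ (K + 2) := by
      rw [eq_div_iff (pow_ne_zero _ hx2), ← hyT]; ring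
    rw [hT, hyT']
    field_simp
  have := tendsto_nhds_unique (hlim3.congr' heq) hlim2
  linarith

/-- A nonzero triple exists by counting dimensions. `A(0) ≠ B(0)` because otherwise
`eq_zero_of_vanishing` would kill the triple. The relation `K + 1 + e = 6n` fixes the weight at `2 -
2e` after division by the `2n`-th power of the theta product. -/
theorem exists_polynomial_data {e n K : ℕ} (he : 0 < e) (hn : n = e / 4 + 1)
    (hK : K + 1 + e = 6 * n) : ∃ p A B : ℝ[X], p ∈ levelOne (K + 2) ∧ A ∈ levelOne (K + 1) ∧
      B ∈ levelOne K ∧ X ^ 2 ∣ p ∧ X ^ (2 * n + 1) ∣ p * logPoly (2 * n) + polyPhi A B ∧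
      A.eval 0 ≠ B.eval 0 := by
  -- Here `K = 2n + 3 - (e % 4)`. This is the least `s` with `K < 2s + 2n`, as the vanishing theorem
  -- requires; prescribing the factor `polyDelta ^ s` of `p` still leaves enough dimensions.
  obtain ⟨s, hs⟩ : ∃ s : ℕ, (e % 4 ≤ 1 ∧ s = 2) ∨ (2 ≤ e % 4 ∧ s = 1) := by
    rcases le_or_gt (e % 4) 1 with h | h
    · exact ⟨2, Or.inl ⟨h, rfl⟩⟩
    · exact ⟨1, Or.inr ⟨h, rfl⟩⟩
  have hs1 : 1 ≤ s := by omega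
  obtain ⟨E, hE, hEdim⟩ : ∃ E : Submodule ℝ ℝ[X],
      (∀ q ∈ E, polyDelta ^ s * q ∈ levelOne (K + 2)) ∧ FiniteDimensional ℝ E ∧
      (6 * s ≤ K + 2 → (if (K + 2 - 6 * s) % 6 = 1 then (K + 2 - 6 * s) / 6 else
        (K + 2 - 6 * s) / 6 + 1) ≤ Module.finrank ℝ E) := by
    by_cases h : 6 * s ≤ K + 2
    · refine ⟨levelOne (K + 2 - 6 * s), fun q hq ↦ ?_, inferInstance,
        fun _ ↦ le_finrank_levelOne _⟩
      exact levelOne_mul_of_eq (levelOne_pow polyDelta_mem s) hq (by omega)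
    -- No room for a factor `polyDelta ^ s`: here `p = 0`, and `A` and `B` alone supply the
    -- dimensions.
    · refine ⟨⊥, fun q hq ↦ ?_, inferInstance, fun h' ↦ absurd h' h⟩
      rw [(Submodule.mem_bot ℝ).1 hq, mul_zero]
      exact zero_mem _
  obtain ⟨hfin, hdim⟩ := hEdim
  -- Only the odd coefficients up to `2n - 1` are imposed; the even ones follow from
  -- `coeff_even_eq_zero`.
  let Φ : (E × levelOne (K + 1) × levelOne K) →ₗ[ℝ] (Fin n → ℝ) :=
    { toFun := fun v i ↦ (polyDelta ^ s * (v.1 : ℝ[X]) * logPoly (2 * n) +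
        polyPhi (v.2.1 : ℝ[X]) (v.2.2 : ℝ[X])).coeff (2 * i + 1)
      map_add' := by
        intro v w
        ext i
        simp only [Prod.fst_add, Prod.snd_add, Submodule.coe_add, Pi.add_apply]
        rw [← coeff_add]
        congr 1
        simp only [polyPhi]; ring
      map_smul' := by
        intro c v
        ext i
        simp only [Prod.smul_fst, Prod.smul_snd, Submodule.coe_smul, Pi.smul_apply, RingHom.id_apply]
        rw [← coeff_smul]
        congr 1
        simp only [polyPhi, smul_eq_C_mul]; ring }
  have hlt : Module.finrank ℝ (Fin n → ℝ) <
      Module.finrank ℝ (E × levelOne (K + 1) × levelOne K) := by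
    rw [Module.finrank_prod, Module.finrank_prod, Module.finrank_fin_fun]
    have h1 := le_finrank_levelOne (K + 1)
    have h2 := le_finrank_levelOne K
    generalize Module.finrank ℝ E = a at *
    generalize Module.finrank ℝ (levelOne (K + 1)) = b at *
    generalize Module.finrank ℝ (levelOne K) = c at *
    by_cases h : 6 * s ≤ K + 2
    · have h3 := hdim h
      split_ifs at h1 h2 h3 <;> omega
    · split_ifs at h1 h2 <;> omega
  obtain ⟨v, hv, hv0⟩ := Submodule.exists_mem_ne_zero_of_ne_bot
    (LinearMap.ker_ne_bot_of_finrank_lt (f := Φ) hlt)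
  obtain ⟨⟨q, hq⟩, ⟨A, hA⟩, ⟨B, hB⟩⟩ := v
  have hcoef : ∀ i < n, (polyDelta ^ s * q * logPoly (2 * n) + polyPhi A B).coeff (2 * i + 1) = 0 :=
    fun i hi ↦ congrFun (LinearMap.mem_ker.1 hv) ⟨i, hi⟩
  have hp := hE q hq
  have hps : X ^ (2 * s) ∣ polyDelta ^ s * q := by
    rw [polyDelta, mul_pow, ← pow_mul, mul_assoc]; exact dvd_mul_right _ _
  have hY : ∀ j ≤ 2 * n + 1, X ^ j ∣ polyDelta ^ s * q * logPoly (2 * n) + polyPhi A B := by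
    intro j
    induction j with
    | zero => simp
    | succ j ih =>
      intro hj
      have h := ih (by omega)
      rw [X_pow_dvd_iff] at h ⊢
      intro d hd
      rcases Nat.lt_succ_iff_lt_or_eq.1 hd with h1 | h1
      · exact h d h1
      · rw [h1]
        rcases Nat.even_or_odd j with ⟨i, hi⟩ | ⟨i, hi⟩
        · rw [show j = 2 * i by omega]
          exact coeff_even_eq_zero hp hA hB (by omega)
            (by rw [show 2 * i = j by omega]; exact ih (by omega))
        · rw [hi]
          exact hcoef i (by omega)
  have hYn := hY _ le_rfl
  refine ⟨polyDelta ^ s * q, A, B, hp, hA, hB, (pow_dvd_pow X (by omega)).trans hps, hYn, ?_⟩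
  intro hAB
  have h1 : (polyDelta ^ s * q * logPoly (2 * n) + polyPhi A B).coeff 1 = 0 :=
    X_pow_dvd_iff.1 hYn 1 (by omega)
  have h2 : (polyDelta ^ s * q * logPoly (2 * n)).coeff 1 = 0 := by
    have : X ^ 2 ∣ polyDelta ^ s * q * logPoly (2 * n) :=
      Dvd.dvd.mul_right ((pow_dvd_pow X (by omega)).trans hps) _
    exact X_pow_dvd_iff.1 this 1 (by omega)
  have h3 : (polyPhi A B).coeff 1 = A.eval 0 + 2 * B.eval 0 := by
    rw [polyPhi, mul_assoc, ← mul_add]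
    refine (coeff_X_mul _ 0).trans ?_
    rw [coeff_zero_eq_eval_zero]
    simp
  rw [coeff_add, h2, h3, zero_add] at h1
  -- The coefficient of degree one gives `A(0) + 2B(0) = 0`. With `A(0) = B(0)` both values are
  -- zero.
  have hA0 : A.eval 0 = 0 := by linarith
  have hB0 : B.eval 0 = 0 := by linarith
  obtain ⟨e1, e2, e3⟩ := eq_zero_of_vanishing (n := n) (s := s) hp hA hB hs1 hps
    (X_sq_dvd_of_mem_levelOne hA hA0) (X_sq_dvd_of_mem_levelOne hB hB0) hYn (by omega) (by omega)
  apply hv0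
  have hq0 : q = 0 := by
    refine (mul_eq_zero.1 e1).resolve_left (pow_ne_zero _ ?_)
    intro h
    have := congrArg (eval 2) h
    norm_num [polyDelta] at this
  subst e2 e3 hq0
  rfl

end FourierEigen

end

noncomputable section

namespace FourierEigen

open Polynomial Filter Topology Asymptotics

/-! ### Level one symmetries at complex arguments -/

lemma aeval_one_sub_of_mem_levelOne {N : ℕ} {p : ℝ[X]} (hp : p ∈ levelOne N) (x : ℂ) :
    aeval (1 - x) p = (-1) ^ N * aeval x p := by
  have h := congrArg (aeval x) (comp_of_mem_levelOne hp)
  simpa [aeval_comp] using h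

lemma aeval_inv_of_mem_levelOne {N : ℕ} {p : ℝ[X]} (hp : p ∈ levelOne N) {x : ℂ} (hx : x ≠ 0) :
    x ^ N * aeval x⁻¹ p = aeval x p := by
  have : Invertible x⁻¹ := invertibleOfNonzero (inv_ne_zero hx)
  have h := eval₂_reflect_mul_pow (algebraMap ℝ ℂ) x⁻¹ N p (natDegree_le_of_mem_levelOne hp)
  rw [reflect_of_mem_levelOne hp, invOf_eq_inv, inv_inv, inv_pow] at h
  rw [aeval_def, aeval_def, ← h]
  field_simp

lemma aeval_T_of_mem_levelOne {N : ℕ} {p : ℝ[X]} (hp : p ∈ levelOne N) {x : ℂ} (hx : 1 - x ≠ 0) :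
    (1 - x) ^ N * aeval (-(x / (1 - x))) p = aeval x p := by
  have h2 := aeval_inv_of_mem_levelOne hp hx
  have h3 := aeval_one_sub_of_mem_levelOne hp ((1 - x)⁻¹)
  have h4 := aeval_one_sub_of_mem_levelOne hp x
  have h5 : 1 - (1 - x)⁻¹ = -(x / (1 - x)) := by field_simp; ring
  have hs : ((-1 : ℂ) ^ N) ^ 2 = 1 := by rw [← pow_mul, mul_comm, pow_mul]; simp
  rw [h5] at h3
  rw [h4] at h2
  rw [h3]
  linear_combination (-1 : ℂ) ^ N * h2 + aeval x p * hs

/-! ### Weakly holomorphic forms from polynomials in `λ` -/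

/-- The form `θ₀₀ ^ (4 N) q(λ) / (θ₁₀ θ₀₀ θ₀₁) ^ (4 m)`, of weight `2 N - 6 m`. -/
def thetaForm (N m : ℕ) (q : ℝ[X]) (z : ℂ) : ℂ :=
  thetaV z ^ N * aeval (modularLambda z) q / (thetaU z * thetaV z * thetaW z) ^ m

lemma differentiableAt_thetaForm (N m : ℕ) (q : ℝ[X]) {z : ℂ} (hz : 0 < z.im) :
    DifferentiableAt ℂ (thetaForm N m q) z := by
  refine DifferentiableAt.div ?_ ?_ (pow_ne_zero _ (theta_mul_ne_zero hz))
  · exact ((differentiableAt_thetaV hz).pow N).mul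
      ((q.differentiable_aeval (𝕜 := ℂ) _).comp z (differentiableAt_modularLambda hz))
  · exact (((differentiableAt_thetaU hz).mul (differentiableAt_thetaV hz)).mul
      (differentiableAt_thetaW hz)).pow m

/-- The theta product changes sign under both generators apart from the automorphy factor, which is
why `m` is taken even. -/
lemma thetaForm_S {N m κ : ℕ} (hm : Even m) (hκ : 2 * N + κ = 6 * m) {q r : ℝ[X]}
    (hqr : ∀ x : ℂ, (-1) ^ N * aeval (1 - x) q = aeval x r) {z : ℂ} (hz : 0 < z.im) :
    z ^ κ * thetaForm N m q (-1 / z) = thetaForm N m r z := by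
  have hz0 := ne_zero_of_im_pos hz
  have h := theta_mul_ne_zero hz
  rw [thetaForm, thetaForm, thetaU_S hz, thetaV_S hz, thetaW_S hz, modularLambda_S hz, ← hqr]
  have h1 : (-z ^ 2 * thetaW z * (-z ^ 2 * thetaV z) * (-z ^ 2 * thetaU z)) ^ m =
      z ^ κ * z ^ (2 * N) * (thetaU z * thetaV z * thetaW z) ^ m := by
    rw [show -z ^ 2 * thetaW z * (-z ^ 2 * thetaV z) * (-z ^ 2 * thetaU z) =
      (-1) * (z ^ 6 * (thetaU z * thetaV z * thetaW z)) by ring, mul_pow, hm.neg_one_pow, mul_pow,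
      ← pow_mul, ← hκ, pow_add]
    ring
  have h2 : (-z ^ 2 * thetaV z) ^ N = (-1) ^ N * z ^ (2 * N) * thetaV z ^ N := by
    rw [mul_pow, neg_pow, ← pow_mul]
  rw [h1, h2]
  field_simp

lemma thetaForm_add_one {N m : ℕ} (hm : Even m) {q r : ℝ[X]}
    (hqr : ∀ x : ℂ, 1 - x ≠ 0 → (1 - x) ^ N * aeval (-(x / (1 - x))) q = aeval x r)
    {z : ℂ} (hz : 0 < z.im) : thetaForm N m q (z + 1) = thetaForm N m r z := by
  have h1 := one_sub_modularLambda hz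
  have hV := thetaV_ne_zero hz
  rw [thetaForm, thetaForm, thetaU_add_one, thetaV_add_one, thetaW_add_one,
    modularLambda_add_one hz, ← hqr _ (one_sub_modularLambda_ne_zero hz), ← mul_assoc, ← mul_pow,
    h1, mul_div_cancel₀ _ hV]
  congr 1
  rw [show -thetaU z * thetaW z * thetaV z = (-1) * (thetaU z * thetaV z * thetaW z) by ring,
    mul_pow, hm.neg_one_pow, one_mul]

lemma thetaForm_neg_poly (N m : ℕ) (q : ℝ[X]) (z : ℂ) :
    thetaForm N m (-q) z = -thetaForm N m q z := by
  simp [thetaForm, neg_div]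

lemma thetaForm_sub_poly (N m : ℕ) (q r : ℝ[X]) (z : ℂ) :
    thetaForm N m (q - r) z = thetaForm N m q z - thetaForm N m r z := by
  simp [thetaForm]; ring

/-! ### Slash action on the fourth powers of theta constants -/

/-- The matrix through which `γ` with residues `a, b, c, d` modulo two acts on `(θ₀₀⁴, θ₁₀⁴)`. -/
def thetaMatrix (a b c d : ZMod 2) : ℤ × ℤ × ℤ × ℤ :=
  if c = 0 then (if b = 0 then (1, 0, 0, 1) else (1, -1, 0, -1))
  else if a = 0 then (if d = 0 then (-1, 0, -1, 1) else (-1, 1, -1, 0))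
  else (if b = 0 then (0, 1, 1, 0) else (0, -1, 1, -1))

lemma thetaMatrix_S : ∀ a b c d : ZMod 2, a * d - b * c = 1 →
    thetaMatrix b a d c = (-(thetaMatrix a b c d).1 - (thetaMatrix a b c d).2.1,
      (thetaMatrix a b c d).2.1,
      -(thetaMatrix a b c d).2.2.1 - (thetaMatrix a b c d).2.2.2, (thetaMatrix a b c d).2.2.2) := by
  decide

lemma thetaMatrix_T : ∀ a b c d : ZMod 2, a * d - b * c = 1 →
    thetaMatrix a (a + b) c (c + d) = ((thetaMatrix a b c d).1,
      -(thetaMatrix a b c d).1 - (thetaMatrix a b c d).2.1,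
      (thetaMatrix a b c d).2.2.1,
      -(thetaMatrix a b c d).2.2.1 - (thetaMatrix a b c d).2.2.2) := by
  decide

/-- `θ₀₀⁴` on `ℍ`. -/
def formV (z : ℍ) : ℂ := thetaV z

/-- `θ₁₀⁴` on `ℍ`. -/
def formU (z : ℍ) : ℂ := thetaU z

lemma slash_S_apply (f : ℂ → ℂ) (k : ℤ) (z : ℍ) :
    ((fun w : ℍ ↦ f w) ∣[k] ModularGroup.S) z = f (-1 / z) * (z : ℂ) ^ (-k) := by
  rw [ModularForm.SL_slash_apply, UpperHalfPlane.modular_S_smul, ModularGroup.denom_S]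
  have h0 := ne_zero_of_im_pos z.2
  simp only
  rw [show (-(z : ℂ))⁻¹ = -1 / z by field_simp]

lemma slash_T_apply (f : ℂ → ℂ) (k : ℤ) (z : ℍ) :
    ((fun w : ℍ ↦ f w) ∣[k] ModularGroup.T) z = f (z + 1) := by
  rw [ModularForm.SL_slash_apply, UpperHalfPlane.modular_T_smul, ModularGroup.denom_apply]
  simp [ModularGroup.coe_T, add_comm]

lemma formV_slash_S : formV ∣[(2 : ℤ)] ModularGroup.S = -formV := by
  ext z
  have h0 := ne_zero_of_im_pos z.2
  refine (slash_S_apply thetaV 2 z).trans ?_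
  rw [thetaV_S z.2]
  simp only [Pi.neg_apply, formV]
  rw [show (-2 : ℤ) = -((2 : ℕ) : ℤ) from rfl, zpow_neg, zpow_natCast]
  field_simp

lemma formU_slash_S : formU ∣[(2 : ℤ)] ModularGroup.S = formU - formV := by
  ext z
  have h0 := ne_zero_of_im_pos z.2
  refine (slash_S_apply thetaU 2 z).trans ?_
  rw [thetaU_S z.2]
  simp only [Pi.sub_apply, formV, formU]
  rw [show (-2 : ℤ) = -((2 : ℕ) : ℤ) from rfl, zpow_neg, zpow_natCast, thetaV_eq_add z.2]
  field_simp
  ring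

lemma formV_slash_T : formV ∣[(2 : ℤ)] ModularGroup.T = formV - formU := by
  ext z
  refine (slash_T_apply thetaV 2 z).trans ?_
  rw [thetaV_add_one]
  simp only [Pi.sub_apply, formV, formU]
  rw [thetaV_eq_add z.2]; ring

lemma formU_slash_T : formU ∣[(2 : ℤ)] ModularGroup.T = -formU := by
  ext z
  refine (slash_T_apply thetaU 2 z).trans ?_
  rw [thetaU_add_one]
  rfl

lemma slash_inv_eq {f g : ℍ → ℂ} {k : ℤ} {γ : SL(2, ℤ)} (h : f ∣[k] γ = g) : g ∣[k] γ⁻¹ = f := by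
  rw [← h, ← SlashAction.slash_mul, mul_inv_cancel, SlashAction.slash_one]

lemma formV_slash_S_inv : formV ∣[(2 : ℤ)] ModularGroup.S⁻¹ = -formV := by
  have h := slash_inv_eq formV_slash_S
  rw [SlashAction.neg_slash] at h
  exact (neg_eq_iff_eq_neg.1 h)

lemma formU_slash_S_inv : formU ∣[(2 : ℤ)] ModularGroup.S⁻¹ = formU - formV := by
  have h := slash_inv_eq formU_slash_S
  rw [sub_eq_add_neg, SlashAction.add_slash, SlashAction.neg_slash, formV_slash_S_inv, neg_neg] at h
  exact eq_sub_of_add_eq h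

lemma formU_slash_T_inv : formU ∣[(2 : ℤ)] ModularGroup.T⁻¹ = -formU := by
  have h := slash_inv_eq formU_slash_T
  rw [SlashAction.neg_slash] at h
  exact (neg_eq_iff_eq_neg.1 h)

lemma formV_slash_T_inv : formV ∣[(2 : ℤ)] ModularGroup.T⁻¹ = formV - formU := by
  have h := slash_inv_eq formV_slash_T
  rw [sub_eq_add_neg, SlashAction.add_slash, SlashAction.neg_slash, formU_slash_T_inv, neg_neg] at h
  exact eq_sub_of_add_eq h

lemma comb_slash (a b : ℤ) (γ : SL(2, ℤ)) :
    (a • formV + b • formU) ∣[(2 : ℤ)] γ = a • (formV ∣[(2 : ℤ)] γ) + b • (formU ∣[(2 : ℤ)] γ) := by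
  rw [SlashAction.add_slash]
  have h : ∀ (a : ℤ) (f : ℍ → ℂ), (a • f) ∣[(2 : ℤ)] γ = a • (f ∣[(2 : ℤ)] γ) := fun a f ↦ by
    ext z; simp [ModularForm.SL_slash_apply, mul_assoc]
  rw [h, h]

/-- `γ` acts on `(θ₀₀⁴, θ₁₀⁴)` through `thetaMatrix`. -/
def ActsByThetaMatrix (γ : SL(2, ℤ)) : Prop := ∃ a b c d : ℤ,
    thetaMatrix (γ 0 0 : ℤ) (γ 0 1 : ℤ) (γ 1 0 : ℤ) (γ 1 1 : ℤ) = (a, b, c, d) ∧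
    formV ∣[(2 : ℤ)] γ = a • formV + b • formU ∧ formU ∣[(2 : ℤ)] γ = c • formV + d • formU

lemma actsByThetaMatrix (γ : SL(2, ℤ)) : ActsByThetaMatrix γ := by
  have hmem : γ ∈ Subgroup.closure {ModularGroup.S, ModularGroup.T} := by
    simp [SpecialLinearGroup.SL2Z_generators]
  have hdet : ∀ x : SL(2, ℤ), ((x 0 0 : ℤ) : ZMod 2) * (x 1 1 : ℤ) - (x 0 1 : ℤ) * (x 1 0 : ℤ) = 1 := by
    intro x
    have := x.2
    rw [Matrix.det_fin_two] at this
    exact_mod_cast congrArg (Int.cast : ℤ → ZMod 2) this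
  -- Modulo two, a generator and its inverse act alike, so the induction step treats them together.
  have hneg : ∀ x : ZMod 2, -x = x := by decide
  have key : ∀ (x y : SL(2, ℤ)), (y = ModularGroup.S ∨ y = ModularGroup.S⁻¹ ∨
      y = ModularGroup.T ∨ y = ModularGroup.T⁻¹) → ActsByThetaMatrix x → ActsByThetaMatrix (x * y) := by
    rintro x y hy ⟨a, b, c, d, h1, h2, h3⟩
    have hS : formV ∣[(2 : ℤ)] y = -formV → formU ∣[(2 : ℤ)] y = formU - formV →
        thetaMatrix ((x * y) 0 0 : ℤ) ((x * y) 0 1 : ℤ) ((x * y) 1 0 : ℤ) ((x * y) 1 1 : ℤ) =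
        thetaMatrix (x 0 1 : ℤ) (x 0 0 : ℤ) (x 1 1 : ℤ) (x 1 0 : ℤ) →
        ActsByThetaMatrix (x * y) := fun e1 e2 e3 ↦ by
      refine ⟨-a - b, b, -c - d, d, ?_, ?_, ?_⟩
      · rw [e3, thetaMatrix_S _ _ _ _ (hdet x), h1]
      · rw [SlashAction.slash_mul, h2, comb_slash, e1, e2]; module
      · rw [SlashAction.slash_mul, h3, comb_slash, e1, e2]; module
    have hT : formV ∣[(2 : ℤ)] y = formV - formU → formU ∣[(2 : ℤ)] y = -formU →
        thetaMatrix ((x * y) 0 0 : ℤ) ((x * y) 0 1 : ℤ) ((x * y) 1 0 : ℤ) ((x * y) 1 1 : ℤ) =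
        thetaMatrix (x 0 0 : ℤ) ((x 0 0 : ℤ) + (x 0 1 : ℤ)) (x 1 0 : ℤ)
          ((x 1 0 : ℤ) + (x 1 1 : ℤ)) → ActsByThetaMatrix (x * y) := fun e1 e2 e3 ↦ by
      refine ⟨a, -a - b, c, -c - d, ?_, ?_, ?_⟩
      · rw [e3, thetaMatrix_T _ _ _ _ (hdet x), h1]
      · rw [SlashAction.slash_mul, h2, comb_slash, e1, e2]; module
      · rw [SlashAction.slash_mul, h3, comb_slash, e1, e2]; module
    rcases hy with rfl | rfl | rfl | rfl
    · refine hS formV_slash_S formU_slash_S ?_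
      simp [Matrix.mul_apply, ModularGroup.coe_S, hneg]
    · refine hS formV_slash_S_inv formU_slash_S_inv ?_
      have e : ((ModularGroup.S⁻¹ : SL(2, ℤ)) : Matrix (Fin 2) (Fin 2) ℤ) = !![0, 1; -1, 0] := by
        rw [Matrix.SpecialLinearGroup.coe_inv, ModularGroup.coe_S, Matrix.adjugate_fin_two_of]
        simp
      simp only [Matrix.SpecialLinearGroup.coe_mul, e]
      simp [Matrix.mul_apply, hneg]
    · refine hT formV_slash_T formU_slash_T ?_
      simp [Matrix.mul_apply, ModularGroup.coe_T]
    · refine hT formV_slash_T_inv formU_slash_T_inv ?_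
      simp [Matrix.mul_apply, hneg]
  induction hmem using Subgroup.closure_induction_right with
  | one => exact ⟨1, 0, 0, 1, by simp [thetaMatrix], by simp, by simp⟩
  | mul_right x _ y hy ih =>
    refine key x y ?_ ih
    rcases hy with rfl | rfl <;> simp
  | mul_inv_cancel x _ y hy ih =>
    refine key x y⁻¹ ?_ ih
    rcases hy with rfl | rfl <;> simp

lemma theta_prod_sq_smul (γ : SL(2, ℤ)) (z : ℍ) :
    (thetaU (γ • z : ℍ) * thetaV (γ • z : ℍ) * thetaW (γ • z : ℍ)) ^ 2 =
      UpperHalfPlane.denom γ z ^ 12 * (thetaU z * thetaV z * thetaW z) ^ 2 := by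
  set F : ℂ → ℂ := fun z ↦ (thetaU z * thetaV z * thetaW z) ^ 2 with hF
  have hS : (fun z : ℍ ↦ F z) ∣[(12 : ℤ)] ModularGroup.S = fun z : ℍ ↦ F z := by
    ext z
    have h0 := ne_zero_of_im_pos z.2
    rw [slash_S_apply]
    simp only [hF, thetaU_S z.2, thetaV_S z.2, thetaW_S z.2]
    rw [show (-12 : ℤ) = -((12 : ℕ) : ℤ) from rfl, zpow_neg, zpow_natCast]
    field_simp
  have hT : (fun z : ℍ ↦ F z) ∣[(12 : ℤ)] ModularGroup.T = fun z : ℍ ↦ F z := by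
    ext z
    rw [slash_T_apply]
    simp only [hF, thetaU_add_one, thetaV_add_one, thetaW_add_one]
    ring
  have h := congrFun (SlashInvariantForm.slash_action_generators_SL2Z hS hT γ) z
  rw [ModularForm.SL_slash_apply, show (-12 : ℤ) = -((12 : ℕ) : ℤ) from rfl, zpow_neg,
    zpow_natCast] at h
  have hd : UpperHalfPlane.denom γ z ≠ 0 := UpperHalfPlane.denom_ne_zero _ z
  simp only [hF] at h
  rw [← h]
  field_simp

lemma thetaForm_eq_sum {N m : ℕ} {q : ℝ[X]} (hq : q.natDegree ≤ N) {z : ℂ} (hz : 0 < z.im) :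
    thetaForm N m q z = (∑ i ∈ Finset.range (N + 1), (q.coeff i : ℂ) * thetaU z ^ i *
      thetaV z ^ (N - i)) / (thetaU z * thetaV z * thetaW z) ^ m := by
  have hV := thetaV_ne_zero hz
  rw [thetaForm, aeval_eq_sum_range' (Nat.lt_succ_of_le hq), Finset.mul_sum]
  congr 1
  refine Finset.sum_congr rfl fun i hi ↦ ?_
  have hi' : i ≤ N := Nat.lt_succ_iff.1 (Finset.mem_range.1 hi)
  rw [modularLambda_eq, div_pow, Complex.real_smul, ← Nat.sub_add_cancel hi', pow_add,
    Nat.add_sub_cancel]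
  field_simp

/-- The numerator is a homogeneous polynomial in `θ₁₀⁴` and `θ₀₀⁴`, so `γ` acts by substituting the
transforms of these two. This handles invariance under `Γ(2)` and growth at every cusp at once. -/
lemma thetaForm_slash {N m κ : ℕ} (hm : Even m) (hκ : 2 * N + κ = 6 * m) {q : ℝ[X]}
    (hq : q.natDegree ≤ N) {γ : SL(2, ℤ)} {u v : ℍ → ℂ} (hu : formU ∣[(2 : ℤ)] γ = u)
    (hv : formV ∣[(2 : ℤ)] γ = v) (z : ℍ) :
    ((fun z : ℍ ↦ thetaForm N m q z) ∣[-(κ : ℤ)] γ) z =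
      (∑ i ∈ Finset.range (N + 1), (q.coeff i : ℂ) * u z ^ i * v z ^ (N - i)) /
        (thetaU z * thetaV z * thetaW z) ^ m := by
  have hd : UpperHalfPlane.denom γ z ≠ 0 := UpperHalfPlane.denom_ne_zero _ z
  have hu' : thetaU (γ • z : ℍ) = UpperHalfPlane.denom γ z ^ 2 * u z := by
    rw [← hu, ModularForm.SL_slash_apply, show (-2 : ℤ) = -((2 : ℕ) : ℤ) from rfl, zpow_neg,
      zpow_natCast]
    simp only [formU]
    field_simp
  have hv' : thetaV (γ • z : ℍ) = UpperHalfPlane.denom γ z ^ 2 * v z := by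
    rw [← hv, ModularForm.SL_slash_apply, show (-2 : ℤ) = -((2 : ℕ) : ℤ) from rfl, zpow_neg,
      zpow_natCast]
    simp only [formV]
    field_simp
  rw [ModularForm.SL_slash_apply, neg_neg, zpow_natCast]
  rw [thetaForm_eq_sum hq (γ • z).2]
  obtain ⟨l, hl⟩ := hm
  have hP : (thetaU (γ • z : ℍ) * thetaV (γ • z : ℍ) * thetaW (γ • z : ℍ)) ^ m =
      UpperHalfPlane.denom γ z ^ (6 * m) * (thetaU z * thetaV z * thetaW z) ^ m := by
    rw [show m = 2 * l by omega, pow_mul, pow_mul _ 2 l, theta_prod_sq_smul, mul_pow, ← pow_mul]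
    congr 2
    omega
  rw [hP]
  have hz := theta_mul_ne_zero z.2
  have hsum : ∑ i ∈ Finset.range (N + 1), (q.coeff i : ℂ) * thetaU (γ • z : ℍ) ^ i *
      thetaV (γ • z : ℍ) ^ (N - i) = UpperHalfPlane.denom γ z ^ (2 * N) *
      ∑ i ∈ Finset.range (N + 1), (q.coeff i : ℂ) * u z ^ i * v z ^ (N - i) := by
    rw [Finset.mul_sum]
    refine Finset.sum_congr rfl fun i hi ↦ ?_
    have hi' : i ≤ N := Nat.lt_succ_iff.1 (Finset.mem_range.1 hi)
    obtain ⟨j, rfl⟩ := Nat.exists_eq_add_of_le hi'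
    rw [hu', hv', Nat.add_sub_cancel_left, mul_pow, mul_pow, mul_add, pow_add, ← pow_mul, ← pow_mul]
    ring
  rw [hsum, ← hκ, pow_add]
  field_simp

lemma thetaForm_slash_Gamma_two {N m κ : ℕ} (hm : Even m) (hκ : 2 * N + κ = 6 * m) {q : ℝ[X]}
    (hq : q.natDegree ≤ N) {γ : SL(2, ℤ)} (hγ : γ ∈ CongruenceSubgroup.Gamma 2) :
    (fun z : ℍ ↦ thetaForm N m q z) ∣[-(κ : ℤ)] γ = fun z : ℍ ↦ thetaForm N m q z := by
  obtain ⟨a, b, c, d, h1, h2, h3⟩ := actsByThetaMatrix γ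
  rw [CongruenceSubgroup.Gamma_mem] at hγ
  obtain ⟨e1, e2, e3, e4⟩ := hγ
  rw [e1, e2, e3, e4, show thetaMatrix 1 0 0 1 = (1, 0, 0, 1) from rfl] at h1
  simp only [Prod.mk.injEq] at h1
  obtain ⟨rfl, rfl, rfl, rfl⟩ := h1
  ext z
  rw [thetaForm_slash hm hκ hq h3 h2, thetaForm_eq_sum hq z.2]
  simp [formU, formV]

lemma isBigO_inv_theta_prod :
    (fun z : ℂ ↦ (thetaU z * thetaV z * thetaW z)⁻¹) =O[comap Complex.im atTop]
      fun z ↦ Real.exp (Real.pi * z.im) := by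
  have h : Tendsto (fun z ↦ (thetaU z * Complex.exp (-(Real.pi * Complex.I * z)) * thetaV z *
      thetaW z)⁻¹) (comap Complex.im atTop) (𝓝 (16 * 1 * 1)⁻¹) :=
    ((tendsto_thetaU.mul tendsto_thetaV).mul tendsto_thetaW).inv₀ (by norm_num)
  have h2 : (fun z : ℂ ↦ Complex.exp (-(Real.pi * Complex.I * z))) =O[comap Complex.im atTop]
      fun z ↦ Real.exp (Real.pi * z.im) :=
    IsBigO.of_bound 1 (Eventually.of_forall fun z ↦ by simp [Complex.norm_exp])
  refine (((h.isBigO_one ℝ).mul h2).congr_left fun z ↦ ?_).congr_right fun z ↦ one_mul _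
  have := Complex.exp_ne_zero (-(Real.pi * Complex.I * z))
  rw [mul_inv, mul_inv, mul_inv, mul_inv, mul_inv]
  field_simp

lemma isWeaklyHolomorphic_thetaForm {Γ : Subgroup SL(2, ℤ)} {N m κ : ℕ} (hm : Even m)
    (hκ : 2 * N + κ = 6 * m) {q : ℝ[X]} (hq : q.natDegree ≤ N)
    (hinv : ∀ γ ∈ Γ, (fun z : ℍ ↦ thetaForm N m q z) ∣[-(κ : ℤ)] γ = fun z : ℍ ↦ thetaForm N m q z) :
    IsWeaklyHolomorphic Γ (-(κ : ℤ)) fun z : ℍ ↦ thetaForm N m q z where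
  holo := by
    rw [UpperHalfPlane.mdifferentiable_iff]
    refine .congr (fun z hz ↦ (differentiableAt_thetaForm N m q hz).differentiableWithinAt)
      fun z hz ↦ ?_
    simp [UpperHalfPlane.ofComplex_apply_of_im_pos hz]
  slash_eq := hinv
  cusps := by
    intro γ
    obtain ⟨a, b, c, d, -, h2, h3⟩ := actsByThetaMatrix γ
    -- The numerator stays bounded, and the inverse of the theta product is `O(exp(π Im z))`; its
    -- `m`-th power corresponds to `exp(2π(m/2) Im z)`.
    refine ⟨m / 2, ?_⟩
    have hfun := funext (thetaForm_slash hm hκ hq h3 h2)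
    rw [hfun]
    have hV : formV =O[UpperHalfPlane.atImInfty] fun _ ↦ (1 : ℝ) :=
      (tendsto_thetaV.comp UpperHalfPlane.tendsto_coe_atImInfty).isBigO_one ℝ
    have hU : formU =O[UpperHalfPlane.atImInfty] fun _ ↦ (1 : ℝ) :=
      (tendsto_thetaU_zero.comp UpperHalfPlane.tendsto_coe_atImInfty).isBigO_one ℝ
    have hcomb : ∀ a b : ℤ, (a • formV + b • formU) =O[UpperHalfPlane.atImInfty]
        fun _ ↦ (1 : ℝ) := fun a b ↦ by
      refine (((hV.const_mul_left (a : ℂ)).add (hU.const_mul_left (b : ℂ)))).congr_left fun z ↦ ?_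
      simp
    have hsum : (fun z : ℍ ↦ ∑ i ∈ Finset.range (N + 1), (q.coeff i : ℂ) *
        (c • formV + d • formU) z ^ i * (a • formV + b • formU) z ^ (N - i))
        =O[UpperHalfPlane.atImInfty] fun _ ↦ (1 : ℝ) := by
      refine IsBigO.fun_sum (A := fun i (z : ℍ) ↦ (q.coeff i : ℂ) * (c • formV + d • formU) z ^ i *
        (a • formV + b • formU) z ^ (N - i)) fun i _ ↦ ?_
      have := (((hcomb c d).pow i).const_mul_left (q.coeff i : ℂ)).mul ((hcomb a b).pow (N - i))
      simpa using this
    have hP := (isBigO_inv_theta_prod.comp_tendsto UpperHalfPlane.tendsto_coe_atImInfty).pow m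
    refine ((hsum.mul hP).congr_left fun z ↦ ?_).congr_right fun z ↦ ?_
    · simp only [div_eq_mul_inv, Function.comp, inv_pow]
    · simp only [one_mul, Function.comp, ← Real.exp_nat_mul]
      congr 1
      have : (z : ℂ).im = z.im := rfl
      rw [this]; ring

end FourierEigen

end

noncomputable section

namespace FourierEigen

open Complex Filter Topology Asymptotics

/-! ### The kernel of the Laplace transform -/

/-- The properties of `ψ = f log λ + ω` that drive the construction of the eigenfunction; `ψS` is
the transform of `ψ` under `z ↦ -1 / z`. -/
structure LaplaceKernel (κ n : ℕ) (f ψ ψS : ℂ → ℂ) : Prop where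
  differentiableAt : ∀ z : ℂ, 0 < z.im → DifferentiableAt ℂ ψ z
  differentiableAt_S : ∀ z : ℂ, 0 < z.im → DifferentiableAt ℂ ψS z
  slash : ∀ z : ℂ, 0 < z.im → z ^ κ * ψ (-1 / z) = ψS z
  f_add_one : ∀ z : ℂ, 0 < z.im → f (z + 1) = f z
  add_one : ∀ z : ℂ, 0 < z.im → ψ (z + 1) = ψ z - ψS z + Real.pi * I * f z
  S_add_one : ∀ z : ℂ, 0 < z.im → ψS (z + 1) = -ψS z
  bound_S : ∃ C : ℝ, ∀ z : ℂ, 1 / 2 ≤ z.im → ‖ψS z‖ ≤ C * Real.exp (-(Real.pi * z.im))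
  bound : ∃ C : ℝ, ∀ z : ℂ, 1 / 2 ≤ z.im → |z.re| ≤ 1 →
    ‖ψ z‖ ≤ C * Real.exp (2 * Real.pi * n * z.im)
  im_eq_zero : ∀ t : ℝ, 0 < t → (ψ (I * t)).im = 0
  asymp : ∃ c : ℂ, c ≠ 0 ∧
    Tendsto (fun t : ℝ ↦ ψ (I * t) * Real.exp (-(2 * Real.pi * n * t))) atTop (𝓝 c)

lemma neBot_comap_im : (comap im atTop : Filter ℂ).NeBot := by
  refine comap_neBot fun t ht ↦ ?_
  obtain ⟨y, hy⟩ := (atTop_neBot (α := ℝ)).nonempty_of_mem ht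
  exact ⟨y * I, by simpa using hy⟩

/-- After exponentiation this is `(1 - λ(z+1))(1 - λ(z)) = 1`; the limit at `i∞` excludes a multiple
of `2πi`. -/
lemma logLam_S_add_one {z : ℂ} (hz : 0 < z.im) : logLam (-1 / (z + 1)) = -logLam (-1 / z) := by
  set h : ℂ → ℂ := fun z ↦ logLam (-1 / (z + 1)) + logLam (-1 / z) with hh
  have hc : ContinuousOn h {z | 0 < z.im} := by
    have h1 : ContinuousOn (fun z ↦ logLam (-1 / (z + 1))) {z | 0 < z.im} :=
      continuousOn_logLam_S.comp (f := fun z : ℂ ↦ z + 1) (by fun_prop)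
        fun z hz ↦ by simpa using hz
    exact h1.add continuousOn_logLam_S
  have h1 : ∀ z ∈ {z : ℂ | 0 < z.im}, cexp (h z) = 1 := by
    intro z hz
    have hz' : 0 < (z + 1).im := by simpa using hz
    have b := one_sub_modularLambda_ne_zero hz
    simp only [hh]
    rw [Complex.exp_add, exp_logLam_S hz, exp_logLam_S hz', modularLambda_add_one hz]
    field_simp
    ring
  have h2 : Tendsto h (comap im atTop) (𝓝 0) := by
    have := (tendsto_logLam_S.comp tendsto_add_one_comap_im).add tendsto_logLam_S
    simpa using this
  have h3 : Tendsto h (comap im atTop) (𝓝 (h z)) :=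
    tendsto_const_nhds.congr' (eventually_im_pos.mono fun w hw ↦
      eq_of_exp_eq_one preconnected_im_pos hc h1 hz hw)
  have := neBot_comap_im
  exact eq_neg_of_add_eq_zero_left (tendsto_nhds_unique h3 h2)

lemma isBigO_modularLambda :
    modularLambda =O[comap im atTop] fun z ↦ Real.exp (-(Real.pi * z.im)) := by
  have h2 : (fun z : ℂ ↦ cexp (Real.pi * I * z)) =O[comap im atTop]
      fun z ↦ Real.exp (-(Real.pi * z.im)) :=
    IsBigO.of_bound 1 (Eventually.of_forall fun z ↦ by simp [Complex.norm_exp])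
  refine (((tendsto_modularLambda_mul_exp.isBigO_one ℝ).mul h2).congr_left fun z ↦ ?_).congr_right
    fun z ↦ one_mul _
  rw [mul_assoc, ← Complex.exp_add]
  simp

lemma isBigO_aeval_modularLambda {q : Polynomial ℝ} {j : ℕ} (hq : Polynomial.X ^ j ∣ q) :
    (fun z ↦ Polynomial.aeval (modularLambda z) q) =O[comap im atTop]
      fun z ↦ Real.exp (-(Real.pi * z.im)) ^ j := by
  obtain ⟨r, rfl⟩ := hq
  have h : Tendsto (fun z ↦ Polynomial.aeval (modularLambda z) r) (comap im atTop)
      (𝓝 (Polynomial.aeval 0 r)) :=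
    ((r.continuous_aeval (A := ℂ)).tendsto 0).comp tendsto_modularLambda
  refine (((isBigO_modularLambda.pow j).mul (h.isBigO_one ℝ))).congr (fun z ↦ ?_) fun z ↦ ?_
  · simp
  · simp

lemma isBigO_thetaV_pow_div (N m : ℕ) :
    (fun z ↦ thetaV z ^ N / (thetaU z * thetaV z * thetaW z) ^ m) =O[comap im atTop]
      fun z ↦ Real.exp (Real.pi * z.im) ^ m := by
  refine (((tendsto_thetaV.isBigO_one ℝ).pow N).mul (isBigO_inv_theta_prod.pow m)).congr
    (fun z ↦ ?_) fun z ↦ ?_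
  · rw [inv_pow, div_eq_mul_inv]
  · simp

lemma isBigO_thetaForm (N : ℕ) {m j k : ℕ} {q : Polynomial ℝ} (hq : Polynomial.X ^ j ∣ q)
    (hm : m = j + k) :
    thetaForm N m q =O[comap im atTop] fun z ↦ Real.exp (Real.pi * z.im) ^ k := by
  refine ((isBigO_thetaV_pow_div N m).mul (isBigO_aeval_modularLambda hq)).congr
    (fun z ↦ ?_) fun z ↦ ?_
  · simp only [thetaForm]; ring
  · rw [hm, pow_add, mul_right_comm, ← mul_pow, ← Real.exp_add]
    simp

lemma isBigO_log_sub_logPoly (m : ℕ) :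
    (fun z ↦ logLam (-1 / z) - Polynomial.aeval (modularLambda z) (logPoly m)) =O[comap im atTop]
      fun z ↦ Real.exp (-(Real.pi * z.im)) ^ (m + 1) := by
  refine IsBigO.trans (IsBigO.of_bound 2 ?_) (isBigO_modularLambda.pow (m + 1))
  have h1 := tendsto_modularLambda.eventually (Metric.ball_mem_nhds (0 : ℂ) (by norm_num : (0 : ℝ) < 1 / 2))
  filter_upwards [h1, eventually_logLam_S] with z hz1 hz2
  have hz : ‖modularLambda z‖ < 1 / 2 := by simpa using hz1
  have h3 : logTaylor (m + 1) (-modularLambda z) = Polynomial.aeval (modularLambda z) (logPoly m) := by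
    rw [logTaylor, Finset.sum_range_succ', logPoly]
    simp only [map_neg, map_sum, map_mul, map_pow, Polynomial.aeval_X, Polynomial.aeval_C]
    simp only [Nat.cast_zero, div_zero, add_zero]
    rw [← Finset.sum_neg_distrib]
    refine Finset.sum_congr rfl fun k _ ↦ ?_
    rw [neg_pow (modularLambda z), pow_succ (-1 : ℂ) (k + 1), ← mul_assoc, mul_right_comm _ (-1 : ℂ),
      ← mul_pow]
    simp
    ring
  rw [hz2, ← h3, sub_eq_add_neg 1]
  refine (norm_log_sub_logTaylor_le m (z := -modularLambda z) (by rw [norm_neg]; linarith)).trans ?_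
  rw [norm_neg, norm_pow]
  have h4 : (1 - ‖modularLambda z‖)⁻¹ ≤ 2 := by
    rw [inv_le_comm₀ (by linarith) (by norm_num)]; linarith
  have h5 : 0 ≤ ‖modularLambda z‖ ^ (m + 1) := by positivity
  have h6 : 0 ≤ (1 - ‖modularLambda z‖)⁻¹ := by
    rw [inv_nonneg]; linarith
  calc ‖modularLambda z‖ ^ (m + 1) * (1 - ‖modularLambda z‖)⁻¹ / (m + 1)
      ≤ ‖modularLambda z‖ ^ (m + 1) * (1 - ‖modularLambda z‖)⁻¹ :=
        div_le_self (by positivity) (by linarith [Nat.cast_nonneg (α := ℝ) m])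
    _ ≤ 2 * ‖modularLambda z‖ ^ (m + 1) := by nlinarith

/-- The term `πiz` grows with `Re z`, hence the restriction to a vertical strip. -/
lemma isBigO_logLam : logLam =O[comap im atTop ⊓ 𝓟 {z | |z.re| ≤ 1}]
    fun z ↦ Real.exp (Real.pi * z.im) := by
  have h1 := tendsto_logLam_sub.eventually (Metric.ball_mem_nhds (0 : ℂ) one_pos)
  refine IsBigO.of_bound (1 + Real.pi + 1 + Real.log 16) ?_
  rw [eventually_inf_principal]
  filter_upwards [h1, eventually_im_pos] with z hz1 hz hre
  have hz2 : ‖logLam z - Real.pi * I * z - Real.log 16‖ < 1 := by simpa using hz1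
  have hlog : 0 ≤ Real.log 16 := Real.log_nonneg (by norm_num)
  have hz3 : ‖Real.pi * I * z‖ ≤ Real.pi * (1 + z.im) := by
    rw [norm_mul, norm_mul, norm_I, Complex.norm_real, Real.norm_of_nonneg Real.pi_pos.le, mul_one]
    gcongr
    refine (Complex.norm_le_abs_re_add_abs_im z).trans ?_
    rw [abs_of_pos hz]
    have : |z.re| ≤ 1 := hre
    linarith
  have hz4 : ‖logLam z‖ ≤ 1 + Real.pi * (1 + z.im) + Real.log 16 := by
    calc ‖logLam z‖ = ‖(logLam z - Real.pi * I * z - Real.log 16) + Real.pi * I * z + (Real.log 16 : ℝ)‖ := by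
          congr 1; ring
      _ ≤ ‖logLam z - Real.pi * I * z - Real.log 16‖ + ‖Real.pi * I * z‖ + ‖((Real.log 16 : ℝ) : ℂ)‖ :=
          norm_add₃_le
      _ ≤ _ := by
          rw [Complex.norm_real, Real.norm_of_nonneg hlog]
          linarith
  have h5 : Real.pi * z.im + 1 ≤ Real.exp (Real.pi * z.im) := Real.add_one_le_exp _
  have h6 : 1 ≤ Real.exp (Real.pi * z.im) := Real.one_le_exp (by positivity)
  rw [Real.norm_of_nonneg (Real.exp_pos _).le]
  have := Real.pi_pos
  nlinarith

lemma aeval_ofReal_eq (q : Polynomial ℝ) (r : ℝ) :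
    Polynomial.aeval (r : ℂ) q = ((q.eval r : ℝ) : ℂ) := by
  rw [← Complex.coe_algebraMap, Polynomial.aeval_algebraMap_apply]
  rfl

lemma exists_thetaForm_eq_ofReal (N m : ℕ) (q : Polynomial ℝ) {t : ℝ} (ht : 0 < t) :
    ∃ r : ℝ, thetaForm N m q (I * t) = r := by
  obtain ⟨u, -, hu⟩ := exists_thetaU_eq_ofReal ht
  obtain ⟨v, -, hv⟩ := exists_thetaV_eq_ofReal ht
  obtain ⟨w, -, hw⟩ := exists_thetaW_eq_ofReal ht
  obtain ⟨l, -, -, hl⟩ := exists_modularLambda_eq_ofReal ht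
  refine ⟨v ^ N * q.eval l / (u * v * w) ^ m, ?_⟩
  rw [thetaForm, hu, hv, hw, hl, aeval_ofReal_eq]
  push_cast
  rfl

lemma isCompact_strip (a b : ℝ) : IsCompact {z : ℂ | z.im ∈ Set.Icc a b ∧ |z.re| ≤ 1} := by
  have h := (isCompact_Icc (a := (-1 : ℝ)) (b := 1)).reProdIm (isCompact_Icc (a := a) (b := b))
  convert h using 1
  ext z
  simp only [Set.mem_ofPred_eq, Complex.mem_reProdIm, Set.mem_Icc, abs_le]
  tauto

/-- A bound near `i∞` extends to the strip `|Re z| ≤ 1`, `Im z ≥ 1/2`. -/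
lemma exists_bound_strip {g : ℂ → ℂ} (hg : ∀ z : ℂ, 0 < z.im → DifferentiableAt ℂ g z) {a : ℝ}
    (h : g =O[comap im atTop ⊓ 𝓟 {z | |z.re| ≤ 1}] fun z ↦ Real.exp (a * z.im)) :
    ∃ C : ℝ, ∀ z : ℂ, 1 / 2 ≤ z.im → |z.re| ≤ 1 → ‖g z‖ ≤ C * Real.exp (a * z.im) := by
  obtain ⟨C, hC⟩ := h.bound
  rw [eventually_inf_principal, eventually_comap, eventually_atTop] at hC
  obtain ⟨Y, hY⟩ := hC
  have hcont : ContinuousOn (fun z ↦ g z * Real.exp (-(a * z.im)))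
      {z : ℂ | z.im ∈ Set.Icc (1 / 2) Y ∧ |z.re| ≤ 1} := by
    refine ContinuousOn.mul (fun z hz ↦ ?_) (by fun_prop)
    exact (hg z (by linarith [hz.1.1])).continuousAt.continuousWithinAt
  obtain ⟨C', hC'⟩ := (isCompact_strip (1 / 2) Y).exists_bound_of_continuousOn hcont
  refine ⟨max C C', fun z hz hre ↦ ?_⟩
  have hpos := Real.exp_pos (a * z.im)
  rcases le_total Y z.im with h1 | h1
  · have := hY z.im h1 z rfl hre
    rw [Real.norm_of_nonneg hpos.le] at this
    exact this.trans (by gcongr; exact le_max_left _ _)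
  · have h2 := hC' z ⟨⟨hz, h1⟩, hre⟩
    rw [norm_mul, Complex.norm_real, Real.norm_of_nonneg (Real.exp_pos _).le, Real.exp_neg,
      ← div_eq_mul_inv, div_le_iff₀ hpos] at h2
    exact h2.trans (by gcongr; exact le_max_right _ _)

lemma norm_add_int_of_neg {g : ℂ → ℂ} (hg : ∀ z : ℂ, 0 < z.im → g (z + 1) = -g z) {z : ℂ}
    (hz : 0 < z.im) (k : ℤ) : ‖g (z + k)‖ = ‖g z‖ := by
  induction k using Int.induction_on with
  | zero => simp
  | succ k ih =>
    rw [← ih, Int.cast_add, Int.cast_one, ← add_assoc, hg _ (by simpa using hz), norm_neg]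
  | pred k ih =>
    rw [← ih, Int.cast_sub, Int.cast_one]
    conv_rhs => rw [show z + ((-k : ℤ) : ℂ) = z + (((-k : ℤ) : ℂ) - 1) + 1 by ring]
    rw [hg _ (by simpa using hz), norm_neg]

end FourierEigen

end

/-! ### Construction of the kernel from the polynomial data -/

noncomputable section

namespace FourierEigen

open Complex Filter Topology Asymptotics

lemma polyOmega_S {K : ℕ} {A B : Polynomial ℝ} (hA : A ∈ levelOne (K + 1)) (hB : B ∈ levelOne K)
    (x : ℂ) : (-1) ^ (K + 2) * Polynomial.aeval (1 - x) (polyOmega A B) =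
      Polynomial.aeval x (polyPhi A B) := by
  have hs : ((-1 : ℂ) ^ K) ^ 2 = 1 := by rw [← pow_mul, mul_comm, pow_mul]; simp
  simp only [polyOmega, polyPhi, map_add, map_neg, map_mul, map_sub, map_pow, map_one, map_ofNat,
    Polynomial.aeval_X, aeval_one_sub_of_mem_levelOne hA, aeval_one_sub_of_mem_levelOne hB]
  rw [pow_succ, pow_succ]
  linear_combination (x * Polynomial.aeval x A + x * (2 - x) * Polynomial.aeval x B) * hs

lemma polyOmega_T {K : ℕ} {A B : Polynomial ℝ} (hA : A ∈ levelOne (K + 1)) (hB : B ∈ levelOne K)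
    (x : ℂ) (hx : 1 - x ≠ 0) :
    (1 - x) ^ (K + 2) * Polynomial.aeval (-(x / (1 - x))) (polyOmega A B) =
      Polynomial.aeval x (polyOmega A B - polyPhi A B) := by
  have h1 := aeval_T_of_mem_levelOne hA hx
  have h2 := aeval_T_of_mem_levelOne hB hx
  simp only [polyOmega, polyPhi, map_add, map_neg, map_mul, map_sub, map_pow, map_one, map_ofNat,
    Polynomial.aeval_X, ← h1, ← h2]
  field_simp
  ring

lemma polyPhi_T {K : ℕ} {A B : Polynomial ℝ} (hA : A ∈ levelOne (K + 1)) (hB : B ∈ levelOne K)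
    (x : ℂ) (hx : 1 - x ≠ 0) :
    (1 - x) ^ (K + 2) * Polynomial.aeval (-(x / (1 - x))) (polyPhi A B) =
      Polynomial.aeval x (-polyPhi A B) := by
  have h1 := aeval_T_of_mem_levelOne hA hx
  have h2 := aeval_T_of_mem_levelOne hB hx
  simp only [polyPhi, map_add, map_neg, map_mul, map_sub, map_ofNat,
    Polynomial.aeval_X, ← h1, ← h2]
  field_simp
  ring

lemma natDegree_polyOmega_le {K : ℕ} {A B : Polynomial ℝ} (hA : A ∈ levelOne (K + 1))
    (hB : B ∈ levelOne K) : (polyOmega A B).natDegree ≤ K + 2 := by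
  have hA' := natDegree_le_of_mem_levelOne hA
  have hB' := natDegree_le_of_mem_levelOne hB
  have h1 : (1 - Polynomial.X : Polynomial ℝ).natDegree ≤ 1 := by compute_degree
  have h2 : (1 - Polynomial.X ^ 2 : Polynomial ℝ).natDegree ≤ 2 := by compute_degree
  refine Polynomial.natDegree_add_le_of_degree_le ?_ ?_
  · rw [Polynomial.natDegree_neg]
    exact Polynomial.natDegree_mul_le.trans (by omega)
  · exact Polynomial.natDegree_mul_le.trans (by omega)

/-- Both the Taylor remainder of `log(1-λ)` and the truncated numerator have order `2n + 1` in `λ`.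
The denominator takes away `2n` of these and leaves one factor `exp(-π Im z)`. -/
lemma isBigO_kernel_S {N n : ℕ} {p A B : Polynomial ℝ}
    (h : Polynomial.X ^ (2 * n + 1) ∣ p * logPoly (2 * n) + polyPhi A B) :
    (fun z ↦ thetaForm N (2 * n) p z * logLam (-1 / z) + thetaForm N (2 * n) (polyPhi A B) z)
      =O[comap im atTop] fun z ↦ Real.exp (-Real.pi * z.im) := by
  have hp : (fun z ↦ Polynomial.aeval (modularLambda z) p) =O[comap im atTop] fun _ ↦ (1 : ℝ) := by
    have := isBigO_aeval_modularLambda (q := p) (j := 0) (by simp)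
    simpa using this
  have h1 := (hp.mul (isBigO_log_sub_logPoly (2 * n))).congr_right fun z ↦ one_mul _
  have h2 := (isBigO_thetaV_pow_div N (2 * n)).mul (h1.add (isBigO_aeval_modularLambda h))
  refine h2.congr (fun z ↦ ?_) fun z ↦ ?_
  · simp only [thetaForm, map_add, map_mul]; ring
  · rw [pow_succ, ← mul_assoc, ← mul_pow, ← Real.exp_add]
    simp

lemma tendsto_I_mul_comap_im : Tendsto (fun t : ℝ ↦ I * (t : ℂ)) atTop (comap im atTop) := by
  rw [tendsto_comap_iff]
  refine tendsto_id.congr fun t ↦ ?_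
  simp

theorem exists_kernel {e n : ℕ} (he : 0 < e) (hn : n = e / 4 + 1) : ∃ f ω ψS : ℂ → ℂ,
    IsWeaklyHolomorphic ⊤ (-((2 * (e - 1) : ℕ) : ℤ)) (fun z : ℍ ↦ f z) ∧
    IsWeaklyHolomorphic (CongruenceSubgroup.Gamma 2) (-((2 * (e - 1) : ℕ) : ℤ))
      (fun z : ℍ ↦ ω z) ∧
    LaplaceKernel (2 * (e - 1)) n f (fun z ↦ f z * logLam z + ω z) ψS := by
  obtain ⟨K, hK⟩ : ∃ K, K + 1 + e = 6 * n := ⟨6 * n - 1 - e, by omega⟩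
  obtain ⟨p, A, B, hp, hA, hB, hp2, hY, hAB⟩ := exists_polynomial_data he hn hK
  set κ := 2 * (e - 1) with hκdef
  have hκ : 2 * (K + 2) + κ = 6 * (2 * n) := by omega
  have hm : Even (2 * n) := even_two_mul n
  set f : ℂ → ℂ := thetaForm (K + 2) (2 * n) p with hf
  set ω : ℂ → ℂ := thetaForm (K + 2) (2 * n) (polyOmega A B) with hω
  set φ : ℂ → ℂ := thetaForm (K + 2) (2 * n) (polyPhi A B) with hφ
  have hfd : ∀ z : ℂ, 0 < z.im → DifferentiableAt ℂ f z := fun z ↦ differentiableAt_thetaForm _ _ _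
  have hωd : ∀ z : ℂ, 0 < z.im → DifferentiableAt ℂ ω z := fun z ↦ differentiableAt_thetaForm _ _ _
  have hφd : ∀ z : ℂ, 0 < z.im → DifferentiableAt ℂ φ z := fun z ↦ differentiableAt_thetaForm _ _ _
  have hfS : ∀ z : ℂ, 0 < z.im → z ^ κ * f (-1 / z) = f z := fun z hz ↦
    thetaForm_S hm hκ (fun x ↦ by
      rw [aeval_one_sub_of_mem_levelOne hp, ← mul_assoc, ← mul_pow]; simp) hz
  have hfT : ∀ z : ℂ, 0 < z.im → f (z + 1) = f z := fun z hz ↦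
    thetaForm_add_one hm (fun x hx ↦ aeval_T_of_mem_levelOne hp hx) hz
  have hωS : ∀ z : ℂ, 0 < z.im → z ^ κ * ω (-1 / z) = φ z := fun z hz ↦
    thetaForm_S hm hκ (polyOmega_S hA hB) hz
  have hωT : ∀ z : ℂ, 0 < z.im → ω (z + 1) = ω z - φ z := fun z hz ↦ by
    rw [← thetaForm_sub_poly]
    exact thetaForm_add_one hm (polyOmega_T hA hB) hz
  have hφT : ∀ z : ℂ, 0 < z.im → φ (z + 1) = -φ z := fun z hz ↦ by
    rw [← thetaForm_neg_poly]
    exact thetaForm_add_one hm (polyPhi_T hA hB) hz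
  have hψd : ∀ z : ℂ, 0 < z.im → DifferentiableAt ℂ (fun z ↦ f z * logLam z + ω z) z :=
    fun z hz ↦ ((hfd z hz).mul (differentiableAt_logLam hz)).add (hωd z hz)
  have hψSd : ∀ z : ℂ, 0 < z.im → DifferentiableAt ℂ (fun z ↦ f z * logLam (-1 / z) + φ z) z := by
    intro z hz
    refine ((hfd z hz).mul ?_).add (hφd z hz)
    have h1 : DifferentiableAt ℂ (fun z : ℂ ↦ -1 / z) z :=
      (differentiableAt_const _).div differentiableAt_id (ne_zero_of_im_pos hz)
    exact (differentiableAt_logLam (im_neg_one_div hz)).comp z h1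
  have hST : ∀ z : ℂ, 0 < z.im →
      (fun z ↦ f z * logLam (-1 / z) + φ z) (z + 1) = -(fun z ↦ f z * logLam (-1 / z) + φ z) z := by
    intro z hz
    simp only [hfT z hz, hφT z hz, logLam_S_add_one hz]
    ring
  -- `X² ∣ p` keeps `f log λ` of order at most `exp(π(2n-1) Im z)`, strictly below the leading term
  -- of `ω`.
  have hfO : f =O[comap im atTop] fun z ↦ Real.exp (Real.pi * z.im) ^ (2 * n - 2) :=
    isBigO_thetaForm _ hp2 (by omega)
  have hflO : (fun z ↦ f z * logLam z) =O[comap im atTop ⊓ 𝓟 {z | |z.re| ≤ 1}]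
      fun z ↦ Real.exp (Real.pi * z.im) ^ (2 * n - 1) := by
    refine ((hfO.mono inf_le_left).mul isBigO_logLam).congr_right fun z ↦ ?_
    rw [← pow_succ]
    congr 1
    omega
  refine ⟨f, ω, fun z ↦ f z * logLam (-1 / z) + φ z, ?_, ?_, ?_⟩
  · refine isWeaklyHolomorphic_thetaForm hm hκ (natDegree_le_of_mem_levelOne hp) fun γ _ ↦ ?_
    refine SlashInvariantForm.slash_action_generators_SL2Z ?_ ?_ γ
    · ext z
      rw [slash_S_apply, neg_neg, zpow_natCast, mul_comm]
      exact hfS z z.2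
    · ext z
      rw [slash_T_apply]
      exact hfT z z.2
  · exact isWeaklyHolomorphic_thetaForm hm hκ (natDegree_polyOmega_le hA hB) fun γ hγ ↦
      thetaForm_slash_Gamma_two hm hκ (natDegree_polyOmega_le hA hB) hγ
  refine ⟨hψd, hψSd, ?_, hfT, ?_, hST, ?_, ?_, ?_, ?_⟩
  · intro z hz
    rw [mul_add, ← mul_assoc, hfS z hz, hωS z hz]
  · intro z hz
    simp only [hfT z hz, hωT z hz, logLam_add_one hz]
    ring
  -- `ψS(z+1) = -ψS(z)`, so the bound on a strip extends to all real parts by integral translations.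
  · obtain ⟨C, hC⟩ := exists_bound_strip hψSd ((isBigO_kernel_S hY).mono inf_le_left)
    refine ⟨C, fun z hz ↦ ?_⟩
    have hz0 : 0 < z.im := by linarith
    have h1 := norm_add_int_of_neg (g := fun z ↦ f z * logLam (-1 / z) + φ z) hST hz0 (-⌊z.re⌋)
    have hre : |(z + ((-⌊z.re⌋ : ℤ) : ℂ)).re| ≤ 1 := by
      have e1 := Int.floor_le z.re
      have e2 := Int.lt_floor_add_one z.re
      rw [abs_le]
      constructor <;> simp <;> linarith
    have h2 := hC (z + ((-⌊z.re⌋ : ℤ) : ℂ)) (by simpa using hz) hre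
    rw [h1] at h2
    simpa using h2
  · refine exists_bound_strip hψd ?_
    have h1 : (fun z : ℂ ↦ Real.exp (Real.pi * z.im) ^ (2 * n - 1)) =O[comap im atTop]
        fun z ↦ Real.exp (2 * Real.pi * n * z.im) := by
      refine IsBigO.of_bound 1 ?_
      filter_upwards [eventually_im_pos] with z hz
      rw [one_mul, ← Real.exp_nat_mul, Real.norm_of_nonneg (Real.exp_pos _).le,
        Real.norm_of_nonneg (Real.exp_pos _).le, Real.exp_le_exp]
      have h2 : ((2 * n - 1 : ℕ) : ℝ) ≤ 2 * n := by
        exact_mod_cast Nat.sub_le _ _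
      have := Real.pi_pos
      calc ((2 * n - 1 : ℕ) : ℝ) * (Real.pi * z.im) ≤ (2 * n) * (Real.pi * z.im) := by gcongr
        _ = _ := by ring
    have h2 : ω =O[comap im atTop] fun z ↦ Real.exp (2 * Real.pi * n * z.im) := by
      refine (isBigO_thetaForm (K + 2) (j := 0) (k := 2 * n) (by simp) (by omega)).congr_right
        fun z ↦ ?_
      rw [← Real.exp_nat_mul]
      congr 1
      push_cast
      ring
    exact (hflO.trans (h1.mono inf_le_left)).add (h2.mono inf_le_left)
  · intro t ht
    obtain ⟨r, hr⟩ := exists_thetaForm_eq_ofReal (K + 2) (2 * n) p ht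
    obtain ⟨s, hs⟩ := exists_thetaForm_eq_ofReal (K + 2) (2 * n) (polyOmega A B) ht
    have h := logLam_im ht
    simp only [hf, hω, hr, hs]
    simp [h]
  -- The numerator is `polyOmega A B` at `λ = 0`; the denominator comes from the theta product being
  -- asymptotic to `16 exp(πiz)`.
  · refine ⟨((-A.eval 0 + B.eval 0 : ℝ) : ℂ) / 16 ^ (2 * n), ?_, ?_⟩
    · refine div_ne_zero ?_ (by norm_num)
      rw [Complex.ofReal_ne_zero]
      intro h
      exact hAB (by linarith)
    have h1 : Tendsto (fun t : ℝ ↦ ω (I * t) * Real.exp (-(2 * Real.pi * n * t))) atTop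
        (𝓝 (((-A.eval 0 + B.eval 0 : ℝ) : ℂ) / 16 ^ (2 * n))) := by
      have ha : Tendsto (fun z ↦ Polynomial.aeval (modularLambda z) (polyOmega A B))
          (comap im atTop) (𝓝 (Polynomial.aeval 0 (polyOmega A B))) :=
        (((polyOmega A B).continuous_aeval (A := ℂ)).tendsto 0).comp tendsto_modularLambda
      have hb := ((tendsto_thetaV.pow (K + 2)).mul ha).div
        (((tendsto_thetaU.mul tendsto_thetaV).mul tendsto_thetaW).pow (2 * n)) (by norm_num)
      have hval : Polynomial.aeval (0 : ℂ) (polyOmega A B) = ((-A.eval 0 + B.eval 0 : ℝ) : ℂ) := by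
        have := aeval_ofReal_eq (polyOmega A B) 0
        rw [Complex.ofReal_zero] at this
        rw [this]
        congr 1
        simp [polyOmega]
      rw [hval, one_pow, one_mul, mul_one, mul_one] at hb
      refine (hb.comp tendsto_I_mul_comap_im).congr fun t ↦ ?_
      simp only [Function.comp, hω, thetaForm, Pi.div_apply]
      have e1 : cexp (-(Real.pi * I * (I * t))) ^ (2 * n) =
          ((Real.exp (-(2 * Real.pi * n * t)) : ℝ) : ℂ)⁻¹ := by
        rw [← Complex.exp_nat_mul, Complex.ofReal_exp, ← Complex.exp_neg]
        congr 1
        push_cast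
        linear_combination (-(2 * n : ℂ) * Real.pi * t) * I_mul_I
      have e2 : ((Real.exp (-(2 * Real.pi * n * t)) : ℝ) : ℂ) ≠ 0 := by
        exact_mod_cast (Real.exp_pos _).ne'
      rw [show thetaU (I * t) * cexp (-(Real.pi * I * (I * t))) * thetaV (I * t) * thetaW (I * t) =
        cexp (-(Real.pi * I * (I * t))) * (thetaU (I * t) * thetaV (I * t) * thetaW (I * t)) by ring,
        mul_pow, e1]
      rw [div_mul_eq_mul_div, div_mul_eq_div_div, div_inv_eq_mul]
    have h2 : Tendsto (fun t : ℝ ↦ f (I * t) * logLam (I * t) *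
        Real.exp (-(2 * Real.pi * n * t))) atTop (𝓝 0) := by
      have hl : Tendsto (fun t : ℝ ↦ I * (t : ℂ)) atTop (comap im atTop ⊓ 𝓟 {z | |z.re| ≤ 1}) := by
        refine tendsto_inf.2 ⟨tendsto_I_mul_comap_im, ?_⟩
        rw [tendsto_principal]
        exact Eventually.of_forall fun t ↦ by simp
      have h3 : (fun t : ℝ ↦ ((Real.exp (-(2 * Real.pi * n * t)) : ℝ) : ℂ)) =O[atTop]
          fun t ↦ Real.exp (-(2 * Real.pi * n * t)) :=
        IsBigO.of_bound 1 (Eventually.of_forall fun t ↦ by rw [Complex.norm_real, one_mul])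
      refine ((hflO.comp_tendsto hl).mul h3).trans_tendsto ?_
      have h4 : Tendsto (fun t : ℝ ↦ Real.exp (-(Real.pi * t))) atTop (𝓝 0) :=
        Real.tendsto_exp_neg_atTop_nhds_zero.comp (tendsto_id.const_mul_atTop Real.pi_pos)
      refine h4.congr fun t ↦ ?_
      simp only [Function.comp, im_I_mul]
      rw [← Real.exp_nat_mul, ← Real.exp_add]
      congr 1
      have : ((2 * n - 1 : ℕ) : ℝ) = 2 * n - 1 := by
        rw [Nat.cast_sub (by omega)]; push_cast; ring
      rw [this]; ring
    have h3 := h2.add h1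
    rw [zero_add] at h3
    refine h3.congr fun t ↦ ?_
    ring

end FourierEigen

end

noncomputable section

namespace FourierEigen

open Complex Filter Topology MeasureTheory Set

/-! ### Superpositions of complex Gaussians -/

lemma integrableOn_pow_mul_exp {a : ℝ} (ha : 0 < a) (k : ℕ) :
    IntegrableOn (fun t : ℝ ↦ t ^ k * Real.exp (-(a * t))) (Ioi 0) := by
  have h := integrableOn_rpow_mul_exp_neg_mul_rpow (p := 1) (s := k) (b := a)
    (by linarith [Nat.cast_nonneg (α := ℝ) k]) one_pos ha
  refine h.congr_fun (fun t _ ↦ ?_) measurableSet_Ioi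
  simp

/-- The superposition `∫ w(t) exp(π i s z(t)) dt` over `t > a`. -/
def gaussSuper (a : ℝ) (w z : ℝ → ℂ) (s : ℂ) : ℂ :=
  ∫ t in Ioi a, w t * cexp (Real.pi * I * s * z t)

/-- Bounds on the density `w` and the path `z` that make `gaussSuper a w z` converge. -/
structure GaussData (a : ℝ) (w z : ℝ → ℂ) : Prop where
  half_le : 1 / 2 ≤ a
  continuousOn_w : ContinuousOn w (Ioi a)
  continuousOn_z : ContinuousOn z (Ioi a)
  bound : ∃ C : ℝ, ∀ t, a < t → ‖w t‖ ≤ C * Real.exp (-(Real.pi * t))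
  abs_re_le : ∀ t, a < t → |(z t).re| ≤ 1
  im_le : ∀ t, a < t → (z t).im ≤ t + 2
  le_im : ∀ t, a < t → 1 / (2 * t) ≤ (z t).im

namespace GaussData

variable {a : ℝ} {w z : ℝ → ℂ}

lemma pos (h : GaussData a w z) {t : ℝ} (ht : a < t) : 0 < t := by
  linarith [h.half_le]

lemma im_pos (h : GaussData a w z) {t : ℝ} (ht : a < t) : 0 < (z t).im := by
  have := h.pos ht
  exact lt_of_lt_of_le (by positivity) (h.le_im t ht)

lemma norm_exp_le (h : GaussData a w z) {t : ℝ} (ht : a < t) {s : ℂ} (hs : -(1 / 2) < s.re) :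
    ‖cexp (Real.pi * I * s * z t)‖ ≤
      Real.exp (Real.pi / 2 * (t + 2)) * Real.exp (Real.pi * |s.im|) := by
  rw [Complex.norm_exp, ← Real.exp_add, Real.exp_le_exp]
  have h1 : (Real.pi * I * s * z t).re = -(Real.pi * (s.re * (z t).im + s.im * (z t).re)) := by
    simp; ring
  have h2 : -(s.im * (z t).re) ≤ |s.im| := by
    refine (neg_le_abs _).trans ?_
    rw [abs_mul]
    nlinarith [abs_nonneg s.im, h.abs_re_le t ht]
  have h3 : -(s.re * (z t).im) ≤ 1 / 2 * (t + 2) := by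
    nlinarith [h.im_pos ht, h.im_le t ht]
  rw [h1]
  nlinarith [Real.pi_pos]

lemma norm_le (h : GaussData a w z) {t : ℝ} (ht : a < t) : ‖z t‖ ≤ t + 3 := by
  refine (Complex.norm_le_abs_re_add_abs_im _).trans ?_
  rw [abs_of_pos (h.im_pos ht)]
  linarith [h.abs_re_le t ht, h.im_le t ht]

/-- For `Re s > -1/2` the exponential grows at most like `exp(πt/2)`, which the density's `exp(-πt)`
dominates. The neighbourhood is cut down to a unit ball to keep `|Im s|` bounded. -/
lemma differentiableAt (h : GaussData a w z) {s : ℂ} (hs : -(1 / 2) < s.re) :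
    DifferentiableAt ℂ (gaussSuper a w z) s := by
  obtain ⟨C, hC⟩ := h.bound
  have hmeas : ∀ s : ℂ, AEStronglyMeasurable (fun t ↦ w t * cexp (Real.pi * I * s * z t))
      (volume.restrict (Ioi a)) := fun s ↦
    ((h.continuousOn_w.mul (Complex.continuous_exp.comp_continuousOn
      (continuousOn_const.mul h.continuousOn_z)))).aestronglyMeasurable measurableSet_Ioi
  have hC0 : ∀ t, a < t → 0 ≤ C * Real.exp (-(Real.pi * t)) := fun t ht ↦
    (norm_nonneg _).trans (hC t ht)
  set U : Set ℂ := {s : ℂ | -(1 / 2) < s.re} ∩ Metric.ball s 1 with hU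
  have hUn : U ∈ 𝓝 s := inter_mem ((isOpen_lt continuous_const continuous_re).mem_nhds hs)
    (Metric.ball_mem_nhds _ one_pos)
  have hexp : ∀ t, Real.exp (-(Real.pi * t)) * Real.exp (Real.pi / 2 * (t + 2)) =
      Real.exp Real.pi * Real.exp (-(Real.pi / 2 * t)) := fun t ↦ by
    rw [← Real.exp_add, ← Real.exp_add]; congr 1; ring
  have hb : ∀ t, a < t → ∀ s' ∈ U, ‖w t * cexp (Real.pi * I * s' * z t)‖ ≤
      C * Real.exp Real.pi * Real.exp (Real.pi * (|s.im| + 1)) *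
        Real.exp (-(Real.pi / 2 * t)) := by
    intro t ht s' hs'
    have h1 : |s'.im| ≤ |s.im| + 1 := by
      have h2 : ‖s' - s‖ < 1 := by simpa [dist_eq_norm] using hs'.2
      have h3 := (Complex.abs_im_le_norm (s' - s)).trans h2.le
      rw [Complex.sub_im] at h3
      have := abs_sub_abs_le_abs_sub s'.im s.im
      linarith
    rw [norm_mul]
    calc ‖w t‖ * ‖cexp (Real.pi * I * s' * z t)‖ ≤ (C * Real.exp (-(Real.pi * t))) *
          (Real.exp (Real.pi / 2 * (t + 2)) * Real.exp (Real.pi * (|s.im| + 1))) := by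
          refine mul_le_mul (hC t ht) ((h.norm_exp_le ht hs'.1).trans ?_) (norm_nonneg _) (hC0 t ht)
          have := Real.pi_pos
          gcongr
      _ = C * (Real.exp (-(Real.pi * t)) * Real.exp (Real.pi / 2 * (t + 2))) *
          Real.exp (Real.pi * (|s.im| + 1)) := by ring
      _ = _ := by rw [hexp]; ring
  have hsU : s ∈ U := mem_of_mem_nhds hUn
  have hsub : Ioi a ⊆ Ioi 0 := Ioi_subset_Ioi (by linarith [h.half_le])
  have hi0 := (integrableOn_pow_mul_exp (half_pos Real.pi_pos) 0).mono_set hsub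
  have hi1 := (integrableOn_pow_mul_exp (half_pos Real.pi_pos) 1).mono_set hsub
  simp only [pow_zero, one_mul, pow_one] at hi0 hi1
  set M := C * Real.exp Real.pi * Real.exp (Real.pi * (|s.im| + 1)) with hM
  refine (hasDerivAt_integral_of_dominated_loc_of_deriv_le (μ := volume.restrict (Ioi a))
    (F := fun s t ↦ w t * cexp (Real.pi * I * s * z t))
    (F' := fun s t ↦ w t * cexp (Real.pi * I * s * z t) * (Real.pi * I * z t))
    (bound := fun t ↦ M * Real.pi * (t * Real.exp (-(Real.pi / 2 * t)) +
      3 * Real.exp (-(Real.pi / 2 * t)))) hUn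
    (Eventually.of_forall hmeas) ?_ ?_ ?_ ?_ ?_).2.differentiableAt
  · refine Integrable.mono' (hi0.const_mul M) (hmeas s) ?_
    filter_upwards [ae_restrict_mem measurableSet_Ioi] with t ht
    exact hb t ht s hsU
  · exact (hmeas s).mul
      ((continuousOn_const.mul h.continuousOn_z).aestronglyMeasurable measurableSet_Ioi)
  · filter_upwards [ae_restrict_mem measurableSet_Ioi] with t ht s' hs'
    rw [norm_mul]
    have h1 : ‖(Real.pi : ℂ) * I * z t‖ ≤ Real.pi * (t + 3) := by
      rw [norm_mul, norm_mul, norm_I, Complex.norm_real, Real.norm_of_nonneg Real.pi_pos.le, mul_one]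
      gcongr
      exact h.norm_le ht
    refine (mul_le_mul (hb t ht s' hs') h1 (norm_nonneg _) ?_).trans (le_of_eq ?_)
    · exact (norm_nonneg _).trans (hb t ht s' hs')
    · ring
  · exact (hi1.add (hi0.const_mul 3)).const_mul _
  · refine Eventually.of_forall fun t s' _ ↦ ?_
    have h1 : HasDerivAt (fun s : ℂ ↦ Real.pi * I * s * z t) (Real.pi * I * z t) s' := by
      have := ((hasDerivAt_id s').const_mul (Real.pi * I)).mul_const (z t)
      simpa using this
    have := (h1.cexp).const_mul (w t)
    convert! this using 1
    ring

end GaussData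

/-! ### Fourier transforms of superposed Gaussians -/

section Fourier

variable {V : Type*} [NormedAddCommGroup V] [InnerProductSpace ℝ V] [FiniteDimensional ℝ V]
  [MeasurableSpace V] [BorelSpace V]

lemma re_neg_pi_mul_I (ζ : ℂ) : (-(Real.pi * I * ζ)).re = Real.pi * ζ.im := by simp

lemma integral_norm_gauss {m : ℕ} (hV : Module.finrank ℝ V = 2 * m) {ζ : ℂ} (hζ : 0 < ζ.im) (c : ℂ) :
    ∫ x : V, ‖c * cexp (Real.pi * I * ((‖x‖ ^ 2 : ℝ) : ℂ) * ζ)‖ = ‖c‖ * (1 / ζ.im) ^ m := by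
  have h1 : ∀ x : V, ‖c * cexp (Real.pi * I * ((‖x‖ ^ 2 : ℝ) : ℂ) * ζ)‖ =
      ‖c‖ * Real.exp (-(Real.pi * ζ.im) * ‖x‖ ^ 2) := fun x ↦ by
    rw [norm_mul, Complex.norm_exp]
    congr 2
    rw [show (Real.pi * I * ((‖x‖ ^ 2 : ℝ) : ℂ) * ζ) = ((Real.pi * ‖x‖ ^ 2 : ℝ) : ℂ) * (I * ζ) by
      push_cast; ring, Complex.re_ofReal_mul]
    simp
    ring
  simp_rw [h1]
  rw [integral_const_mul, GaussianFourier.integral_rexp_neg_mul_sq_norm (by positivity), hV]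
  congr 1
  rw [show (((2 * m : ℕ) : ℝ) / 2) = m by push_cast; ring, Real.rpow_natCast]
  congr 1
  have := Real.pi_pos
  field_simp

lemma fourier_gauss {m : ℕ} (hV : Module.finrank ℝ V = 2 * m) {ζ : ℂ} (hζ : 0 < ζ.im) (ξ : V) :
    𝓕 (fun x : V ↦ cexp (Real.pi * I * ((‖x‖ ^ 2 : ℝ) : ℂ) * ζ)) ξ =
      (I / ζ) ^ m * cexp (Real.pi * I * ((‖ξ‖ ^ 2 : ℝ) : ℂ) * (-1 / ζ)) := by
  have hb : 0 < (-(Real.pi * I * ζ)).re := by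
    rw [re_neg_pi_mul_I]; have := Real.pi_pos; positivity
  have hζ0 := ne_zero_of_im_pos hζ
  have hpi : (Real.pi : ℂ) ≠ 0 := by exact_mod_cast Real.pi_ne_zero
  have h := fourier_gaussian_innerProductSpace hb ξ
  rw [hV, show (((2 * m : ℕ) : ℂ) / 2) = m by push_cast; ring, Complex.cpow_natCast] at h
  have h1 : (Real.pi : ℂ) / -(Real.pi * I * ζ) = I / ζ := by
    field_simp
    rw [I_sq]
  rw [h1] at h
  convert! h using 2
  · ext x
    congr 1
    push_cast
    ring
  · congr 1
    push_cast
    field_simp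
    rw [I_sq]
    ring

namespace GaussData

variable {a : ℝ} {w z : ℝ → ℂ}

/-- The Gaussian has `L¹` norm `(Im z)^(-m) ≤ (2t)^m`, and the decay of the density absorbs this
power; this is the purpose of the lower bound on `Im z` in `GaussData`. -/
lemma integrable_prod (h : GaussData a w z) {m : ℕ} (hV : Module.finrank ℝ V = 2 * m) :
    Integrable (fun q : ℝ × V ↦ w q.1 * cexp (Real.pi * I * ((‖q.2‖ ^ 2 : ℝ) : ℂ) * z q.1))
      ((volume.restrict (Ioi a)).prod volume) := by
  obtain ⟨C, hC⟩ := h.bound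
  have hmeas : AEStronglyMeasurable
      (fun q : ℝ × V ↦ w q.1 * cexp (Real.pi * I * ((‖q.2‖ ^ 2 : ℝ) : ℂ) * z q.1))
      ((volume.restrict (Ioi a)).prod volume) := by
    have h1 : (volume.restrict (Ioi a)).prod (volume : Measure V) =
        ((volume : Measure ℝ).prod volume).restrict (Ioi a ×ˢ univ) := by
      rw [← Measure.prod_restrict, Measure.restrict_univ]
    rw [h1]
    refine ContinuousOn.aestronglyMeasurable ?_ (measurableSet_Ioi.prod MeasurableSet.univ)
    have hw : ContinuousOn (fun q : ℝ × V ↦ w q.1) (Ioi a ×ˢ univ) :=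
      h.continuousOn_w.comp continuousOn_fst fun q hq ↦ hq.1
    have hz : ContinuousOn (fun q : ℝ × V ↦ z q.1) (Ioi a ×ˢ univ) :=
      h.continuousOn_z.comp continuousOn_fst fun q hq ↦ hq.1
    refine hw.mul (Complex.continuous_exp.comp_continuousOn (ContinuousOn.mul ?_ hz))
    refine Continuous.continuousOn ?_
    fun_prop
  rw [integrable_prod_iff hmeas]
  refine ⟨?_, ?_⟩
  · filter_upwards [ae_restrict_mem measurableSet_Ioi] with t ht
    have hb : 0 < (-(Real.pi * I * z t)).re := by
      rw [re_neg_pi_mul_I]; have := Real.pi_pos; have := h.im_pos ht; positivity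
    have h1 := (GaussianFourier.integrable_cexp_neg_mul_sq_norm_add hb 0 (0 : V)).const_mul (w t)
    refine h1.congr (Eventually.of_forall fun x ↦ ?_)
    simp only
    congr 2
    push_cast
    ring
  · have hi := ((integrableOn_pow_mul_exp Real.pi_pos m).mono_set
      (Ioi_subset_Ioi (by linarith [h.half_le] : (0 : ℝ) ≤ a))).const_mul (C * 2 ^ m)
    refine Integrable.mono' hi hmeas.norm.integral_prod_right' ?_
    filter_upwards [ae_restrict_mem measurableSet_Ioi] with t ht
    rw [integral_norm_gauss hV (h.im_pos ht)]
    have ht0 := h.pos ht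
    have him := h.im_pos ht
    have h1 : 1 / (z t).im ≤ 2 * t := by
      have := h.le_im t ht
      rw [div_le_iff₀ (by positivity)] at this ⊢
      linarith
    rw [Real.norm_of_nonneg (by positivity)]
    calc ‖w t‖ * (1 / (z t).im) ^ m ≤ (C * Real.exp (-(Real.pi * t))) * (2 * t) ^ m := by
          refine mul_le_mul (hC t ht) ?_ (by positivity) ((norm_nonneg _).trans (hC t ht))
          gcongr
      _ = _ := by rw [mul_pow]; ring

lemma integrable_comp_norm_sq (h : GaussData a w z) {m : ℕ} (hV : Module.finrank ℝ V = 2 * m) :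
    Integrable (fun x : V ↦ gaussSuper a w z ((‖x‖ ^ 2 : ℝ) : ℂ)) :=
  (h.integrable_prod hV).integral_prod_right

lemma fourier_comp_norm_sq (h : GaussData a w z) {m : ℕ} (hV : Module.finrank ℝ V = 2 * m) (ξ : V) :
    𝓕 (fun x : V ↦ gaussSuper a w z ((‖x‖ ^ 2 : ℝ) : ℂ)) ξ =
      ∫ t in Ioi a, w t * ((I / z t) ^ m * cexp (Real.pi * I * ((‖ξ‖ ^ 2 : ℝ) : ℂ) * (-1 / z t))) := by
  rw [Real.fourier_eq']
  simp only [gaussSuper, smul_eq_mul, ← integral_const_mul]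
  rw [integral_integral_swap]
  · refine setIntegral_congr_fun measurableSet_Ioi fun t ht ↦ ?_
    rw [← fourier_gauss hV (h.im_pos ht) ξ, Real.fourier_eq', ← integral_const_mul]
    refine integral_congr_ae (Eventually.of_forall fun x ↦ ?_)
    simp only [smul_eq_mul]
    ring
  · have h1 := (h.integrable_prod hV).swap
    refine (h1.bdd_mul (f := fun q : V × ℝ ↦ cexp (((-2 * Real.pi * inner ℝ q.1 ξ : ℝ) : ℂ) * I))
      (c := 1) ?_ ?_)
    · refine Continuous.aestronglyMeasurable ?_
      fun_prop
    · refine Eventually.of_forall fun q ↦ ?_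
      rw [Complex.norm_exp_ofReal_mul_I]

end GaussData

end Fourier

end FourierEigen

end

noncomputable section

namespace FourierEigen

open Complex Filter Topology MeasureTheory Set

/-! ### The holomorphic continuation -/

/-- The density `i v ^ (-κ - 2) ψS(v)` obtained from `ψ(z) dz` by `z = -1 / v`. -/
def kerW (κ : ℕ) (ψS : ℂ → ℂ) (v : ℂ) : ℂ := I * ψS v / v ^ (κ + 2)

/-- The contribution of the path `2 c - 1 / (c + i t)`, `t > a`. -/
def arcPart (κ : ℕ) (ψS : ℂ → ℂ) (a c : ℝ) : ℂ → ℂ :=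
  gaussSuper a (fun t ↦ kerW κ ψS (c + I * t)) (fun t ↦ 2 * c - 1 / (c + I * t))

/-- The contribution of the path `i t`, `t > 1`. -/
def rayPart (ψS : ℂ → ℂ) : ℂ → ℂ := gaussSuper 1 (fun t ↦ I * ψS (I * t)) (fun t ↦ I * t)

/-- The holomorphic continuation of `-4 sin(π s / 2) ^ 2 ∫ ψ(i t) exp(-π s t) dt`. -/
def contU (κ : ℕ) (ψS : ℂ → ℂ) (s : ℂ) : ℂ :=
  I * (arcPart κ ψS (1 / 2) (-(1 / 2)) s + arcPart κ ψS (1 / 2) (1 / 2) s -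
    2 * arcPart κ ψS 1 0 s + 2 * rayPart ψS s)

lemma line_im (c t : ℝ) : ((c : ℂ) + I * t).im = t := by simp

lemma line_re (c t : ℝ) : ((c : ℂ) + I * t).re = c := by simp

lemma normSq_line (c t : ℝ) : normSq ((c : ℂ) + I * t) = c ^ 2 + t ^ 2 := by
  rw [normSq_apply, line_im, line_re]; ring

lemma le_norm_line (c : ℝ) {t : ℝ} (ht : 0 < t) : t ≤ ‖(c : ℂ) + I * t‖ := by
  have := Complex.abs_im_le_norm ((c : ℂ) + I * t)
  rwa [line_im, abs_of_pos ht] at this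

lemma im_arc (c t : ℝ) : (2 * (c : ℂ) - 1 / (c + I * t)).im = t / (c ^ 2 + t ^ 2) := by
  have h : (2 * (c : ℂ)).im = 0 := by simp
  rw [Complex.sub_im, h, one_div, Complex.inv_im, normSq_line, line_im]; ring

lemma re_arc (c t : ℝ) : (2 * (c : ℂ) - 1 / (c + I * t)).re = c * (2 - 1 / (c ^ 2 + t ^ 2)) := by
  have h : (2 * (c : ℂ)).re = 2 * c := by simp
  rw [Complex.sub_re, h, one_div, Complex.inv_re, normSq_line, line_re]; ring

/-- The arcs approach real points, but in the parameter `v = c + it` the decay of `ψS` along a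
vertical line compensates for the degenerating Gaussians. -/
lemma gaussData_arc {κ n : ℕ} {f ψ ψS : ℂ → ℂ} (hk : LaplaceKernel κ n f ψ ψS) {a c : ℝ}
    (ha : 1 / 2 ≤ a) (hc : |c| ≤ 1 / 2) :
    GaussData a (fun t ↦ kerW κ ψS (c + I * t)) (fun t ↦ 2 * c - 1 / (c + I * t)) := by
  obtain ⟨C, hC⟩ := hk.bound_S
  have hne : ∀ t ∈ Ioi a, (c : ℂ) + I * t ≠ 0 := fun t ht ↦ by
    have : a < t := ht
    exact ne_zero_of_im_pos (by rw [line_im]; linarith)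
  have hl : Continuous fun t : ℝ ↦ (c : ℂ) + I * t := by fun_prop
  have hc2 : c ^ 2 ≤ 1 / 4 := by
    rw [← sq_abs]; nlinarith [abs_nonneg c]
  refine ⟨ha, ?_, ?_, ⟨C * 2 ^ (κ + 2), fun t ht ↦ ?_⟩, fun t ht ↦ ?_, fun t ht ↦ ?_, fun t ht ↦ ?_⟩
  · refine ContinuousOn.div (continuousOn_const.mul ?_) (by fun_prop)
      fun t ht ↦ pow_ne_zero _ (hne t ht)
    intro t ht
    have hpos : 0 < ((c : ℂ) + I * t).im := by
      have : a < t := ht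
      rw [line_im]; linarith
    exact (ContinuousAt.comp (f := fun t : ℝ ↦ (c : ℂ) + I * t)
      (hk.differentiableAt_S _ hpos).continuousAt hl.continuousAt).continuousWithinAt
  · exact continuousOn_const.sub (continuousOn_const.div hl.continuousOn hne)
  · have h1 := hC (c + I * t) (by rw [line_im]; linarith)
    rw [line_im] at h1
    have h2 : 1 / 2 ≤ ‖(c : ℂ) + I * t‖ := by
      have := le_norm_line c (t := t) (by linarith); linarith
    rw [kerW, norm_div, norm_mul, norm_I, one_mul, norm_pow, div_le_iff₀ (by positivity)]
    have h3 : 1 ≤ 2 ^ (κ + 2) * ‖(c : ℂ) + I * t‖ ^ (κ + 2) := by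
      rw [← mul_pow]
      exact one_le_pow₀ (by linarith)
    have h4 := (norm_nonneg _).trans h1
    calc ‖ψS (c + I * t)‖ ≤ C * Real.exp (-(Real.pi * t)) * 1 := by rw [mul_one]; exact h1
      _ ≤ C * Real.exp (-(Real.pi * t)) * (2 ^ (κ + 2) * ‖(c : ℂ) + I * t‖ ^ (κ + 2)) := by gcongr
      _ = _ := by ring
  · rw [re_arc, abs_mul]
    have h1 : 1 / 4 ≤ c ^ 2 + t ^ 2 := by nlinarith [sq_nonneg c]
    have h2 : |2 - 1 / (c ^ 2 + t ^ 2)| ≤ 2 := by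
      have h3 : 1 / (c ^ 2 + t ^ 2) ≤ 4 := by
        rw [div_le_iff₀ (by linarith)]; linarith
      have h4 : 0 ≤ 1 / (c ^ 2 + t ^ 2) := by positivity
      rw [abs_le]; constructor <;> linarith
    nlinarith [abs_nonneg c, abs_nonneg (2 - 1 / (c ^ 2 + t ^ 2))]
  · rw [im_arc]
    have h0 : 0 < c ^ 2 + t ^ 2 := by nlinarith [sq_nonneg c]
    rw [div_le_iff₀ h0]
    nlinarith [sq_nonneg c]
  · rw [im_arc]
    have h0 : 0 < c ^ 2 + t ^ 2 := by nlinarith [sq_nonneg c]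
    rw [div_le_div_iff₀ (by linarith) h0]
    nlinarith [sq_nonneg c]

lemma gaussData_ray {κ n : ℕ} {f ψ ψS : ℂ → ℂ} (hk : LaplaceKernel κ n f ψ ψS) :
    GaussData 1 (fun t ↦ I * ψS (I * t)) (fun t ↦ I * t) := by
  obtain ⟨C, hC⟩ := hk.bound_S
  refine ⟨by norm_num, ?_, by fun_prop, ⟨C, fun t ht ↦ ?_⟩, fun t ht ↦ ?_, fun t ht ↦ ?_,
    fun t ht ↦ ?_⟩
  · refine continuousOn_const.mul fun t ht ↦ ?_
    have hpos : 0 < (I * (t : ℂ)).im := by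
      have : 1 < t := ht
      rw [im_I_mul]; linarith
    exact (ContinuousAt.comp (f := fun t : ℝ ↦ I * (t : ℂ))
      (hk.differentiableAt_S _ hpos).continuousAt (by fun_prop)).continuousWithinAt
  · have h1 := hC (I * t) (by rw [im_I_mul]; linarith)
    rw [im_I_mul] at h1
    rwa [norm_mul, norm_I, one_mul]
  · simp
  · rw [im_I_mul]; linarith
  · rw [im_I_mul, div_le_iff₀ (by linarith)]
    nlinarith

lemma differentiableAt_contU {κ n : ℕ} {f ψ ψS : ℂ → ℂ} (hk : LaplaceKernel κ n f ψ ψS) {s : ℂ}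
    (hs : -(1 / 2) < s.re) : DifferentiableAt ℂ (contU κ ψS) s := by
  have h1 := (gaussData_arc hk (a := 1 / 2) (c := -(1 / 2)) le_rfl
    (by rw [abs_neg, abs_of_pos]; norm_num)).differentiableAt hs
  have h2 := (gaussData_arc hk (a := 1 / 2) (c := 1 / 2) le_rfl
    (by rw [abs_of_pos]; norm_num)).differentiableAt hs
  have h3 := (gaussData_arc hk (a := 1) (c := 0) (by norm_num) (by norm_num)).differentiableAt hs
  have h4 := (gaussData_ray hk).differentiableAt hs
  exact ((((h1.add h2).sub (h3.const_mul 2)).add (h4.const_mul 2))).const_mul I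

/-! ### The eigenfunction property -/

section Fourier

variable {V : Type*} [NormedAddCommGroup V] [InnerProductSpace ℝ V] [FiniteDimensional ℝ V]
  [MeasurableSpace V] [BorelSpace V]

lemma I_div_pow {κ e : ℕ} (he : κ + 2 = 2 * e) (ζ : ℂ) :
    (I / ζ) ^ (κ + 2) = (-1) ^ e / ζ ^ (κ + 2) := by
  rw [div_pow]
  congr 1
  rw [he, pow_mul, I_sq]

/-- `z ↦ -1/z` carries the segment between `0` and `i` to the ray above `i`, and `(i/z)^(κ+2)`
cancels the power of `v` in the density. -/
lemma fourier_arcPart_zero {κ n e : ℕ} {f ψ ψS : ℂ → ℂ} (hk : LaplaceKernel κ n f ψ ψS)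
    (he : κ + 2 = 2 * e) (hV : Module.finrank ℝ V = 2 * (κ + 2)) (ξ : V) :
    𝓕 (fun x : V ↦ arcPart κ ψS 1 0 ((‖x‖ ^ 2 : ℝ) : ℂ)) ξ =
      (-1) ^ e * rayPart ψS ((‖ξ‖ ^ 2 : ℝ) : ℂ) := by
  have h := (gaussData_arc hk (a := 1) (c := 0) (by norm_num) (by norm_num)).fourier_comp_norm_sq
    hV ξ
  refine h.trans ?_
  rw [rayPart, gaussSuper, ← integral_const_mul]
  refine setIntegral_congr_fun measurableSet_Ioi fun t ht ↦ ?_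
  have ht0 : (t : ℂ) ≠ 0 := by
    have : (1 : ℝ) < t := ht
    exact_mod_cast (by linarith : t ≠ 0)
  simp only [ofReal_zero, mul_zero, zero_add, zero_sub]
  have hz : (I * (t : ℂ)) ≠ 0 := mul_ne_zero I_ne_zero ht0
  rw [I_div_pow he, kerW, show -1 / (-(1 / (I * (t : ℂ)))) = I * t by field_simp,
    (even_iff_two_dvd.2 ⟨e, he⟩).neg_pow, div_pow, one_pow]
  field_simp

lemma fourier_rayPart {κ n e : ℕ} {f ψ ψS : ℂ → ℂ} (hk : LaplaceKernel κ n f ψ ψS)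
    (he : κ + 2 = 2 * e) (hV : Module.finrank ℝ V = 2 * (κ + 2)) (ξ : V) :
    𝓕 (fun x : V ↦ rayPart ψS ((‖x‖ ^ 2 : ℝ) : ℂ)) ξ =
      (-1) ^ e * arcPart κ ψS 1 0 ((‖ξ‖ ^ 2 : ℝ) : ℂ) := by
  have h := (gaussData_ray hk).fourier_comp_norm_sq hV ξ
  refine h.trans ?_
  rw [arcPart, gaussSuper, ← integral_const_mul]
  refine setIntegral_congr_fun measurableSet_Ioi fun t ht ↦ ?_
  simp only [ofReal_zero, mul_zero, zero_add, zero_sub]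
  rw [I_div_pow he, kerW, neg_div]
  ring

/-- With `v` on `Re v = -1/2`, the image of `-1 - 1/v` under `z ↦ -1/z` is `1 - 1/(v+1)`. So the arc
at `-1` becomes the arc at `1`, with a sign from `ψS(v+1) = -ψS(v)`. -/
lemma fourier_arcPart_neg {κ n e : ℕ} {f ψ ψS : ℂ → ℂ} (hk : LaplaceKernel κ n f ψ ψS)
    (he : κ + 2 = 2 * e) (hV : Module.finrank ℝ V = 2 * (κ + 2)) (ξ : V) :
    𝓕 (fun x : V ↦ arcPart κ ψS (1 / 2) (-(1 / 2)) ((‖x‖ ^ 2 : ℝ) : ℂ)) ξ =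
      -((-1) ^ e * arcPart κ ψS (1 / 2) (1 / 2) ((‖ξ‖ ^ 2 : ℝ) : ℂ)) := by
  have h := (gaussData_arc hk (a := 1 / 2) (c := -(1 / 2)) le_rfl
    (by rw [abs_neg, abs_of_pos]; norm_num)).fourier_comp_norm_sq hV ξ
  refine h.trans ?_
  rw [arcPart, gaussSuper, ← integral_const_mul, ← integral_neg]
  refine setIntegral_congr_fun measurableSet_Ioi fun t ht ↦ ?_
  have ht0 : 0 < t := by
    have : (1 / 2 : ℝ) < t := ht
    linarith
  set v : ℂ := ((-(1 / 2) : ℝ) : ℂ) + I * t with hv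
  have hvi : 0 < v.im := by rw [hv, line_im]; exact ht0
  have hv0 := ne_zero_of_im_pos hvi
  have hv1 : v + 1 ≠ 0 := ne_zero_of_im_pos (by simpa using hvi)
  have e1 : ((1 / 2 : ℝ) : ℂ) + I * t = v + 1 := by rw [hv]; push_cast; ring
  have e2 : 2 * ((-(1 / 2) : ℝ) : ℂ) - 1 / v = -((v + 1) / v) := by
    push_cast; field_simp; ring
  have e3 : 2 * ((1 / 2 : ℝ) : ℂ) - 1 / (v + 1) = -1 / (-((v + 1) / v)) := by
    push_cast; field_simp; ring
  rw [e1, e2, e3, kerW, kerW, hk.S_add_one v hvi, I_div_pow he,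
    (even_iff_two_dvd.2 ⟨e, he⟩).neg_pow, div_pow]
  field_simp

lemma fourier_arcPart_pos {κ n e : ℕ} {f ψ ψS : ℂ → ℂ} (hk : LaplaceKernel κ n f ψ ψS)
    (he : κ + 2 = 2 * e) (hV : Module.finrank ℝ V = 2 * (κ + 2)) (ξ : V) :
    𝓕 (fun x : V ↦ arcPart κ ψS (1 / 2) (1 / 2) ((‖x‖ ^ 2 : ℝ) : ℂ)) ξ =
      -((-1) ^ e * arcPart κ ψS (1 / 2) (-(1 / 2)) ((‖ξ‖ ^ 2 : ℝ) : ℂ)) := by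
  have h := (gaussData_arc hk (a := 1 / 2) (c := 1 / 2) le_rfl
    (by rw [abs_of_pos]; norm_num)).fourier_comp_norm_sq hV ξ
  refine h.trans ?_
  rw [arcPart, gaussSuper, ← integral_const_mul, ← integral_neg]
  refine setIntegral_congr_fun measurableSet_Ioi fun t ht ↦ ?_
  have ht0 : 0 < t := by
    have : (1 / 2 : ℝ) < t := ht
    linarith
  set v : ℂ := ((-(1 / 2) : ℝ) : ℂ) + I * t with hv
  have hvi : 0 < v.im := by rw [hv, line_im]; exact ht0
  have hv0 := ne_zero_of_im_pos hvi
  have hv1 : v + 1 ≠ 0 := ne_zero_of_im_pos (by simpa using hvi)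
  have e1 : ((1 / 2 : ℝ) : ℂ) + I * t = v + 1 := by rw [hv]; push_cast; ring
  have e2 : 2 * ((1 / 2 : ℝ) : ℂ) - 1 / (v + 1) = v / (v + 1) := by
    push_cast; field_simp; ring
  have e3 : 2 * ((-(1 / 2) : ℝ) : ℂ) - 1 / v = -1 / (v / (v + 1)) := by
    push_cast; field_simp; ring
  rw [e1, e2, e3, kerW, kerW, hk.S_add_one v hvi, I_div_pow he, div_pow]
  field_simp

/-- `x ↦ contU κ ψS ‖x‖²` is an eigenfunction of the Fourier transform. -/
lemma fourier_contU {κ n e : ℕ} {f ψ ψS : ℂ → ℂ} (hk : LaplaceKernel κ n f ψ ψS)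
    (he : κ + 2 = 2 * e) (hV : Module.finrank ℝ V = 2 * (κ + 2)) (ξ : V) :
    𝓕 (fun x : V ↦ contU κ ψS ((‖x‖ ^ 2 : ℝ) : ℂ)) ξ =
      (-1) ^ (e + 1) * contU κ ψS ((‖ξ‖ ^ 2 : ℝ) : ℂ) := by
  have i1 := (gaussData_arc hk (a := 1 / 2) (c := -(1 / 2)) le_rfl
    (by rw [abs_neg, abs_of_pos]; norm_num)).integrable_comp_norm_sq hV
  have i2 := (gaussData_arc hk (a := 1 / 2) (c := 1 / 2) le_rfl
    (by rw [abs_of_pos]; norm_num)).integrable_comp_norm_sq hV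
  have i3 := (gaussData_arc hk (a := 1) (c := 0) (by norm_num) (by norm_num)).integrable_comp_norm_sq hV
  have i4 := (gaussData_ray hk).integrable_comp_norm_sq hV
  have key : ∀ g : V → ℂ, Integrable g →
      Integrable (fun x : V ↦ cexp (((-2 * Real.pi * inner ℝ x ξ : ℝ) : ℂ) * I) • g x) := by
    intro g hg
    refine hg.bdd_mul (c := 1) (Continuous.aestronglyMeasurable (by fun_prop))
      (Eventually.of_forall fun x ↦ ?_)
    rw [Complex.norm_exp_ofReal_mul_I]
  have f1 := fourier_arcPart_neg hk he hV ξ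
  have f2 := fourier_arcPart_pos hk he hV ξ
  have f3 := fourier_arcPart_zero hk he hV ξ
  have f4 := fourier_rayPart hk he hV ξ
  rw [Real.fourier_eq'] at f1 f2 f3 f4 ⊢
  have hsplit : ∀ x : V, cexp (((-2 * Real.pi * inner ℝ x ξ : ℝ) : ℂ) * I) •
      contU κ ψS ((‖x‖ ^ 2 : ℝ) : ℂ) =
      I * (cexp (((-2 * Real.pi * inner ℝ x ξ : ℝ) : ℂ) * I) •
          arcPart κ ψS (1 / 2) (-(1 / 2)) ((‖x‖ ^ 2 : ℝ) : ℂ) +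
        cexp (((-2 * Real.pi * inner ℝ x ξ : ℝ) : ℂ) * I) •
          arcPart κ ψS (1 / 2) (1 / 2) ((‖x‖ ^ 2 : ℝ) : ℂ) -
        2 * (cexp (((-2 * Real.pi * inner ℝ x ξ : ℝ) : ℂ) * I) •
          arcPart κ ψS 1 0 ((‖x‖ ^ 2 : ℝ) : ℂ)) +
        2 * (cexp (((-2 * Real.pi * inner ℝ x ξ : ℝ) : ℂ) * I) •
          rayPart ψS ((‖x‖ ^ 2 : ℝ) : ℂ))) := fun x ↦ by
    simp only [contU, smul_eq_mul]; ring
  simp_rw [hsplit]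
  rw [integral_const_mul, integral_add, integral_sub, integral_add, integral_const_mul,
    integral_const_mul, f1, f2, f3, f4, contU]
  · rw [pow_succ]; ring
  · exact key _ i1
  · exact key _ i2
  · exact (key _ i1).add (key _ i2)
  · exact (key _ i3).const_mul 2
  · exact ((key _ i1).add (key _ i2)).sub ((key _ i3).const_mul 2)
  · exact (key _ i4).const_mul 2

end Fourier

end FourierEigen

end

noncomputable section

namespace FourierEigen

open Complex Filter Topology MeasureTheory Set

/-! ### The Laplace transform of the kernel -/

lemma hasDerivAt_line (c t : ℝ) : HasDerivAt (fun t : ℝ ↦ (c : ℂ) + I * t) I t := by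
  have h := ((Complex.ofRealCLM.hasDerivAt (x := t)).const_mul I).const_add (c : ℂ)
  simpa using h

/-- Integrals of an exponentially decaying holomorphic function along vertical half-lines in terms
of a primitive, whose limit at `i∞` does not depend on the line. -/
lemma exists_limit_vertical {g G : ℂ → ℂ} (hG : ∀ z : ℂ, 0 < z.im → HasDerivAt G (g z) z)
    (hg : ∀ z : ℂ, 0 < z.im → ContinuousAt g z) {C δ : ℝ} (hδ : 0 < δ)
    (hb : ∀ z : ℂ, 1 / 2 ≤ z.im → |z.re| ≤ 1 → ‖g z‖ ≤ C * Real.exp (-(δ * z.im))) :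
    ∃ L : ℂ, ∀ c : ℝ, |c| ≤ 1 → Tendsto (fun t : ℝ ↦ G (c + I * t)) atTop (𝓝 L) ∧
      ∀ a : ℝ, 1 / 2 ≤ a → IntegrableOn (fun t : ℝ ↦ I * g (c + I * t)) (Ioi a) ∧
        ∫ t in Ioi a, I * g (c + I * t) = L - G (c + I * a) := by
  have hder : ∀ c t : ℝ, 0 < t → HasDerivAt (fun t : ℝ ↦ G (c + I * t)) (I * g (c + I * t)) t := by
    intro c t ht
    have h1 := (hG (c + I * t) (by rw [line_im]; exact ht)).comp_of_eq t (hasDerivAt_line c t) rfl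
    rw [mul_comm]
    exact h1
  have hint : ∀ c a : ℝ, |c| ≤ 1 → 1 / 2 ≤ a →
      IntegrableOn (fun t : ℝ ↦ I * g (c + I * t)) (Ioi a) := by
    intro c a hc ha
    have hi := ((integrableOn_pow_mul_exp hδ 0).mono_set
      (Ioi_subset_Ioi (by linarith : (0 : ℝ) ≤ a))).const_mul C
    refine Integrable.mono' hi (ContinuousOn.aestronglyMeasurable ?_ measurableSet_Ioi) ?_
    · intro t ht
      have ht' : a < t := ht
      exact (continuousAt_const.mul (ContinuousAt.comp (f := fun t : ℝ ↦ (c : ℂ) + I * t)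
        (hg _ (by rw [line_im]; linarith)) (by fun_prop))).continuousWithinAt
    · filter_upwards [ae_restrict_mem measurableSet_Ioi] with t ht
      have ht' : a < t := ht
      have := hb (c + I * t) (by rw [line_im]; linarith) (by rw [line_re]; exact hc)
      rw [line_im] at this
      simpa using this
  have hlim : ∀ c : ℝ, |c| ≤ 1 → ∃ L, Tendsto (fun t : ℝ ↦ G (c + I * t)) atTop (𝓝 L) :=
    fun c hc ↦ ⟨_, tendsto_limUnder_of_hasDerivAt_of_integrableOn_Ioi
      (fun t ht ↦ hder c t (by have : (1 / 2 : ℝ) < t := ht; linarith)) (hint c (1 / 2) hc le_rfl)⟩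
  obtain ⟨L, hL⟩ := hlim 0 (by simp)
  refine ⟨L, fun c hc ↦ ?_⟩
  have hlc : Tendsto (fun t : ℝ ↦ G (c + I * t)) atTop (𝓝 L) := by
    -- The horizontal distance is bounded while the derivative decays, so `G` has the same limit
    -- along every vertical line.
    have h0 : Tendsto (fun t : ℝ ↦ G (c + I * t) - G ((0 : ℝ) + I * t)) atTop (𝓝 0) := by
      have hexp : Tendsto (fun t : ℝ ↦ C * Real.exp (-(δ * t)) * |c|) atTop (𝓝 0) := by
        have h1 : Tendsto (fun t : ℝ ↦ Real.exp (-(δ * t))) atTop (𝓝 0) :=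
          Real.tendsto_exp_neg_atTop_nhds_zero.comp (tendsto_id.const_mul_atTop hδ)
        have := (h1.const_mul C).mul_const |c|
        simpa using this
      refine squeeze_zero_norm' ?_ hexp
      filter_upwards [eventually_ge_atTop (1 / 2)] with t ht
      have hconv : Convex ℝ ({z : ℂ | z.im = t} ∩ {z | |z.re| ≤ 1}) := by
        have e1 : Convex ℝ {z : ℂ | z.im = t} := by
          intro x hx y hy a b _ _ hab
          have hx' : x.im = t := hx
          have hy' : y.im = t := hy
          change (a • x + b • y).im = t
          simp [hx', hy', ← add_mul, hab]
        have e2 : Convex ℝ {z : ℂ | |z.re| ≤ 1} := by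
          have : {z : ℂ | |z.re| ≤ 1} = {z : ℂ | -1 ≤ z.re} ∩ {z : ℂ | z.re ≤ 1} := by
            ext z; simp [abs_le]
          rw [this]
          exact (convex_halfSpace_re_ge (-1)).inter (convex_halfSpace_re_le 1)
        exact e1.inter e2
      have h1 := hconv.norm_image_sub_le_of_norm_hasDerivWithin_le (f := G) (f' := g)
        (C := C * Real.exp (-(δ * t))) (x := ((0 : ℝ) : ℂ) + I * t) (y := c + I * t)
        (fun z hz ↦ (hG z (by have h := hz.1; change z.im = t at h; linarith)).hasDerivWithinAt)
        (fun z hz ↦ by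
          have h := hz.1
          change z.im = t at h
          rw [← h]
          exact hb z (by linarith) hz.2)
        ⟨line_im _ _, show |(((0 : ℝ) : ℂ) + I * t).re| ≤ 1 by rw [line_re]; simp⟩
        ⟨line_im _ _, show |((c : ℂ) + I * t).re| ≤ 1 by rw [line_re]; exact hc⟩
      refine h1.trans (le_of_eq ?_)
      congr 1
      simp
    have := h0.add hL
    simpa using this
  refine ⟨hlc, fun a ha ↦ ⟨hint c a hc ha, ?_⟩⟩
  exact integral_Ioi_of_hasDerivAt_of_tendsto'
    (fun t ht ↦ hder c t (by have : a ≤ t := ht; linarith)) (hint c a hc ha) hlc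

/-! ### Contour shift: the continuation agrees with the Laplace transform -/

section Kernel

variable {κ n : ℕ} {f ψ ψS : ℂ → ℂ}

/-- For `t ≥ 1` this is the growth bound. For `t ≤ 1` the inversion gives `ψ(it) = O(exp(-π/t))`,
which is below every power of `t`. -/
lemma LaplaceKernel.exists_norm_le (hk : LaplaceKernel κ n f ψ ψS) (k : ℕ) :
    ∃ C : ℝ, 0 ≤ C ∧ ∀ t : ℝ, 0 < t →
      ‖ψ (I * t)‖ ≤ C * (t ^ k * Real.exp (2 * Real.pi * n * t)) := by
  obtain ⟨C₁, hC₁⟩ := hk.bound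
  obtain ⟨C₂, hC₂⟩ := hk.bound_S
  refine ⟨max (max C₁ 0) (max C₂ 0 * k.factorial), le_max_of_le_left (le_max_right _ _),
    fun t ht ↦ ?_⟩
  have hpi := Real.pi_pos
  rcases le_total 1 t with h1 | h1
  · have h2 := hC₁ (I * t) (by rw [im_I_mul]; linarith) (by simp)
    rw [im_I_mul] at h2
    have h3 : 1 ≤ t ^ k := one_le_pow₀ h1
    calc ‖ψ (I * t)‖ ≤ C₁ * (1 * Real.exp (2 * Real.pi * n * t)) := by rw [one_mul]; exact h2
      _ ≤ _ := by
        gcongr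
        exact (le_max_left _ _).trans (le_max_left _ _)
  · have hz : 0 < (I * ((t⁻¹ : ℝ) : ℂ)).im := by rw [im_I_mul]; positivity
    have h2 := hk.slash _ hz
    rw [neg_one_div_I_mul, inv_inv] at h2
    have ht1 : 1 ≤ t⁻¹ := (one_le_inv₀ ht).2 h1
    have h3 := hC₂ (I * ((t⁻¹ : ℝ) : ℂ)) (by rw [im_I_mul]; linarith)
    rw [im_I_mul, ← h2, norm_mul, norm_pow, norm_mul, norm_I, one_mul, Complex.norm_real,
      Real.norm_of_nonneg (by positivity)] at h3
    have h4 : 1 ≤ t⁻¹ ^ κ := one_le_pow₀ ht1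
    have h5 : ‖ψ (I * t)‖ ≤ C₂ * Real.exp (-(Real.pi * t⁻¹)) :=
      (le_mul_of_one_le_left (norm_nonneg _) h4).trans h3
    have h6 : Real.exp (-(Real.pi * t⁻¹)) ≤ k.factorial * t ^ k := by
      have e1 := Real.pow_div_factorial_le_exp (Real.pi * t⁻¹) (by positivity) k
      have e2 : t⁻¹ ^ k ≤ (Real.pi * t⁻¹) ^ k := by
        gcongr
        exact le_mul_of_one_le_left (by positivity) (by linarith [Real.pi_gt_three])
      have hkf : (0 : ℝ) < k.factorial := by exact_mod_cast k.factorial_pos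
      have e3 : t⁻¹ ^ k / k.factorial ≤ Real.exp (Real.pi * t⁻¹) :=
        (div_le_div_of_nonneg_right e2 hkf.le).trans e1
      rw [Real.exp_neg, inv_le_comm₀ (Real.exp_pos _) (by positivity)]
      refine le_trans (le_of_eq ?_) e3
      rw [mul_inv, inv_pow]
      ring
    have h7 : 1 ≤ Real.exp (2 * Real.pi * n * t) := Real.one_le_exp (by positivity)
    calc ‖ψ (I * t)‖ ≤ max C₂ 0 * Real.exp (-(Real.pi * t⁻¹)) :=
          h5.trans (by gcongr; exact le_max_left _ _)
      _ ≤ max C₂ 0 * (k.factorial * t ^ k) := by gcongr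
      _ = (max C₂ 0 * k.factorial) * (t ^ k * 1) := by ring
      _ ≤ _ := by
        gcongr
        exact le_max_right _ _

lemma norm_exp_laplace (s : ℂ) (t : ℝ) :
    ‖cexp (Real.pi * I * s * (I * t))‖ = Real.exp (-(Real.pi * s.re * t)) := by
  rw [Complex.norm_exp]
  congr 1
  rw [show Real.pi * I * s * (I * t) = ((-(Real.pi * t) : ℝ) : ℂ) * s by
    push_cast; linear_combination (Real.pi * t * s) * I_mul_I, Complex.re_ofReal_mul]
  ring

lemma LaplaceKernel.continuousOn_laplace (hk : LaplaceKernel κ n f ψ ψS) (s : ℂ) :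
    ContinuousOn (fun t : ℝ ↦ ψ (I * t) * cexp (Real.pi * I * s * (I * t))) (Ioi 0) := by
  refine ContinuousOn.mul (fun t ht ↦ ?_) (by fun_prop)
  exact (ContinuousAt.comp (f := fun t : ℝ ↦ I * (t : ℂ))
    (hk.differentiableAt _ (by rw [im_I_mul]; exact ht)).continuousAt
    (by fun_prop)).continuousWithinAt

lemma LaplaceKernel.norm_laplace_le {C : ℝ} {k : ℕ}
    (hC : ∀ t : ℝ, 0 < t → ‖ψ (I * t)‖ ≤ C * (t ^ k * Real.exp (2 * Real.pi * n * t))) (s : ℂ)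
    {t : ℝ} (ht : 0 < t) : ‖ψ (I * t) * cexp (Real.pi * I * s * (I * t))‖ ≤
      C * (t ^ k * Real.exp (-(Real.pi * (s.re - 2 * n) * t))) := by
  rw [norm_mul, norm_exp_laplace]
  calc ‖ψ (I * t)‖ * Real.exp (-(Real.pi * s.re * t)) ≤
      C * (t ^ k * Real.exp (2 * Real.pi * n * t)) * Real.exp (-(Real.pi * s.re * t)) := by
        gcongr
        exact hC t ht
    _ = C * (t ^ k * (Real.exp (2 * Real.pi * n * t) * Real.exp (-(Real.pi * s.re * t)))) := by ring
    _ = _ := by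
      rw [← Real.exp_add]
      congr 3
      ring

lemma LaplaceKernel.integrableOn_laplace (hk : LaplaceKernel κ n f ψ ψS) {s : ℂ}
    (hs : 2 * n < s.re) :
    IntegrableOn (fun t : ℝ ↦ ψ (I * t) * cexp (Real.pi * I * s * (I * t))) (Ioi 0) := by
  obtain ⟨C, -, hC⟩ := hk.exists_norm_le 0
  have hpos : 0 < Real.pi * (s.re - 2 * n) := mul_pos Real.pi_pos (by linarith)
  refine Integrable.mono' ((integrableOn_pow_mul_exp hpos 0).const_mul C)
    ((hk.continuousOn_laplace s).aestronglyMeasurable measurableSet_Ioi) ?_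
  filter_upwards [ae_restrict_mem measurableSet_Ioi] with t ht
  exact norm_laplace_le hC s ht

lemma LaplaceKernel.sub_one (hk : LaplaceKernel κ n f ψ ψS) {z : ℂ} (hz : 0 < z.im) :
    ψ (z - 1) = ψ z - ψS z - Real.pi * I * f z := by
  have hz' : 0 < (z - 1).im := by simpa using hz
  have h1 := hk.add_one _ hz'
  have h2 := hk.S_add_one _ hz'
  have h3 := hk.f_add_one _ hz'
  rw [sub_add_cancel] at h1 h2 h3
  linear_combination -h1 + h2 + Real.pi * I * h3

lemma LaplaceKernel.second_difference (hk : LaplaceKernel κ n f ψ ψS) {z : ℂ} (hz : 0 < z.im) :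
    ψS z = ψ z - 1 / 2 * ψ (z + 1) - 1 / 2 * ψ (z - 1) := by
  rw [hk.sub_one hz, hk.add_one z hz]; ring

lemma neg_four_mul_sin_sq (s : ℂ) :
    -4 * Complex.sin (Real.pi / 2 * s) ^ 2 = cexp (Real.pi * I * s) + cexp (-(Real.pi * I * s)) - 2 := by
  have e1 : cexp (Real.pi * I * s) = cexp (Real.pi / 2 * s * I) ^ 2 := by
    rw [← Complex.exp_nat_mul]; congr 1; push_cast; ring
  have e2 : cexp (-(Real.pi * I * s)) = cexp (-(Real.pi / 2 * s) * I) ^ 2 := by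
    rw [← Complex.exp_nat_mul]; congr 1; push_cast; ring
  have e3 : cexp (-(Real.pi / 2 * s) * I) * cexp (Real.pi / 2 * s * I) = 1 := by
    rw [← Complex.exp_add]; simp
  rw [Complex.sin, e1, e2]
  linear_combination (-(cexp (-(Real.pi / 2 * s) * I) - cexp (Real.pi / 2 * s * I)) ^ 2) * I_sq -
    2 * e3

/-- On `Re s > 2 n` the function `contU` is given by the Laplace transform of `ψ(i t)`. -/
theorem LaplaceKernel.contU_eq (hk : LaplaceKernel κ n f ψ ψS) {s : ℂ} (hs : 2 * n < s.re) :
    contU κ ψS s = -4 * Complex.sin (Real.pi / 2 * s) ^ 2 *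
      ∫ t in Ioi (0 : ℝ), ψ (I * t) * cexp (Real.pi * I * s * (I * t)) := by
  set E : ℂ → ℂ := fun z ↦ cexp (Real.pi * I * s * z) with hE
  have hEadd : ∀ x y, E (x + y) = E x * E y := fun x y ↦ by
    simp only [hE]; rw [← Complex.exp_add]; congr 1; ring
  have hEd : Differentiable ℂ E := by simp only [hE]; fun_prop
  have hgd : ∀ z : ℂ, 0 < z.im → DifferentiableAt ℂ (fun z ↦ ψ z * E z) z :=
    fun z hz ↦ (hk.differentiableAt z hz).mul (hEd z)
  -- A primitive replaces contour deformation: every piece becomes a difference of values of `G`,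
  -- and the identity reduces to algebra.
  obtain ⟨G, hG⟩ := exists_primitive (g := fun z ↦ ψ z * E z)
    fun z hz ↦ (hgd z hz).differentiableWithinAt
  obtain ⟨C₁, hC₁⟩ := hk.bound
  obtain ⟨C₂, hC₂⟩ := hk.bound_S
  have hpi := Real.pi_pos
  have hnormE : ∀ z, ‖E z‖ = Real.exp (-(Real.pi * s.re * z.im)) * Real.exp (-(Real.pi * s.im * z.re)) := by
    intro z
    simp only [hE]
    rw [Complex.norm_exp, ← Real.exp_add]
    congr 1
    simp
    ring
  obtain ⟨L, hL⟩ := exists_limit_vertical (C := C₁ * Real.exp (Real.pi * |s.im|))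
    (δ := Real.pi * (s.re - 2 * n)) hG (fun z hz ↦ (hgd z hz).continuousAt)
    (mul_pos hpi (by linarith)) fun z hz hre ↦ by
      rw [norm_mul, hnormE]
      have h1 : -(Real.pi * s.im * z.re) ≤ Real.pi * |s.im| := by
        have h2 := neg_le_abs (s.im * z.re)
        rw [abs_mul] at h2
        nlinarith [abs_nonneg s.im, mul_le_mul_of_nonneg_left hre (abs_nonneg s.im)]
      have h0 : 0 ≤ C₁ * Real.exp (2 * Real.pi * n * z.im) :=
        (norm_nonneg _).trans (hC₁ z hz hre)
      calc ‖ψ z‖ * (Real.exp (-(Real.pi * s.re * z.im)) * Real.exp (-(Real.pi * s.im * z.re)))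
          ≤ (C₁ * Real.exp (2 * Real.pi * n * z.im)) *
            (Real.exp (-(Real.pi * s.re * z.im)) * Real.exp (Real.pi * |s.im|)) := by
            gcongr
            exact hC₁ z hz hre
        _ = C₁ * Real.exp (Real.pi * |s.im|) * (Real.exp (2 * Real.pi * n * z.im) *
            Real.exp (-(Real.pi * s.re * z.im))) := by ring
        _ = _ := by
          rw [← Real.exp_add]
          congr 2
          ring
  -- The integrand in the coordinate `v = -1/z`; `L₀` below is the limit of `G` at the cusp `0`.
  set g₂ : ℂ → ℂ := fun v ↦ ψS v / v ^ (κ + 2) * E (-1 / v) with hg₂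
  have hg₂c : ∀ z : ℂ, 0 < z.im → ContinuousAt g₂ z := fun z hz ↦ by
    have hz0 := ne_zero_of_im_pos hz
    refine ContinuousAt.mul (ContinuousAt.div (hk.differentiableAt_S z hz).continuousAt
      (by fun_prop) (pow_ne_zero _ hz0)) ?_
    exact ContinuousAt.comp (g := E) hEd.continuous.continuousAt
      (continuousAt_const.div continuousAt_id hz0)
  have hH : ∀ z : ℂ, 0 < z.im → HasDerivAt (fun v ↦ G (-1 / v)) (g₂ z) z := fun z hz ↦ by
    have hz0 := ne_zero_of_im_pos hz
    have h1 : HasDerivAt (fun v : ℂ ↦ -1 / v) (1 / z ^ 2) z := by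
      have := (hasDerivAt_inv hz0).const_mul (-1)
      convert! this using 1
      field_simp
    have h2 := (hG (-1 / z) (im_neg_one_div hz)).comp z h1
    convert! h2 using 1
    simp only [hg₂]
    rw [← hk.slash z hz, pow_add]
    field_simp
  obtain ⟨L₀, hL₀⟩ := exists_limit_vertical (C := C₂ * (2 ^ (κ + 2) * Real.exp (2 * (Real.pi * ‖s‖))))
    (δ := Real.pi) hH hg₂c hpi fun z hz hre ↦ by
      have hzn : 1 / 2 ≤ ‖z‖ := hz.trans ((le_abs_self _).trans (Complex.abs_im_le_norm z))
      have h1 : ‖E (-1 / z)‖ ≤ Real.exp (2 * (Real.pi * ‖s‖)) := by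
        refine (Complex.norm_exp_le_exp_norm _).trans (Real.exp_le_exp.2 ?_)
        rw [norm_mul, norm_mul, norm_mul, norm_I, Complex.norm_real,
          Real.norm_of_nonneg hpi.le, norm_div, norm_neg, norm_one, mul_one, mul_comm]
        gcongr
        rw [div_le_iff₀ (by linarith)]
        linarith
      have h2 : 1 ≤ 2 ^ (κ + 2) * ‖z‖ ^ (κ + 2) := by
        rw [← mul_pow]
        exact one_le_pow₀ (by linarith)
      have h3 := hC₂ z hz
      simp only [hg₂]
      rw [norm_mul, norm_div, norm_pow]
      have h4 : ‖ψS z‖ / ‖z‖ ^ (κ + 2) ≤ C₂ * Real.exp (-(Real.pi * z.im)) * 2 ^ (κ + 2) := by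
        rw [div_le_iff₀ (by positivity)]
        have h5 := (norm_nonneg _).trans h3
        calc ‖ψS z‖ ≤ C₂ * Real.exp (-(Real.pi * z.im)) * 1 := by rw [mul_one]; exact h3
          _ ≤ C₂ * Real.exp (-(Real.pi * z.im)) * (2 ^ (κ + 2) * ‖z‖ ^ (κ + 2)) := by gcongr
          _ = _ := by ring
      calc ‖ψS z‖ / ‖z‖ ^ (κ + 2) * ‖E (-1 / z)‖ ≤
          (C₂ * Real.exp (-(Real.pi * z.im)) * 2 ^ (κ + 2)) * Real.exp (2 * (Real.pi * ‖s‖)) := by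
            refine mul_le_mul h4 h1 (norm_nonneg _) (le_trans (by positivity) h4)
        _ = _ := by ring
  have harc : ∀ a c : ℝ, |c| ≤ 1 → 1 / 2 ≤ a →
      arcPart κ ψS a c s = E (2 * c) * (L₀ - G (-1 / (c + I * a))) := by
    intro a c hc ha
    rw [← ((hL₀ c hc).2 a ha).2, arcPart, gaussSuper, ← integral_const_mul]
    refine integral_congr_ae (Eventually.of_forall fun t ↦ ?_)
    have : cexp (Real.pi * I * s * (2 * c - 1 / (c + I * t))) = E (2 * c) * E (-1 / (c + I * t)) := by
      rw [← hEadd]; simp only [hE]; congr 2; ring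
    simp only [kerW, hg₂, this]
    ring
  -- `ψS` is replaced by the second difference of `ψ`; the factors `E(±1)` compensate for moving the
  -- shifted terms to the lines `Re z = ±1`.
  have hray : rayPart ψS s = (L - G (I * (1 : ℝ))) - 1 / 2 * E (-1) * (L - G (1 + I * (1 : ℝ))) -
      1 / 2 * E 1 * (L - G (-1 + I * (1 : ℝ))) := by
    have l0 := (hL 0 (by simp)).2 1 (by norm_num)
    have l1 := (hL 1 (by simp)).2 1 (by norm_num)
    have l2 := (hL (-1) (by simp)).2 1 (by norm_num)
    simp only [ofReal_zero, zero_add, ofReal_neg, ofReal_one] at l0 l1 l2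
    rw [ofReal_one, ← l0.2, ← l1.2, ← l2.2, ← integral_const_mul, ← integral_const_mul,
      ← integral_sub, ← integral_sub]
    · rw [rayPart, gaussSuper]
      refine setIntegral_congr_fun measurableSet_Ioi fun t ht ↦ ?_
      have ht' : (1 : ℝ) < t := ht
      have hz : 0 < (I * (t : ℂ)).im := by rw [im_I_mul]; linarith
      have e1 : E (1 + I * t) = E 1 * E (I * t) := hEadd _ _
      have e2 : E (-1 + I * t) = E (-1) * E (I * t) := hEadd _ _
      have e3 : E (-1) * E 1 = 1 := by rw [← hEadd]; simp [hE]
      change I * ψS (I * t) * E (I * t) = _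
      rw [hk.second_difference hz]
      rw [e1, e2, show I * (t : ℂ) + 1 = 1 + I * t by ring, show I * (t : ℂ) - 1 = -1 + I * t by ring]
      linear_combination (1 / 2 * I * ψ (1 + I * t) * E (I * t) +
        1 / 2 * I * ψ (-1 + I * t) * E (I * t)) * e3
    · exact l0.1.sub (l1.1.const_mul _)
    · exact l2.1.const_mul _
    · exact l0.1
    · exact l1.1.const_mul _
  have hlap : ∫ t in Ioi (0 : ℝ), I * (ψ (I * t) * E (I * t)) = L - L₀ := by
    -- `G` carries no information outside the upper half-plane, so its limit at the cusp is inserted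
    -- at `t = 0`.
    set Gt : ℝ → ℂ := fun t ↦ if t ≤ 0 then L₀ else G (I * t) with hGt
    have hGt0 : Gt 0 = L₀ := by simp [hGt]
    have hGtp : ∀ t, 0 < t → Gt t = G (I * t) := fun t ht ↦ by simp [hGt, ht]
    rw [← hGt0]
    refine integral_Ioi_of_hasDerivAt_of_tendsto ?_ ?_ ?_ ?_
    · rw [← continuousWithinAt_Ioi_iff_Ici, ContinuousWithinAt, hGt0]
      have h1 := (hL₀ 0 (by simp)).1.comp tendsto_inv_nhdsGT_zero
      refine h1.congr' ?_
      filter_upwards [self_mem_nhdsWithin] with t ht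
      rw [hGtp t ht]
      simp only [Function.comp, ofReal_zero, zero_add]
      rw [neg_one_div_I_mul, inv_inv]
    · intro t ht
      have ht' : 0 < t := ht
      have h1 : HasDerivAt (fun t : ℝ ↦ G (I * t)) (I * (ψ (I * t) * E (I * t))) t := by
        have h2 := hasDerivAt_line 0 t
        simp only [ofReal_zero, zero_add] at h2
        have h3 := (hG (I * t) (by rw [im_I_mul]; exact ht')).comp_of_eq t h2 rfl
        rw [mul_comm]
        exact h3
      refine h1.congr_of_eventuallyEq ?_
      filter_upwards [lt_mem_nhds ht'] with r hr using hGtp r hr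
    · exact (hk.integrableOn_laplace hs).const_mul I
    · have h1 := (hL 0 (by simp)).1
      simp only [ofReal_zero, zero_add] at h1
      refine h1.congr' ?_
      filter_upwards [eventually_gt_atTop 0] with t ht using (hGtp t ht).symm
  rw [integral_const_mul] at hlap
  have hlap' : ∫ t in Ioi (0 : ℝ), ψ (I * t) * cexp (Real.pi * I * s * (I * t)) =
      -I * (L - L₀) := by
    rw [← hlap]
    linear_combination (∫ t in Ioi (0 : ℝ), ψ (I * t) * E (I * t)) * I_mul_I
  -- In the unshifted variable the arcs start at `1 + i`, `-1 + i` and `i`, the same points as the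
  -- three vertical pieces of the ray, so these values of `G` cancel.
  have p1 : -1 / (((-(1 / 2) : ℝ) : ℂ) + I * ((1 / 2 : ℝ) : ℂ)) = 1 + I * (1 : ℝ) := by
    have : ((-(1 / 2) : ℝ) : ℂ) + I * ((1 / 2 : ℝ) : ℂ) ≠ 0 :=
      ne_zero_of_im_pos (by rw [line_im]; norm_num)
    rw [div_eq_iff this]
    push_cast
    linear_combination -(1 / 2) * I_mul_I
  have p2 : -1 / (((1 / 2 : ℝ) : ℂ) + I * ((1 / 2 : ℝ) : ℂ)) = -1 + I * (1 : ℝ) := by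
    have : ((1 / 2 : ℝ) : ℂ) + I * ((1 / 2 : ℝ) : ℂ) ≠ 0 :=
      ne_zero_of_im_pos (by rw [line_im]; norm_num)
    rw [div_eq_iff this]
    push_cast
    linear_combination -(1 / 2) * I_mul_I
  have p3 : -1 / (((0 : ℝ) : ℂ) + I * ((1 : ℝ) : ℂ)) = I * (1 : ℝ) := by
    rw [ofReal_zero, zero_add, neg_one_div_I_mul, inv_one]
  rw [hlap', neg_four_mul_sin_sq, contU, hray, harc _ _ (by rw [abs_neg, abs_of_pos] <;> norm_num) le_rfl,
    harc _ _ (by rw [abs_of_pos] <;> norm_num) le_rfl, harc 1 0 (by simp) (by norm_num), p1, p2, p3]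
  have q1 : E (2 * ((-(1 / 2) : ℝ) : ℂ)) = E (-1) := by congr 1; push_cast; ring
  have q2 : E (2 * ((1 / 2 : ℝ) : ℂ)) = E 1 := by congr 1; push_cast; ring
  have q3 : E (2 * ((0 : ℝ) : ℂ)) = 1 := by simp [hE]
  have q4 : cexp (Real.pi * I * s) = E 1 := by simp [hE]
  have q5 : cexp (-(Real.pi * I * s)) = E (-1) := by simp [hE]
  rw [q1, q2, q3, q4, q5]
  ring

end Kernel

end FourierEigen

end

noncomputable section

namespace FourierEigen

open Complex Filter Topology MeasureTheory Set

/-! ### Schwartz functions from holomorphic functions -/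

lemma isOpen_halfPlane (a : ℝ) : IsOpen {s : ℂ | a < s.re} := isOpen_lt continuous_const continuous_re

lemma analyticOnNhd_halfPlane {U : ℂ → ℂ} {a : ℝ} (hU : ∀ s : ℂ, a < s.re → DifferentiableAt ℂ U s) :
    AnalyticOnNhd ℂ U {s : ℂ | a < s.re} :=
  DifferentiableOn.analyticOnNhd (fun s hs ↦ (hU s hs).differentiableWithinAt) (isOpen_halfPlane a)

lemma iteratedDeriv_re {U : ℂ → ℂ} {a : ℝ} (hU : ∀ s : ℂ, a < s.re → DifferentiableAt ℂ U s) (m : ℕ) :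
    ∀ s : ℝ, a < s → iteratedDeriv m (fun s : ℝ ↦ (U s).re) s = (iteratedDeriv m U s).re := by
  induction m with
  | zero => intro s _; simp
  | succ m ih =>
    intro s hs
    rw [iteratedDeriv_succ, iteratedDeriv_succ]
    have h1 : DifferentiableAt ℂ (iteratedDeriv m U) s := by
      rw [iteratedDeriv_eq_iterate]
      exact ((analyticOnNhd_halfPlane hU s (by simpa using hs)).iterated_deriv m).differentiableAt
    have h2 : iteratedDeriv m (fun s : ℝ ↦ (U s).re) =ᶠ[𝓝 s]
        fun s : ℝ ↦ (iteratedDeriv m U s).re := by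
      filter_upwards [lt_mem_nhds hs] with r hr using ih r hr
    rw [h2.deriv_eq]
    exact h1.hasDerivAt.real_of_complex.deriv

lemma contDiffAt_re {U : ℂ → ℂ} {a : ℝ} (hU : ∀ s : ℂ, a < s.re → DifferentiableAt ℂ U s) {s : ℝ}
    (hs : a < s) {m : ℕ∞} : ContDiffAt ℝ m (fun s : ℝ ↦ (U s).re) s :=
  ((analyticOnNhd_halfPlane hU s (by simpa using hs)).contDiffAt (n := m)).real_of_complex

/-- A holomorphic function on `Re s > -1/2` of rapid decay in a horizontal strip coincides on
`[0, ∞)` with a Schwartz function, up to taking real parts. -/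
lemma exists_schwartz {U : ℂ → ℂ} (hU : ∀ s : ℂ, -(1 / 2) < s.re → DifferentiableAt ℂ U s) {R : ℝ}
    (hR : 1 ≤ R) (hdecay : ∀ k : ℕ, ∃ C : ℝ, ∀ w : ℂ, R ≤ w.re → |w.im| ≤ 1 →
      ‖U w‖ * w.re ^ k ≤ C) : ∃ h : 𝓢(ℝ, ℝ), ∀ s : ℝ, 0 ≤ s → h s = (U s).re := by
  set u : ℝ → ℝ := fun s ↦ (U s).re with hu
  -- The cutoff is `0` for `s ≤ -1/4` and `1` for `s ≥ 0`, inside the half-plane where `U` is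
  -- holomorphic.
  set h : ℝ → ℝ := fun s ↦ Real.smoothTransition (4 * s + 1) * u s with hh
  have hzero : ∀ s < -(1 / 4 : ℝ), h =ᶠ[𝓝 s] fun _ ↦ 0 := fun s hs ↦ by
    filter_upwards [gt_mem_nhds hs] with r hr
    simp only [hh]
    rw [Real.smoothTransition.zero_of_nonpos (by linarith), zero_mul]
  have hpos : ∀ s > (0 : ℝ), h =ᶠ[𝓝 s] u := fun s hs ↦ by
    filter_upwards [lt_mem_nhds hs] with r hr
    simp only [hh]
    rw [Real.smoothTransition.one_of_one_le (by linarith), one_mul]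
  have hsmooth : ∀ m : ℕ∞, ContDiff ℝ m h := fun m ↦ by
    rw [contDiff_iff_contDiffAt]
    intro s
    rcases lt_or_ge s (-(1 / 4)) with hs | hs
    · exact contDiffAt_const.congr_of_eventuallyEq (hzero s hs)
    · refine ContDiffAt.mul ?_ (contDiffAt_re hU (by linarith))
      exact (Real.smoothTransition.contDiff.comp (by fun_prop)).contDiffAt
  refine ⟨⟨h, hsmooth ⊤, fun k m ↦ ?_⟩, fun s hs ↦ ?_⟩
  · obtain ⟨C, hC⟩ := hdecay k
    have hcont : Continuous (fun s : ℝ ↦ ‖s‖ ^ k * ‖iteratedFDeriv ℝ m h s‖) := by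
      refine (continuous_norm.pow k).mul (Continuous.norm ?_)
      exact (hsmooth ⊤).continuous_iteratedFDeriv (by exact_mod_cast le_top)
    obtain ⟨C', hC'⟩ := (isCompact_Icc (a := (-1 : ℝ)) (b := R + 1)).exists_bound_of_continuousOn
      hcont.continuousOn
    refine ⟨max (max C' 0) (m.factorial * (C * 2 ^ k)), fun s ↦ ?_⟩
    rcases lt_or_ge s (-1) with h1 | h1
    · refine le_max_of_le_left (le_max_of_le_right (le_of_eq ?_))
      rw [norm_iteratedFDeriv_eq_norm_iteratedDeriv, (hzero s (by linarith)).iteratedDeriv_eq m]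
      simp
    rcases le_or_gt s (R + 1) with h2 | h2
    · refine le_max_of_le_left (le_max_of_le_left ?_)
      exact (le_abs_self _).trans (hC' s ⟨h1, h2⟩)
    · refine le_max_of_le_right ?_
      have hs0 : 0 < s := by linarith
      rw [norm_iteratedFDeriv_eq_norm_iteratedDeriv, (hpos s hs0).iteratedDeriv_eq m,
        iteratedDeriv_re hU m s (by linarith), Real.norm_of_nonneg hs0.le]
      have hball : ∀ w ∈ Metric.closedBall (s : ℂ) 1, s - 1 ≤ w.re ∧ |w.im| ≤ 1 := by
        intro w hw
        have h3 : ‖w - s‖ ≤ 1 := by simpa [dist_eq_norm] using hw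
        have h4 := (abs_le.1 ((Complex.abs_re_le_norm _).trans h3)).1
        have h5 := (Complex.abs_im_le_norm _).trans h3
        simp only [sub_re, ofReal_re, sub_im, ofReal_im, sub_zero] at h4 h5
        exact ⟨by linarith, h5⟩
      have hdc : DiffContOnCl ℂ U (Metric.ball (s : ℂ) 1) := by
        refine DifferentiableOn.diffContOnCl fun w hw ↦ ?_
        rw [closure_ball _ one_ne_zero] at hw
        exact (hU w (by linarith [(hball w hw).1])).differentiableWithinAt
      -- Cauchy's estimate on a unit circle gives all derivatives the decay of `U`; `2 ^ k` enters
      -- because `s ≤ 2 Re w` there.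
      have h6 := Complex.norm_iteratedDeriv_le_of_forall_mem_sphere_norm_le m one_pos hdc
        (C := C * 2 ^ k / s ^ k) fun w hw ↦ by
          obtain ⟨h7, h8⟩ := hball w (Metric.sphere_subset_closedBall hw)
          have h9 := hC w (by linarith) h8
          rw [le_div_iff₀ (by positivity)]
          calc ‖U w‖ * s ^ k ≤ ‖U w‖ * (w.re * 2) ^ k := by gcongr; linarith
            _ = ‖U w‖ * w.re ^ k * 2 ^ k := by rw [mul_pow]; ring
            _ ≤ C * 2 ^ k := by gcongr
      rw [one_pow, div_one] at h6
      calc s ^ k * ‖(iteratedDeriv m U s).re‖ ≤ s ^ k * (m.factorial * (C * 2 ^ k / s ^ k)) := by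
            gcongr
            exact (Complex.abs_re_le_norm _).trans h6
        _ = _ := by field_simp
  · change h s = u s
    simp only [hh]
    rw [Real.smoothTransition.one_of_one_le (by linarith), one_mul]

/-! ### Decay, reality and zeros of the continuation -/

section Kernel

variable {κ n : ℕ} {f ψ ψS : ℂ → ℂ}

/-- The Laplace transform of `ψ(i t)`. -/
def lap (ψ : ℂ → ℂ) (s : ℂ) : ℂ := ∫ t in Ioi (0 : ℝ), ψ (I * t) * cexp (Real.pi * I * s * (I * t))

/-- A bound `t^k` on `ψ` near `0` turns into decay of order `k` of its Laplace transform, and `k` is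
arbitrary. -/
lemma LaplaceKernel.exists_norm_lap_le (hk : LaplaceKernel κ n f ψ ψS) (k : ℕ) :
    ∃ C : ℝ, ∀ w : ℂ, 2 * n + 1 ≤ w.re → ‖lap ψ w‖ * (w.re - 2 * n) ^ k ≤ C := by
  obtain ⟨C, hC0, hC⟩ := hk.exists_norm_le k
  have hi := integrableOn_pow_mul_exp (a := 2) (by norm_num) 0
  simp only [pow_zero, one_mul] at hi
  refine ⟨C * k.factorial * ∫ t in Ioi (0 : ℝ), Real.exp (-(2 * t)), fun w hw ↦ ?_⟩
  set x := w.re - 2 * n with hx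
  have hx1 : 1 ≤ x := by rw [hx]; linarith
  have hb : ∀ᵐ t : ℝ ∂volume.restrict (Ioi (0 : ℝ)), ‖ψ (I * t) * cexp (Real.pi * I * w * (I * t))‖ ≤
      C * k.factorial / x ^ k * Real.exp (-(2 * t)) := by
    filter_upwards [ae_restrict_mem measurableSet_Ioi] with t ht
    have ht0 : 0 < t := ht
    refine (norm_laplace_le hC w ht0).trans ?_
    have h1 := Real.pow_div_factorial_le_exp (x * t) (by positivity) k
    have hkf : (0 : ℝ) < k.factorial := by exact_mod_cast k.factorial_pos
    rw [div_le_iff₀ hkf] at h1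
    rw [mul_div_assoc, mul_assoc C]
    refine mul_le_mul_of_nonneg_left ?_ hC0
    rw [div_mul_eq_mul_div, le_div_iff₀ (by positivity)]
    calc t ^ k * Real.exp (-(Real.pi * x * t)) * x ^ k =
        (x * t) ^ k * Real.exp (-(Real.pi * x * t)) := by rw [mul_pow]; ring
      _ ≤ (Real.exp (x * t) * k.factorial) * Real.exp (-(Real.pi * x * t)) := by gcongr
      _ = k.factorial * (Real.exp (x * t) * Real.exp (-(Real.pi * x * t))) := by ring
      _ ≤ k.factorial * Real.exp (-(2 * t)) := by
        rw [← Real.exp_add]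
        gcongr
        have h3 := Real.pi_gt_three
        have h4 : t ≤ x * t := by nlinarith
        nlinarith
  have h2 := norm_integral_le_of_norm_le (hi.const_mul _) hb
  rw [integral_const_mul] at h2
  calc ‖lap ψ w‖ * x ^ k ≤ (C * k.factorial / x ^ k * ∫ t in Ioi (0 : ℝ), Real.exp (-(2 * t))) * x ^ k := by
        gcongr
        exact h2
    _ = _ := by field_simp

lemma norm_sin_factor_le {w : ℂ} (hw : |w.im| ≤ 1) :
    ‖-4 * Complex.sin (Real.pi / 2 * w) ^ 2‖ ≤ 2 * Real.exp Real.pi + 2 := by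
  rw [neg_four_mul_sin_sq]
  have h1 := abs_le.1 hw
  have hpi := Real.pi_pos
  have e1 : ‖cexp (Real.pi * I * w)‖ ≤ Real.exp Real.pi := by
    rw [Complex.norm_exp, Real.exp_le_exp]
    simp
    nlinarith
  have e2 : ‖cexp (-(Real.pi * I * w))‖ ≤ Real.exp Real.pi := by
    rw [Complex.norm_exp, Real.exp_le_exp]
    simp
    nlinarith
  calc ‖cexp (Real.pi * I * w) + cexp (-(Real.pi * I * w)) - 2‖ ≤
      ‖cexp (Real.pi * I * w)‖ + ‖cexp (-(Real.pi * I * w))‖ + ‖(2 : ℂ)‖ :=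
        (norm_sub_le _ _).trans (by gcongr; exact norm_add_le _ _)
    _ ≤ _ := by
      have : ‖(2 : ℂ)‖ = 2 := by simp
      rw [this]; linarith

lemma LaplaceKernel.exists_norm_contU_le (hk : LaplaceKernel κ n f ψ ψS) (k : ℕ) :
    ∃ C : ℝ, ∀ w : ℂ, (2 * n + 1 : ℝ) ≤ w.re → |w.im| ≤ 1 → ‖contU κ ψS w‖ * w.re ^ k ≤ C := by
  obtain ⟨C, hC⟩ := hk.exists_norm_lap_le k
  refine ⟨(2 * Real.exp Real.pi + 2) * (C * (2 * n + 1) ^ k), fun w hw him ↦ ?_⟩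
  have h1 := hC w hw
  have h2 : w.re ≤ (w.re - 2 * n) * (2 * n + 1) := by
    have : (0 : ℝ) ≤ n := Nat.cast_nonneg n
    nlinarith
  have h0 : 0 ≤ w.re := by
    have : (0 : ℝ) ≤ n := Nat.cast_nonneg n
    linarith
  rw [hk.contU_eq (by linarith), norm_mul, mul_assoc]
  change _ * (‖lap ψ w‖ * _) ≤ _
  refine mul_le_mul (norm_sin_factor_le him) ?_ (by positivity) (by positivity)
  calc ‖lap ψ w‖ * w.re ^ k ≤ ‖lap ψ w‖ * ((w.re - 2 * n) * (2 * n + 1)) ^ k := by gcongr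
    _ = ‖lap ψ w‖ * (w.re - 2 * n) ^ k * (2 * n + 1) ^ k := by rw [mul_pow]; ring
    _ ≤ _ := by gcongr

/-- Schwarz reflection: `contU` agrees with its conjugate reflection on real `s > 2n`, where the
Laplace integrand is real, hence on the whole half-plane. -/
lemma LaplaceKernel.contU_im (hk : LaplaceKernel κ n f ψ ψS) {s : ℝ} (hs : -(1 / 2) < s) :
    (contU κ ψS s).im = 0 := by
  have hU : ∀ s : ℂ, -(1 / 2) < s.re → DifferentiableAt ℂ (contU κ ψS) s :=
    fun s hs ↦ differentiableAt_contU hk hs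
  set A : ℂ → ℂ := fun s ↦ (starRingEnd ℂ) (contU κ ψS ((starRingEnd ℂ) s)) with hA
  have hAd : ∀ s : ℂ, -(1 / 2) < s.re → DifferentiableAt ℂ A s := fun s hs ↦ by
    have h1 := (hU ((starRingEnd ℂ) s) (by simpa using hs)).conj_conj
    rwa [Complex.conj_conj] at h1
  have hreal : ∀ x : ℝ, 2 * n < x → A x = contU κ ψS x := fun x hx ↦ by
    simp only [hA]
    rw [Complex.conj_ofReal, hk.contU_eq (by simpa using hx), map_mul, map_mul, map_pow,
      ← Complex.sin_conj, ← integral_conj]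
    congr 1
    · have h2 : (starRingEnd ℂ) 2 = 2 := Complex.conj_ofNat 2
      have h4 : (starRingEnd ℂ) 4 = 4 := Complex.conj_ofNat 4
      simp [h2, h4]
    · refine setIntegral_congr_fun measurableSet_Ioi fun t ht ↦ ?_
      rw [map_mul, Complex.conj_eq_iff_im.2 (hk.im_eq_zero t ht), ← Complex.exp_conj]
      congr 2
      simp
  have heq : EqOn A (contU κ ψS) {s : ℂ | -(1 / 2) < s.re} := by
    have hz : (((2 * n + 1 : ℝ)) : ℂ) ∈ {s : ℂ | -(1 / 2) < s.re} := by
      change -(1 / 2) < ((2 * n + 1 : ℝ) : ℂ).re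
      rw [ofReal_re]
      have : (0 : ℝ) ≤ n := Nat.cast_nonneg n
      linarith
    refine (analyticOnNhd_halfPlane hAd).eqOn_of_preconnected_of_frequently_eq
      (analyticOnNhd_halfPlane hU) (convex_halfSpace_re_gt _).isPreconnected hz ?_
    have ht : Tendsto (fun x : ℝ ↦ (x : ℂ)) (𝓝[≠] (2 * n + 1 : ℝ)) (𝓝[≠] ((2 * n + 1 : ℝ) : ℂ)) := by
      refine tendsto_nhdsWithin_iff.2 ⟨(continuous_ofReal.tendsto _).mono_left nhdsWithin_le_nhds, ?_⟩
      filter_upwards [self_mem_nhdsWithin] with x hx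
      exact fun h ↦ hx (ofReal_injective h)
    refine ht.frequently (Eventually.frequently ?_)
    have : Ioi (2 * n : ℝ) ∈ 𝓝[≠] (2 * n + 1 : ℝ) :=
      nhdsWithin_le_nhds (Ioi_mem_nhds (by linarith))
    filter_upwards [this] with x hx using hreal x hx
  have h1 := heq (show (s : ℂ) ∈ {s : ℂ | -(1 / 2) < s.re} by simpa using hs)
  simp only [hA, Complex.conj_ofReal] at h1
  exact Complex.conj_eq_iff_im.1 h1

end Kernel

end FourierEigen

end

/-! ### Zeros at even integers -/

noncomputable section

namespace FourierEigen

open Complex Filter Topology MeasureTheory Set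

section Kernel

variable {κ n : ℕ} {f ψ ψS : ℂ → ℂ}

/-- Near `2m` the sine factor is `-π²(s-2m)²` to leading order. Multiplied by a Laplace transform
behaving like `ℓ/(s-2m)`, it gives a zero with derivative `-π²ℓ`. Limits from the right suffice
because `contU` is known to be differentiable. -/
lemma LaplaceKernel.contU_zero (hk : LaplaceKernel κ n f ψ ψS) {m : ℕ} (hnm : n ≤ m) {ℓ : ℂ}
    (hℓ : Tendsto (fun s : ℝ ↦ ((s - 2 * m : ℝ) : ℂ) * lap ψ s) (𝓝[>] (2 * m : ℝ)) (𝓝 ℓ)) :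
    contU κ ψS ((2 * m : ℝ) : ℂ) = 0 ∧
      HasDerivAt (contU κ ψS) (-(Real.pi ^ 2 * ℓ)) ((2 * m : ℝ) : ℂ) := by
  have hnm' : (n : ℝ) ≤ m := by exact_mod_cast hnm
  have hn0 : (0 : ℝ) ≤ n := Nat.cast_nonneg n
  have hle : 𝓝[>] (2 * m : ℝ) ≤ 𝓝[≠] (2 * m : ℝ) :=
    nhdsWithin_mono _ fun x hx ↦ ne_of_gt hx
  set U : ℝ → ℂ := fun x ↦ contU κ ψS x with hU
  have hd : DifferentiableAt ℂ (contU κ ψS) ((2 * m : ℝ) : ℂ) :=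
    differentiableAt_contU hk (by rw [ofReal_re]; linarith)
  have hd' : HasDerivAt U (deriv (contU κ ψS) ((2 * m : ℝ) : ℂ)) (2 * m : ℝ) :=
    hd.hasDerivAt.comp_ofReal
  have hsin0 : Complex.sin (Real.pi / 2 * ((2 * m : ℝ) : ℂ)) = 0 := by
    rw [show (Real.pi / 2 * ((2 * m : ℝ) : ℂ) : ℂ) = m * Real.pi by push_cast; ring]
    exact Complex.sin_nat_mul_pi m
  have hsin : Tendsto (fun s : ℝ ↦ ((s - 2 * m : ℝ) : ℂ)⁻¹ * Complex.sin (Real.pi / 2 * s))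
      (𝓝[>] (2 * m : ℝ)) (𝓝 (Complex.cos (m * Real.pi) * (Real.pi / 2))) := by
    have h1 : HasDerivAt (fun s : ℂ ↦ Complex.sin (Real.pi / 2 * s))
        (Complex.cos (Real.pi / 2 * ((2 * m : ℝ) : ℂ)) * (Real.pi / 2)) ((2 * m : ℝ) : ℂ) := by
      have := ((hasDerivAt_id ((2 * m : ℝ) : ℂ)).const_mul (Real.pi / 2 : ℂ)).csin
      simpa using this
    have h2 := (hasDerivAt_iff_tendsto_slope.1 h1.comp_ofReal).mono_left hle
    rw [show (Real.pi / 2 * ((2 * m : ℝ) : ℂ) : ℂ) = m * Real.pi by push_cast; ring] at h2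
    refine h2.congr fun s ↦ ?_
    rw [slope_def_module, hsin0, sub_zero, Complex.real_smul, ofReal_inv]
  have hcos : Complex.cos (m * Real.pi) ^ 2 = 1 := by
    have := Complex.sin_sq_add_cos_sq (m * Real.pi)
    rw [Complex.sin_nat_mul_pi] at this
    simpa using this
  have hquot : Tendsto (fun s : ℝ ↦ ((s - 2 * m : ℝ) : ℂ)⁻¹ * U s) (𝓝[>] (2 * m : ℝ))
      (𝓝 (-(Real.pi ^ 2 * ℓ))) := by
    have h1 := ((hsin.pow 2).mul hℓ).const_mul (-4)
    rw [mul_pow, hcos] at h1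
    rw [show -(Real.pi ^ 2 * ℓ) = -4 * (1 * (Real.pi / 2 : ℂ) ^ 2 * ℓ) by ring]
    refine h1.congr' ?_
    filter_upwards [self_mem_nhdsWithin] with s hs
    have hs' : (2 * m : ℝ) < s := hs
    have hne : ((s - 2 * m : ℝ) : ℂ) ≠ 0 := by
      rw [Complex.ofReal_ne_zero]; linarith
    simp only [hU]
    rw [hk.contU_eq (by rw [ofReal_re]; linarith)]
    change _ = _ * (_ * lap ψ s)
    field_simp
  have hU0 : U (2 * m : ℝ) = 0 := by
    have h1 : Tendsto U (𝓝[>] (2 * m : ℝ)) (𝓝 (U (2 * m : ℝ))) :=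
      hd'.continuousAt.tendsto.mono_left nhdsWithin_le_nhds
    have h2 : Tendsto (fun s : ℝ ↦ ((s - 2 * m : ℝ) : ℂ)) (𝓝[>] (2 * m : ℝ)) (𝓝 0) := by
      have : Continuous fun s : ℝ ↦ ((s - 2 * m : ℝ) : ℂ) := by fun_prop
      have h := (this.tendsto (2 * m : ℝ)).mono_left (nhdsWithin_le_nhds (s := Ioi (2 * m : ℝ)))
      simpa using h
    have h3 := h2.mul hquot
    rw [zero_mul] at h3
    refine tendsto_nhds_unique h1 (h3.congr' ?_)
    filter_upwards [self_mem_nhdsWithin] with s hs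
    have hs' : (2 * m : ℝ) < s := hs
    have hne : ((s - 2 * m : ℝ) : ℂ) ≠ 0 := by
      rw [Complex.ofReal_ne_zero]; linarith
    rw [← mul_assoc, mul_inv_cancel₀ hne, one_mul]
  refine ⟨hU0, ?_⟩
  have h1 := (hasDerivAt_iff_tendsto_slope.1 hd').mono_left hle
  have h2 : deriv (contU κ ψS) ((2 * m : ℝ) : ℂ) = -(Real.pi ^ 2 * ℓ) := by
    refine tendsto_nhds_unique h1 (hquot.congr fun s ↦ ?_)
    rw [slope_def_module, hU0, sub_zero, Complex.real_smul, ofReal_inv]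
  rw [← h2]
  exact hd.hasDerivAt

lemma LaplaceKernel.tendsto_lap_of_lt (hk : LaplaceKernel κ n f ψ ψS) {m : ℕ} (hnm : n < m) :
    Tendsto (fun s : ℝ ↦ ((s - 2 * m : ℝ) : ℂ) * lap ψ s) (𝓝[>] (2 * m : ℝ)) (𝓝 0) := by
  obtain ⟨C, hC⟩ := hk.exists_norm_lap_le 0
  have hnm' : (n : ℝ) + 1 ≤ m := by exact_mod_cast hnm
  have h2 : Tendsto (fun s : ℝ ↦ ‖((s - 2 * m : ℝ) : ℂ)‖ * C) (𝓝[>] (2 * m : ℝ)) (𝓝 0) := by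
    have : Continuous fun s : ℝ ↦ ‖((s - 2 * m : ℝ) : ℂ)‖ * C := by fun_prop
    have h := (this.tendsto (2 * m : ℝ)).mono_left (nhdsWithin_le_nhds (s := Ioi (2 * m : ℝ)))
    simpa using h
  refine squeeze_zero_norm' ?_ h2
  filter_upwards [self_mem_nhdsWithin] with s hs
  have hs' : (2 * m : ℝ) < s := hs
  have h3 := hC s (by rw [ofReal_re]; linarith)
  rw [pow_zero, mul_one] at h3
  rw [norm_mul]
  gcongr

/-- An Abelian theorem: with `u = (s-2n)t` the integrand tends to `c exp(-πu)` under a fixed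
dominating function, so the transform has residue `c/π` at `2n`. -/
lemma LaplaceKernel.tendsto_lap (hk : LaplaceKernel κ n f ψ ψS) {c : ℂ}
    (hc : Tendsto (fun t : ℝ ↦ ψ (I * t) * Real.exp (-(2 * Real.pi * n * t))) atTop (𝓝 c)) :
    Tendsto (fun s : ℝ ↦ ((s - 2 * n : ℝ) : ℂ) * lap ψ s) (𝓝[>] (2 * n : ℝ)) (𝓝 (c / Real.pi)) := by
  obtain ⟨C, hC0, hC⟩ := hk.exists_norm_le 0
  have hpi := Real.pi_pos
  set φ : ℝ → ℂ := fun t ↦ ψ (I * t) * Real.exp (-(2 * Real.pi * n * t)) with hφ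
  have hφc : ContinuousOn φ (Ioi 0) := by
    refine ContinuousOn.mul (fun t ht ↦ ?_) (by fun_prop)
    exact (ContinuousAt.comp (f := fun t : ℝ ↦ I * (t : ℂ))
      (hk.differentiableAt _ (by rw [im_I_mul]; exact ht)).continuousAt
      (by fun_prop)).continuousWithinAt
  have hφb : ∀ t, 0 < t → ‖φ t‖ ≤ C := fun t ht ↦ by
    have h1 := hC t ht
    simp only [hφ]
    rw [norm_mul, Complex.norm_real, Real.norm_of_nonneg (Real.exp_pos _).le, Real.exp_neg,
      ← div_eq_mul_inv, div_le_iff₀ (Real.exp_pos _)]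
    simpa using h1
  have hlim : Tendsto (fun s : ℝ ↦ ∫ u in Ioi (0 : ℝ), φ ((s - 2 * n)⁻¹ * u) *
      Real.exp (-(Real.pi * u))) (𝓝[>] (2 * n : ℝ))
      (𝓝 (∫ u in Ioi (0 : ℝ), c * ((Real.exp (-(Real.pi * u)) : ℝ) : ℂ))) := by
    have hi := integrableOn_pow_mul_exp hpi 0
    simp only [pow_zero, one_mul] at hi
    refine tendsto_integral_filter_of_dominated_convergence
      (fun u ↦ C * Real.exp (-(Real.pi * u))) ?_ ?_ (hi.const_mul C) ?_
    · filter_upwards [self_mem_nhdsWithin] with s hs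
      have hs' : 0 < s - 2 * n := sub_pos.2 hs
      refine ContinuousOn.aestronglyMeasurable (ContinuousOn.mul ?_ (by fun_prop)) measurableSet_Ioi
      refine hφc.comp (by fun_prop) fun u hu ↦ ?_
      have hu' : 0 < u := hu
      exact mul_pos (inv_pos.2 hs') hu'
    · filter_upwards [self_mem_nhdsWithin] with s hs
      have hs' : 0 < s - 2 * n := sub_pos.2 hs
      filter_upwards [ae_restrict_mem measurableSet_Ioi] with u hu
      have hu' : 0 < u := hu
      rw [norm_mul, Complex.norm_real, Real.norm_of_nonneg (Real.exp_pos _).le]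
      gcongr
      exact hφb _ (mul_pos (inv_pos.2 hs') hu')
    · filter_upwards [ae_restrict_mem measurableSet_Ioi] with u hu
      have hu' : 0 < u := hu
      refine Tendsto.mul_const _ (hc.comp ?_)
      refine Tendsto.atTop_mul_const hu' (tendsto_inv_nhdsGT_zero.comp ?_)
      refine tendsto_nhdsWithin_iff.2 ⟨?_, ?_⟩
      · have : Continuous fun s : ℝ ↦ s - 2 * n := by fun_prop
        have h := (this.tendsto (2 * n : ℝ)).mono_left (nhdsWithin_le_nhds (s := Ioi (2 * n : ℝ)))
        simpa using h
      · filter_upwards [self_mem_nhdsWithin] with s hs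
        have hs' : (2 * n : ℝ) < s := hs
        exact sub_pos.2 hs'
  have hval : ∫ u in Ioi (0 : ℝ), c * ((Real.exp (-(Real.pi * u)) : ℝ) : ℂ) = c / Real.pi := by
    rw [integral_const_mul, integral_complex_ofReal]
    have h1 := integral_exp_mul_Ioi (a := -Real.pi) (by linarith) 0
    simp only [neg_mul] at h1
    rw [h1]
    simp
    ring
  rw [hval] at hlim
  refine hlim.congr' ?_
  filter_upwards [self_mem_nhdsWithin] with s hs
  have hs' : 0 < s - 2 * n := sub_pos.2 hs
  have h1 := integral_comp_mul_left_Ioi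
    (fun t : ℝ ↦ φ t * Real.exp (-(Real.pi * ((s - 2 * n) * t)))) 0 (inv_pos.2 hs')
  rw [mul_zero, inv_inv] at h1
  have h2 : ∀ u : ℝ, (s - 2 * n) * ((s - 2 * n)⁻¹ * u) = u := fun u ↦ by
    rw [← mul_assoc, mul_inv_cancel₀ hs'.ne', one_mul]
  simp only [h2] at h1
  rw [h1, Complex.real_smul]
  congr 1
  rw [lap]
  refine integral_congr_ae (Eventually.of_forall fun t ↦ ?_)
  simp only [hφ]
  rw [mul_assoc, ← ofReal_mul, ← Real.exp_add, ofReal_exp]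
  congr 2
  push_cast
  linear_combination (-(Real.pi * s * t : ℂ)) * I_mul_I

end Kernel

end FourierEigen

end

/-! ### Assembly of the theorem -/

theorem theorem4p3 (d : ℕ) (hd : 0 < d) (h4 : 4 ∣ d) (n : ℕ) (hn : n = d / 16 + 1) :
    ∃ (F : 𝓢(EuclideanSpace ℝ (Fin d), ℝ)) (g : ℝ → ℝ),
      -- `F` is radial with profile `g`
      (∀ x, F x = g ‖x‖) ∧
      -- `F` is a Fourier eigenfunction
      (∀ x, (F x : ℂ) = (-1 : ℂ) ^ (d / 4 + 1) *
        𝓕 (fun y : EuclideanSpace ℝ (Fin d) ↦ (F y : ℂ)) x) ∧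
      -- simple zero at `√(2n)`
      g (Real.sqrt (2 * n)) = 0 ∧
      (∃ c : ℝ, c ≠ 0 ∧ HasDerivAt g c (Real.sqrt (2 * n))) ∧
      -- zeros of order at least two at `√(2m)` for `m > n`
      (∀ m : ℕ, n < m →
        g (Real.sqrt (2 * m)) = 0 ∧ HasDerivAt g 0 (Real.sqrt (2 * m))) ∧
      -- `F` comes from a form for `Γ(2)` and a form for `SL(2, ℤ)` times `log λ`
      ∃ (f ω : ℍ → ℂ) (U : ℂ → ℂ),
        FourierEigen.IsWeaklyHolomorphic ⊤ (2 - ((d / 2 : ℕ) : ℤ)) f ∧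
        FourierEigen.IsWeaklyHolomorphic (CongruenceSubgroup.Gamma 2) (2 - ((d / 2 : ℕ) : ℤ)) ω ∧
        FourierEigen.IsLaplaceContinuation
          (fun z ↦ f z * FourierEigen.logLambda z + ω z) (2 * n) U ∧
        ∀ x, (F x : ℂ) = U ((‖x‖ ^ 2 : ℝ) : ℂ) := by
  obtain ⟨e, rfl⟩ := h4
  have he : 0 < e := by omega
  obtain ⟨f, ω, ψS, hf, hω, hk⟩ := FourierEigen.exists_kernel (n := n) he (by omega)
  set ψ : ℂ → ℂ := fun z ↦ f z * FourierEigen.logLam z + ω z with hψ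
  set κ := 2 * (e - 1) with hκ
  set U := FourierEigen.contU κ ψS with hU
  have hUd : ∀ s : ℂ, -(1 / 2) < s.re → DifferentiableAt ℂ U s :=
    fun s hs ↦ FourierEigen.differentiableAt_contU hk hs
  have hκe : κ + 2 = 2 * e := by omega
  obtain ⟨h, hh⟩ := FourierEigen.exists_schwartz hUd (R := 2 * n + 1)
    (by linarith [Nat.cast_nonneg (α := ℝ) n]) hk.exists_norm_contU_le
  -- Composition with `x ↦ ‖x‖²` preserves Schwartz functions because `‖x‖` is controlled by `1 +
  -- ‖x‖²`.
  have hup : ∃ (k : ℕ) (C : ℝ), ∀ x : EuclideanSpace ℝ (Fin (4 * e)),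
      ‖x‖ ≤ C * (1 + ‖‖x‖ ^ 2‖) ^ k := by
    refine ⟨1, 1, fun x ↦ ?_⟩
    rw [one_mul, pow_one, Real.norm_of_nonneg (by positivity)]
    nlinarith [sq_nonneg (‖x‖ - 1), norm_nonneg x]
  set F : 𝓢(EuclideanSpace ℝ (Fin (4 * e)), ℝ) :=
    SchwartzMap.compCLM ℝ (Function.hasTemperateGrowth_norm_sq _) hup h with hF
  have hFx : ∀ x, F x = (U ((‖x‖ ^ 2 : ℝ) : ℂ)).re := fun x ↦ hh _ (by positivity)
  have hFU : ∀ x, (F x : ℂ) = U ((‖x‖ ^ 2 : ℝ) : ℂ) := fun x ↦ by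
    have him := hk.contU_im (s := ‖x‖ ^ 2) (by linarith [sq_nonneg ‖x‖])
    rw [hFx]
    exact Complex.ext (by simp) (by rw [Complex.ofReal_im]; exact him.symm)
  set g : ℝ → ℝ := fun r ↦ (U ((r ^ 2 : ℝ) : ℂ)).re with hg
  have hgd : ∀ (m : ℕ) {D : ℂ}, HasDerivAt U D ((2 * m : ℝ) : ℂ) →
      HasDerivAt g (D.re * (2 * Real.sqrt (2 * m))) (Real.sqrt (2 * m)) := by
    intro m D hD
    have h0 : (0 : ℝ) ≤ 2 * m := by positivity
    have h1 : HasDerivAt (fun r : ℝ ↦ r ^ 2) (2 * Real.sqrt (2 * m)) (Real.sqrt (2 * m)) := by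
      simpa using hasDerivAt_pow 2 (Real.sqrt (2 * m))
    exact hD.real_of_complex.comp_of_eq _ h1 (Real.sq_sqrt h0).symm
  have hg0 : ∀ m : ℕ, U ((2 * m : ℝ) : ℂ) = 0 → g (Real.sqrt (2 * m)) = 0 := by
    intro m hm
    simp only [hg]
    rw [Real.sq_sqrt (by positivity), hm, Complex.zero_re]
  have hn1 : 0 < n := by omega
  refine ⟨F, g, hFx, fun x ↦ ?_, ?_, ?_, fun m hm ↦ ?_, fun z ↦ f z, fun z ↦ ω z, U, ?_, ?_, ?_, hFU⟩
  · have h1 : (fun y : EuclideanSpace ℝ (Fin (4 * e)) ↦ (F y : ℂ)) =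
        fun y ↦ U ((‖y‖ ^ 2 : ℝ) : ℂ) := funext hFU
    rw [h1, FourierEigen.fourier_contU hk hκe (by rw [finrank_euclideanSpace_fin]; omega), hFU,
      show 4 * e / 4 = e by omega, ← mul_assoc, ← mul_pow]
    simp [hU]
  · obtain ⟨c, -, hc⟩ := hk.asymp
    exact hg0 n (hk.contU_zero le_rfl (hk.tendsto_lap hc)).1
  · obtain ⟨c, hc0, hc⟩ := hk.asymp
    refine ⟨_, ?_, hgd n (hk.contU_zero le_rfl (hk.tendsto_lap hc)).2⟩
    -- `c` is a limit of real values. As only real parts enter `g`, this is what keeps the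
    -- derivative `-πc` visible there.
    have hcim : c.im = 0 := by
      have h1 := (Complex.continuous_im.tendsto c).comp hc
      refine tendsto_nhds_unique h1 (tendsto_const_nhds.congr' ?_)
      filter_upwards [Filter.eventually_gt_atTop 0] with t ht
      simp only [Function.comp]
      rw [Complex.im_mul_ofReal, hk.im_eq_zero t ht, zero_mul]
    have hcre : c.re ≠ 0 := fun h1 ↦ hc0 (Complex.ext h1 hcim)
    have hpi := Real.pi_ne_zero
    have h2 : -((Real.pi : ℂ) ^ 2 * (c / Real.pi)) = ((-Real.pi : ℝ) : ℂ) * c := by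
      have : (Real.pi : ℂ) ≠ 0 := by exact_mod_cast hpi
      push_cast
      field_simp
    rw [h2, Complex.re_ofReal_mul]
    have h3 : Real.sqrt (2 * n) ≠ 0 := by
      have : (0 : ℝ) < n := by exact_mod_cast hn1
      positivity
    exact mul_ne_zero (mul_ne_zero (neg_ne_zero.2 hpi) hcre) (mul_ne_zero two_ne_zero h3)
  · obtain ⟨h1, h2⟩ := hk.contU_zero hm.le (hk.tendsto_lap_of_lt hm)
    refine ⟨hg0 m h1, ?_⟩
    simpa using hgd m h2
  · convert! hf using 1
    omega
  · convert! hω using 1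
    omega
  · refine ⟨⟨1 / 2, by norm_num, fun s hs ↦ (hUd s hs).differentiableWithinAt⟩, fun s hs ↦ ?_⟩
    have hint : Set.EqOn (fun t : ℝ ↦ ψ (Complex.I * t) *
        Complex.exp (Real.pi * Complex.I * s * (Complex.I * t)))
        (FourierEigen.laplaceIntegrand (fun z ↦ f z * FourierEigen.logLambda z + ω z) s)
        (Set.Ioi 0) := by
      intro t ht
      have ht' : 0 < (Complex.I * (t : ℂ)).im := by rw [FourierEigen.im_I_mul]; exact ht
      simp only [FourierEigen.laplaceIntegrand, FourierEigen.logLambda_eq, hψ]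
      rw [UpperHalfPlane.ofComplex_apply_of_im_pos ht']
      congr 2
      linear_combination (Real.pi * s * t) * Complex.I_mul_I
    refine ⟨(hk.integrableOn_laplace hs).congr_fun hint measurableSet_Ioi, ?_⟩
    rw [← MeasureTheory.setIntegral_congr_fun measurableSet_Ioi hint]
    exact hk.contU_eq hs
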